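/- **Model.** Let $\Lambda\subset\mathbb Z^2$ be finite, $\partial^-\Lambda$ the set of sites of $\Lambda$ with a nearest neighbour outside $\Lambda$, and $\Lambda^-=\Lambda\setminus\partial^-\Lambda$. A configuration $\eta\in\mathcal X=\{0,1,2\}^\Lambda$ says which sites are empty ($0$) or hold a particle of type $1$ or $2$. An active bond of $\eta$ is a non-oriented nearest-neighbour pair in $\Lambda^-$ holding particles of different types; $B(\eta)$ is the number of active bonds, $n_i(\eta)$ the number of particles of type $i$, and $$H(\eta)=-U\,B(\eta)+\Delta_1 n_1(\eta)+\Delta_2 n_2(\eta),\qquad U>0,\quad 0<\Delta_1\le\Delta_2,\quad \Delta_1+\Delta_2<4U$$ (the metastable region). Write $\eta\sim\eta'$ if one of $\eta,\eta'$ arises from the other by moving a particle to an empty neighbouring site of $\Lambda$, or by creating a particle of either type at an empty site of $\partial^-\Lambda$. Kawasaki dynamics is the continuous-time Markov chain on $\mathcal X$ with rates $c_\beta(\eta,\eta')=e^{-\beta[H(\eta')-H(\eta)]_+}$ if $\eta\sim\eta'$ and $0$ otherwise. $E_\eta$ is expectation for the chain started at $\eta$, and $\tau_A=\inf\{t\ge0:\eta_t\in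 A,\ \exists\,0<s<t:\eta_s\notin A\}$. **Landscape.** A path is a finite sequence of configurations with consecutive ones related by $\sim$. $\Phi(A,B)$ is the minimum over paths from $A$ to $B$ of the maximum of $H$ along the path; optimal paths are those attaining it. The stability level is $V_\eta=\Phi(\eta,\{\xi:H(\xi)<H(\eta)\})-H(\eta)$, and $\mathcal X_{\rm stab}$ is the set of minimizers of $H$. Let $\square$ be the empty configuration, and let $\boxplus\subset\mathcal X$ be the full box, regarded as the (possibly one-element) set of configurations representing it; it is pinned down by (H1) below. Put $\Gamma^\star=\Phi(\square,\boxplus)-H(\square)$. A gate is a set $W$ of configurations of energy $\Phi(\square,\boxplus)$ lying on optimal paths $\square\to\boxplus$, such that every such path meets $W$; it is minimal if no proper subset meets all of these paths. $\mathcal G$ is the union of all minimal gates. $\mathcal C^\star_{\rm bd}$ is the set of configurations at which optimal paths $\square\to\boxplus$ first enter $\mathcal G$, and $\mathcal P$ (the protocritical droplets) the set of configurations visited just prior to that first entrance. A droplet is a maximal set of particles connected by active bonds (a particle without active bonds counts as one). A free particle is one without active bonds. For $\hat\eta\in\mathcal P$, $\mathcal C^\star(\hat\eta)$ is the set of configurations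 obtained by adding to $\hat\eta$ a free particle of type $2$ somewhere in $\Lambda$, and $\mathcal C^\star_{\rm att}(\hat\eta)$ the set of those obtained when a particle of type $2$ enters at $\partial^-\Lambda$, moves while free, and attaches itself to $\hat\eta$ by one or more active bonds; $\mathcal C^\star$ and $\mathcal C^\star_{\rm att}$ are the unions over $\hat\eta\in\mathcal P$. $N^\star=N^\star(\Lambda)$ is the cardinality of $\mathcal P$ modulo shifts. **Hypotheses.** - (H1) $\mathcal X_{\rm stab}=\boxplus$, and $\square\notin\boxplus$. - (H2) There is $V^\star<\Gamma^\star$ with $V_\eta\le V^\star$ for all $\eta\notin\{\square\}\cup\boxplus$. - (H3-a) Every $\hat\eta\in\mathcal P$ is a single droplet, lying in $\Lambda^-$ and fitting inside an $L^\star\times L^\star$ square; whenever an optimal path $\square\to\boxplus$ first enters $\mathcal G$ by a step $\hat\eta\to\eta$, $\eta$ consists of $\hat\eta$ and a particle of type $2$ in $\partial^-\Lambda$. - (H3-b) All moves from $\mathcal C^\star$ that add a particle or increase the number of droplets lead to energy $>\Gamma^\star$. - (H3-c) All optimal paths from $\mathcal C^\star_{\rm bd}$ to $\boxplus$ pass through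 $\mathcal C^\star_{\rm att}$, and for every $\hat\eta\in\mathcal P$ there is a $\zeta\in\mathcal C^\star_{\rm att}(\hat\eta)$ with $\Phi(\zeta,\boxplus)<\Gamma^\star$. **Theorem.** (1) For every finite $\Lambda$ for which (H1)–(H2) hold there is a constant $K=K(\Lambda;U,\Delta_1,\Delta_2)\in(0,\infty)$ with $$\lim_{\beta\to\infty}e^{-\beta\Gamma^\star}E_\square(\tau_\boxplus)=K.$$ (2) Fix $U,\Delta_1,\Delta_2$ and let $\Lambda_n\to\mathbb Z^2$ through boxes of bounded distortion: $\Lambda_n=C_n\cap\mathbb Z^2$ with $C_n\subset\mathbb R^2$ convex and $\{|x|_\infty<r_n\}\subset C_n\subset\{|x|_\infty\le\kappa r_n\}$, where $r_n\to\infty$ and $\kappa$ does not depend on $n$ (squares, rhombi, …). Suppose that for all large $n$ (H1)–(H3) hold for $\Lambda_n$, with $L^\star$ not depending on $n$, and that protocritical droplets can be shifted freely away from the boundary: for every $\varepsilon>0$ and all large $n$, every shift of an element of $\mathcal P(\Lambda_n)$ whose particles are at distance at least $\varepsilon\sqrt{|\Lambda_n|}$ from $\mathbb Z^2\setminus\Lambda_n$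 is in $\mathcal P(\Lambda_n)$. Then $$K(\Lambda_n;U,\Delta_1,\Delta_2)\ \sim\ \frac1{N^\star(\Lambda_n)}\,\frac{\log|\Lambda_n|}{4\pi|\Lambda_n|}\qquad(n\to\infty).$$ -/

import Mathlib

open MeasureTheory ProbabilityTheory Filter Topology Asymptotics
open scoped ENNReal NNReal

noncomputable section

namespace Kawasaki

/-! ## The lattice gas with two types of particles -/

/-- Sites of the square lattice. -/
abbrev Site : Type := ℤ × ℤ

/-- Nearest neighbours: Euclidean distance one. -/
def nbr (x y : Site) : Prop := |x.1 - y.1| + |x.2 - y.2| = 1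

/-- The interior `Λ⁻` of `Λ`, that is, `Λ` without its internal boundary. -/
def innerSites (Λ : Finset Site) : Set Site := {x | x ∈ Λ ∧ ∀ y, nbr x y → y ∈ Λ}

/-- The internal boundary `∂⁻Λ`. -/
def innerBoundary (Λ : Finset Site) : Set Site := {x | x ∈ Λ ∧ ∃ y, nbr x y ∧ y ∉ Λ}

/-- Configurations: each site of `Λ` is empty (`0`) or holds a particle of type `1` or `2`. -/
abbrev Config (Λ : Finset Site) : Type := Λ → Fin 3

/-- Binding energy `U` and activation energies `Δ₁`, `Δ₂`. -/
structure Params where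
  U : ℝ
  Δ₁ : ℝ
  Δ₂ : ℝ

/-- The metastable region of the parameter space. -/
structure Params.Metastable (p : Params) : Prop where
  U_pos : 0 < p.U
  Δ₁_pos : 0 < p.Δ₁
  Δ₁_le_Δ₂ : p.Δ₁ ≤ p.Δ₂
  lt : p.Δ₁ + p.Δ₂ < 4 * p.U

section Box

variable {Λ : Finset Site}

/-- The empty box `□`. -/
def emptyBox (Λ : Finset Site) : Config Λ := fun _ => 0

/-- Two neighbouring sites of `Λ⁻` that hold particles of different types. -/
def ActiveBond (η : Config Λ) (x y : Λ) : Prop :=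
  (x : Site) ∈ innerSites Λ ∧ (y : Site) ∈ innerSites Λ ∧ nbr x y ∧ (η x).val * (η y).val = 2

/-- The number `B(η)` of active (non-oriented) bonds. -/
def numBonds (η : Config Λ) : ℕ :=
  Set.ncard {b : Sym2 Λ | ∃ x y, ActiveBond η x y ∧ b = s(x, y)}

/-- The number of sites in state `k`. -/
def numType (η : Config Λ) (k : Fin 3) : ℕ := (Finset.univ.filter fun x => η x = k).card

/-- The number of particles. -/
def numParticles (η : Config Λ) : ℕ := (Finset.univ.filter fun x => η x ≠ 0).card

/-- The Hamiltonian. -/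
def energy (p : Params) (η : Config Λ) : ℝ :=
  -p.U * numBonds η + p.Δ₁ * numType η 1 + p.Δ₂ * numType η 2

/-- Elementary moves in one direction: a particle hops to an empty neighbouring site of `Λ`, or a
particle is created at an empty site of `∂⁻Λ`. -/
def MoveRel (η η' : Config Λ) : Prop :=
  (∃ x y : Λ, nbr x y ∧ η x ≠ 0 ∧ η y = 0 ∧ η' = η ∘ Equiv.swap x y) ∨
  (∃ x : Λ, (x : Site) ∈ innerBoundary Λ ∧ η x = 0 ∧ ∃ k : Fin 3, k ≠ 0 ∧ η' = Function.update η x k)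

/-- The graph of communicating configurations: `η ∼ η'` if one of them is obtained from the other by
an elementary move (so that annihilation in `∂⁻Λ` is included). -/
def moves (Λ : Finset Site) : SimpleGraph (Config Λ) := SimpleGraph.fromRel MoveRel

/-! ## The Kawasaki dynamics

The continuous-time Markov chain with the Metropolis rates is constructed from its jump chain and its
holding times. A trajectory is a sequence `ω` where `(ω n).1` is the state after `n` jumps and
`(ω (n + 1)).2` is the time spent in the state `(ω n).1`; by convention `(ω 0).2 = 0`. -/

open scoped Classical in
/-- The Metropolis transition rates `c_β(η, η')`. -/
def rate (p : Params) (β : ℝ) (η η' : Config Λ) : ℝ :=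
  if (moves Λ).Adj η η' then Real.exp (-β * max (energy p η' - energy p η) 0) else 0

/-- The total rate of leaving `η`. -/
def totalRate (p : Params) (β : ℝ) (η : Config Λ) : ℝ := ∑ η', rate p β η η'

lemma rate_nonneg (p : Params) (β : ℝ) (η η' : Config Λ) : 0 ≤ rate p β η η' := by
  unfold rate; split_ifs <;> positivity

open scoped Classical in
/-- The law of the holding time in `η`: exponential with parameter `totalRate p β η`. -/
def holdLaw (p : Params) (β : ℝ) (η : Config Λ) : Measure ℝ :=
  if 0 < totalRate p β η then expMeasure (totalRate p β η) else Measure.dirac 0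

open scoped Classical in
/-- The law of the state after a jump from `η`: `η'` has probability `c_β(η, η')` over the total
rate. -/
def jumpLaw (p : Params) (β : ℝ) (η : Config Λ) : Measure (Config Λ) :=
  if 0 < totalRate p β η then
    ∑ η', ENNReal.ofReal (rate p β η η' / totalRate p β η) • Measure.dirac η'
  else Measure.dirac η

instance (p : Params) (β : ℝ) (η : Config Λ) : IsProbabilityMeasure (holdLaw p β η) := by
  unfold holdLaw
  split_ifs with h
  · exact isProbabilityMeasure_expMeasure h
  · infer_instance

instance (p : Params) (β : ℝ) (η : Config Λ) : IsProbabilityMeasure (jumpLaw p β η) := by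
  unfold jumpLaw
  split_ifs with h
  · constructor
    simp only [Measure.coe_finsetSum, Measure.coe_smul, Finset.sum_apply, Pi.smul_apply,
      measure_univ, smul_eq_mul, mul_one]
    rw [← ENNReal.ofReal_sum_of_nonneg fun η' _ => div_nonneg (rate_nonneg p β η η') h.le,
      ← Finset.sum_div]
    change ENNReal.ofReal (totalRate p β η / totalRate p β η) = 1
    rw [div_self h.ne', ENNReal.ofReal_one]
  · infer_instance

/-- One step of the marked jump chain: jump out of `η`, after an independent holding time. -/
def stepKernel (p : Params) (β : ℝ) : Kernel (Config Λ) (Config Λ × ℝ) :=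
  Kernel.ofFunOfCountable fun η => (jumpLaw p β η).prod (holdLaw p β η)

instance (p : Params) (β : ℝ) : IsMarkovKernel (stepKernel (Λ := Λ) p β) :=
  ⟨fun η => inferInstanceAs (IsProbabilityMeasure ((jumpLaw p β η).prod (holdLaw p β η)))⟩

/-- The state reached at the end of a finite piece of trajectory. -/
def lastState (n : ℕ) (h : (i : Finset.Iic n) → Config Λ × ℝ) : Config Λ :=
  (h ⟨n, Finset.mem_Iic.2 le_rfl⟩).1

lemma measurable_lastState (n : ℕ) : Measurable (lastState (Λ := Λ) n) :=
  measurable_fst.comp (measurable_pi_apply _)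

/-- The law of the trajectory started from `η`. -/
def law (p : Params) (β : ℝ) (η : Config Λ) : Measure (ℕ → Config Λ × ℝ) :=
  Kernel.traj (X := fun _ => Config Λ × ℝ)
    (fun n => (stepKernel p β).comap (lastState n) (measurable_lastState n)) 0 (fun _ => (η, 0))

/-- The time of the `n`-th jump. -/
def jumpTime (ω : ℕ → Config Λ × ℝ) (n : ℕ) : ℝ := ∑ k ∈ Finset.range (n + 1), (ω k).2

/-- The state `η_t` at time `t`. -/
def stateAt (ω : ℕ → Config Λ × ℝ) (t : ℝ) : Config Λ :=
  (ω (sInf {n : ℕ | t < jumpTime ω (n + 1)})).1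

/-- The first hitting/return time of `A`:
`τ_A = inf {t ≥ 0 : η_t ∈ A, ∃ 0 < s < t : η_s ∉ A}`. -/
def hitTime (A : Set (Config Λ)) (ω : ℕ → Config Λ × ℝ) : ℝ≥0∞ :=
  ⨅ (t : ℝ≥0) (_ : stateAt ω t ∈ A ∧ ∃ s : ℝ, 0 < s ∧ s < t ∧ stateAt ω s ∉ A), (t : ℝ≥0∞)

/-- The expectation of `τ_A` for the dynamics started from `η`. -/
def meanHitTime (p : Params) (β : ℝ) (η : Config Λ) (A : Set (Config Λ)) : ℝ≥0∞ :=
  ∫⁻ ω, hitTime A ω ∂(law p β η)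

/-! ## The energy landscape -/

/-- The maximal energy along a path of allowed moves. -/
def height (p : Params) {η η' : Config Λ} (w : (moves Λ).Walk η η') : ℝ :=
  sSup (energy p '' {ξ | ξ ∈ w.support})

/-- The communication height between two configurations. -/
def commHeight (p : Params) (η η' : Config Λ) : ℝ :=
  sInf (Set.range fun w : (moves Λ).Walk η η' => height p w)

/-- The communication height between two sets of configurations. -/
def commHeightSet (p : Params) (A B : Set (Config Λ)) : ℝ :=
  sInf {m | ∃ η ∈ A, ∃ η' ∈ B, m = commHeight p η η'}

/-- The stability level `V_η`. -/
def stabLevel (p : Params) (η : Config Λ) : ℝ :=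
  commHeightSet p {η} {ξ : Config Λ | energy p ξ < energy p η} - energy p η

/-- The stable configurations: those of minimal energy. -/
def stable (p : Params) (Λ : Finset Site) : Set (Config Λ) :=
  {η | ∀ ξ : Config Λ, energy p η ≤ energy p ξ}

/-- A path from `A` to `B` that realizes the minimax: a member of `(A → B)_opt`. -/
def IsOptimal (p : Params) (A B : Set (Config Λ)) {η η' : Config Λ} (w : (moves Λ).Walk η η') :
    Prop :=
  η ∈ A ∧ η' ∈ B ∧ height p w = commHeightSet p A B

/-- The communication level set between `A` and `B`. -/
def levelSet (p : Params) (A B : Set (Config Λ)) : Set (Config Λ) :=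
  {ζ | energy p ζ = commHeightSet p A B ∧
    ∃ (η η' : Config Λ) (w : (moves Λ).Walk η η'), IsOptimal p A B w ∧ ζ ∈ w.support}

/-- Gates for the transition from `A` to `B`. -/
def IsGate (p : Params) (A B W : Set (Config Λ)) : Prop :=
  W ⊆ levelSet p A B ∧
  ∀ (η η' : Config Λ) (w : (moves Λ).Walk η η'), IsOptimal p A B w → ∃ ξ ∈ w.support, ξ ∈ W

/-- Minimal gates. -/
def IsMinimalGate (p : Params) (A B W : Set (Config Λ)) : Prop :=
  IsGate p A B W ∧
  ∀ W', W' ⊂ W → ∃ (η η' : Config Λ) (w : (moves Λ).Walk η η'), IsOptimal p A B w ∧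
    ∀ ξ ∈ w.support, ξ ∉ W'

/-- The essential gate: the union of all minimal gates. -/
def essentialGate (p : Params) (A B : Set (Config Λ)) : Set (Config Λ) :=
  {ξ | ∃ W, IsMinimalGate p A B W ∧ ξ ∈ W}

/-- `Γ⋆`, the communication height between the empty box and the full box `F`. -/
def gammaStar (p : Params) (F : Set (Config Λ)) : ℝ :=
  commHeightSet p {emptyBox Λ} F - energy p (emptyBox Λ)

/-! ## Protocritical and critical droplets -/

/-- Some optimal path from `□` to `F` enters the essential gate for the first time at `η`, and is at
`ξ` just before. -/
def Entrance (p : Params) (F : Set (Config Λ)) (ξ η : Config Λ) : Prop :=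
  ∃ (ζ ζ' : Config Λ) (w : (moves Λ).Walk ζ ζ') (k : ℕ), IsOptimal p {emptyBox Λ} F w ∧
    k + 1 ≤ w.length ∧ w.getVert k = ξ ∧ w.getVert (k + 1) = η ∧
    η ∈ essentialGate p {emptyBox Λ} F ∧
    ∀ j ≤ k, w.getVert j ∉ essentialGate p {emptyBox Λ} F

/-- The entrance set of the essential gate: the minimal set through which all the optimal paths
enter. -/
def gateEntrance (p : Params) (F : Set (Config Λ)) : Set (Config Λ) := {η | ∃ ξ, Entrance p F ξ η}

/-- The protocritical droplets: the configurations visited by the optimal paths just prior to their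
first entrance of the essential gate. -/
def proto (p : Params) (F : Set (Config Λ)) : Set (Config Λ) := {ξ | ∃ η, Entrance p F ξ η}

/-- The graph of active bonds on the occupied sites; its connected components are the droplets. -/
def bondGraph (η : Config Λ) : SimpleGraph {x : Λ // η x ≠ 0} :=
  SimpleGraph.fromRel fun x y => ActiveBond η x y

/-- The number of droplets (maximal sets of particles connected by active bonds; a particle without
active bonds counts as one). -/
def numDroplets (η : Config Λ) : ℕ := Nat.card (bondGraph η).ConnectedComponent

/-- `η` consists of a single droplet, which lies in `Λ⁻` and fits inside an `L × L` square. -/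
def IsSingleDroplet (L : ℕ) (η : Config Λ) : Prop :=
  numDroplets η = 1 ∧ (∀ x : Λ, η x ≠ 0 → (x : Site) ∈ innerSites Λ) ∧
  ∃ a : Site, ∀ x : Λ, η x ≠ 0 →
    a.1 ≤ (x : Site).1 ∧ (x : Site).1 < a.1 + L ∧ a.2 ≤ (x : Site).2 ∧ (x : Site).2 < a.2 + L

/-- `η` with a particle of type `2` put at `x`. -/
def addTwo (η : Config Λ) (x : Λ) : Config Λ := Function.update η x 2

/-- A particle of type `2` put at `x` is free: `x` is vacant and the particle has no active bond. -/
def FreeAt (η : Config Λ) (x : Λ) : Prop := η x = 0 ∧ ∀ y, ¬ ActiveBond (addTwo η x) x y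

/-- A free particle of type `2` can enter at `∂⁻Λ` and move to `x` while remaining free. -/
def FreeReach (η : Config Λ) (x : Λ) : Prop :=
  ∃ y : Λ, (y : Site) ∈ innerBoundary Λ ∧ FreeAt η y ∧
    Relation.ReflTransGen (fun a b : Λ => nbr a b ∧ FreeAt η b) y x

/-- `𝒞⋆(η)`: the configurations obtained from `η` by adding a free particle of type `2`. -/
def critical (η : Config Λ) : Set (Config Λ) := {ζ | ∃ x, FreeAt η x ∧ ζ = addTwo η x}

/-- `𝒞⋆_att(η)`: the configurations obtained from `η` when a particle of type `2` that has entered at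
`∂⁻Λ` and moved freely attaches itself to the droplet, through an active bond. -/
def attached (η : Config Λ) : Set (Config Λ) :=
  {ζ | ∃ x z : Λ, FreeReach η x ∧ nbr x z ∧ η z = 0 ∧ (∃ y, ActiveBond (addTwo η z) z y) ∧
    ζ = addTwo η z}

/-! ## The hypotheses

`F` stands for the full box `⊞`, viewed as the set of the configurations that represent it. -/

/-- (H1): the stable configurations are those of the full box, and the empty box is not one of
them. -/
structure H1 (p : Params) (F : Set (Config Λ)) : Prop where
  stable_eq : stable p Λ = F
  empty_notMem : emptyBox Λ ∉ F

/-- (H2): apart from the empty and the full box, stability levels are at most some `V⋆ < Γ⋆`. -/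
def H2 (p : Params) (F : Set (Config Λ)) : Prop :=
  ∃ V : ℝ, V < gammaStar p F ∧ ∀ η, η ≠ emptyBox Λ → η ∉ F → stabLevel p η ≤ V

/-- (H3), with `L` the side length of the squares in which the protocritical droplets fit. -/
structure H3 (p : Params) (F : Set (Config Λ)) (L : ℕ) : Prop where
  /-- Protocritical configurations are single droplets, and the essential gate is entered by the
  creation of a free particle of type `2` in `∂⁻Λ`. -/
  single : ∀ ξ ∈ proto p F, IsSingleDroplet L ξ
  enter : ∀ ξ η, Entrance p F ξ η →
    ∃ x : Λ, (x : Site) ∈ innerBoundary Λ ∧ ξ x = 0 ∧ η = addTwo ξ x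
  /-- Transitions from a critical droplet that add a particle or increase the number of droplets lead
  to energy above `Γ⋆`. -/
  above : ∀ ξ ∈ proto p F, ∀ η ∈ critical ξ, ∀ η', (moves Λ).Adj η η' →
    (numParticles η < numParticles η' ∨ numDroplets η < numDroplets η') →
    gammaStar p F < energy p η'
  /-- Optimal paths from the entrance set to the full box pass through `𝒞⋆_att`. -/
  through : ∀ (η η' : Config Λ) (w : (moves Λ).Walk η η'), IsOptimal p (gateEntrance p F) F w →
    ∃ ζ ∈ w.support, ∃ ξ ∈ proto p F, ζ ∈ attached ξ
  /-- Every protocritical droplet has a good attachment. -/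
  good : ∀ ξ ∈ proto p F, ∃ ζ ∈ attached ξ, commHeightSet p {ζ} F < gammaStar p F

/-! ## Shifts -/

/-- Extension of a configuration by empty sites to the whole lattice. -/
def extend (η : Config Λ) (x : Site) : Fin 3 := if h : x ∈ Λ then η ⟨x, h⟩ else 0

/-- The equivalence class of a configuration modulo shifts. -/
def shiftClass (η : Config Λ) : Set (Site → Fin 3) :=
  Set.range fun (v : Site) (x : Site) => extend η (x - v)

/-- `N⋆`: the number of protocritical droplets modulo shifts. -/
def numShapes (p : Params) (F : Set (Config Λ)) : ℕ := (shiftClass '' proto p F).ncard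

/-- Every shift of a protocritical droplet whose particles stay at distance at least `d` from the
complement of `Λ` is again protocritical. (The distance is the one of the maximum norm.) -/
def ShiftInvariantAt (p : Params) (F : Set (Config Λ)) (d : ℝ) : Prop :=
  ∀ ξ ∈ proto p F, ∀ v : Site,
    (∀ x, extend ξ x ≠ 0 → ∀ y, y ∉ Λ → d ≤ dist (x + v) y) →
    ∃ ξ' ∈ proto p F, ∀ x, extend ξ' (x + v) = extend ξ x

end Box

/-- `Λ n` tends to `ℤ²` through boxes of bounded distortion: `Λ n` consists of the lattice points of a
convex set that lies between the (maximum norm) balls of radius `r n` and `κ * r n` around the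
origin, where `r n → ∞`. (Squares, rhombi, and rectangles of bounded aspect ratio are examples.) -/
def TendsToLattice (Λ : ℕ → Finset Site) : Prop :=
  ∃ (C : ℕ → Set (ℝ × ℝ)) (r : ℕ → ℝ) (κ : ℝ), Tendsto r atTop atTop ∧
    ∀ᶠ n in atTop, Convex ℝ (C n) ∧ Metric.ball 0 (r n) ⊆ C n ∧ C n ⊆ Metric.closedBall 0 (κ * r n) ∧
      ∀ x : Site, x ∈ Λ n ↔ ((x.1 : ℝ), (x.2 : ℝ)) ∈ C n

end Kawasaki

end

/-!
The mean crossover time is a ratio of electrical quantities. With the conductances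
`e^{-β max (H a) (H b)}` on the edges of the graph of moves, the mean hitting time of `F` from the empty
box is a sum over configurations of `e^{-β H}` against the Green function killed on `F`
(`meanHitTime_eq_sum`). After multiplication by `e^{-βΓ⋆}` only the term of the empty box survives: (H2)
excludes other traps of comparable depth. The Green function at its pole is the inverse of a capacity,
and as `β → ∞` the Dirichlet principle for this capacity degenerates to a finite variational problem:
minimize the number of edges of level `Γ⋆`, weighted by squared gradients, over the functions that are
`1` at the empty box, `0` on `F`, and constant along the edges of level below `Γ⋆`. Its minimum `θ` is
positive, and `K = 1 / θ` (`tendsto_meanHitTime`).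

For a large box, `θ` is a sum over the protocritical droplets `ξ` of the capacity, for a simple random
walk in the box, between the droplet and the outside. Indeed, before the gate the optimal function is
`1`; beyond it, the only moves of energy at most `Γ⋆` are those of the free particle of type `2`
(`H3.critical_move`), because the type plus the parity of the site is constant along a droplet, so that
any hop of a particle of the droplet breaks it up (`H3.numDroplets_hop`). Hence test functions for the
free particle, one for each droplet, combine into a test function on configurations
(`H3.exists_critForm_le`). Conversely the networks of the free particle belonging to different droplets
are disjoint (`H3.sum_dirichlet_le`), every droplet is in the well of the empty box
(`H3.linkedIn_proto`), and the free particle can reach an attachment site from which the descent to `F`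
stays below `Γ⋆`.

The capacity of the two-dimensional walk between a bounded set and distance `R` is `2π / log R` to
leading order. From above, this is the energy of the logarithm, cut off at the two radii
(`exists_cutoff`). From below, it is Thomson's principle for an explicit flow: the flow through an edge is
the angle under which the dual edge is seen from the origin (`sq_le_mul_latticeEnergy`). Close to the
droplet the equilibrium potential is small because the free particle can reach the droplet within a
bounded square (`H3.potential_bounds`). Since the radius may be taken to be a power of `|Λ|` with
exponent close to `1 / 2`, each droplet contributes `4π / log |Λ|`. Finally there are about `N⋆ |Λ|`
droplets: a droplet is determined by its shape and its position, almost all positions are available, and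
few are close to the boundary (`LatticeConvex.card_shallow_le`), where a crude bound on the capacity
suffices.
-/

noncomputable section

namespace Kawasaki

/-! ### Finite electrical networks with a killed set -/

/-- The increments of a function along a chain. The length of the chain does not depend on the
function. -/
lemma exists_chain_bound {V : Type*} {r : V → V → Prop} {x y : V} (h : Relation.ReflTransGen r x y) :
    ∃ n : ℕ, ∀ (f : V → ℝ) (t : ℝ), (∀ a b, r a b → |f a - f b| ≤ t) → |f x - f y| ≤ n * t := by
  induction h with
  | refl => exact ⟨0, fun f t _ => by simp⟩
  | @tail b c _ hbc ih =>
    obtain ⟨n, hn⟩ := ih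
    refine ⟨n + 1, fun f t ht => ?_⟩
    have h1 := hn f t ht
    have h2 := ht _ _ hbc
    calc |f x - f c| ≤ |f x - f b| + |f b - f c| := abs_sub_le _ _ _
      _ ≤ n * t + t := add_le_add h1 h2
      _ = (n + 1 : ℕ) * t := by push_cast; ring

section Network

variable {V : Type*} [Fintype V]

/-- The Dirichlet form of the conductances `c` (each non-oriented edge is counted once). -/
def dirichlet (c : V → V → ℝ) (f g : V → ℝ) : ℝ :=
  (∑ x, ∑ y, c x y * ((f x - f y) * (g x - g y))) / 2

/-- The (positive) Laplacian of the conductances `c`. -/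
def lap (c : V → V → ℝ) (f : V → ℝ) (x : V) : ℝ := ∑ y, c x y * (f x - f y)

/-- Symmetric nonnegative conductances for which every vertex is connected to `F`. -/
structure IsKilled (c : V → V → ℝ) (F : Set V) : Prop where
  nonneg : ∀ x y, 0 ≤ c x y
  symm : ∀ x y, c x y = c y x
  reach : ∀ x, ∃ y ∈ F, Relation.ReflTransGen (fun a b => 0 < c a b) x y

lemma sum_mul_lap {c : V → V → ℝ} (hc : ∀ x y, c x y = c y x) (f g : V → ℝ) :
    ∑ x, g x * lap c f x = dirichlet c f g := by
  have h1 : ∑ x, g x * lap c f x = ∑ x, ∑ y, c x y * ((f x - f y) * g x) := by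
    simp only [lap, Finset.mul_sum]
    exact Finset.sum_congr rfl fun x _ => Finset.sum_congr rfl fun y _ => by ring
  have h2 : ∑ x, ∑ y, c x y * ((f x - f y) * g x) = ∑ x, ∑ y, c x y * ((f x - f y) * (-g y)) := by
    rw [Finset.sum_comm]
    exact Finset.sum_congr rfl fun x _ => Finset.sum_congr rfl fun y _ => by rw [hc y x]; ring
  have h3 : dirichlet c f g * 2 = ∑ x, ∑ y, c x y * ((f x - f y) * g x) +
      ∑ x, ∑ y, c x y * ((f x - f y) * (-g y)) := by
    rw [dirichlet, div_mul_cancel₀ _ two_ne_zero, ← Finset.sum_add_distrib]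
    refine Finset.sum_congr rfl fun x _ => ?_
    rw [← Finset.sum_add_distrib]
    exact Finset.sum_congr rfl fun y _ => by ring
  linarith

lemma dirichlet_comm (c : V → V → ℝ) (f g : V → ℝ) : dirichlet c f g = dirichlet c g f := by
  simp only [dirichlet, mul_comm (f _ - f _)]

lemma dirichlet_self_nonneg {c : V → V → ℝ} (hc : ∀ x y, 0 ≤ c x y) (f : V → ℝ) :
    0 ≤ dirichlet c f f :=
  div_nonneg (Finset.sum_nonneg fun x _ => Finset.sum_nonneg fun y _ =>
    mul_nonneg (hc x y) (mul_self_nonneg _)) zero_le_two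

lemma dirichlet_sq_le {c : V → V → ℝ} (hc : ∀ x y, 0 ≤ c x y) (f g : V → ℝ) :
    dirichlet c f g ^ 2 ≤ dirichlet c f f * dirichlet c g g := by
  have key := Finset.sum_mul_sq_le_sq_mul_sq (Finset.univ : Finset (V × V))
    (fun e => √(c e.1 e.2) * (f e.1 - f e.2)) (fun e => √(c e.1 e.2) * (g e.1 - g e.2))
  have e1 : ∀ (f g : V → ℝ), ∑ e : V × V, (√(c e.1 e.2) * (f e.1 - f e.2)) *
      (√(c e.1 e.2) * (g e.1 - g e.2)) = 2 * dirichlet c f g := by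
    intro f g
    rw [dirichlet, mul_div_cancel₀ _ two_ne_zero, ← Finset.univ_product_univ, Finset.sum_product]
    refine Finset.sum_congr rfl fun x _ => Finset.sum_congr rfl fun y _ => ?_
    calc _ = (√(c x y) * √(c x y)) * ((f x - f y) * (g x - g y)) := by ring
      _ = _ := by rw [Real.mul_self_sqrt (hc x y)]
  simp only [pow_two] at key ⊢
  rw [e1 f g, e1 f f, e1 g g] at key
  nlinarith

/-- A single edge carries at most the whole energy. -/
lemma edge_le_dirichlet {c : V → V → ℝ} (h0 : ∀ x y, 0 ≤ c x y) (hs : ∀ x y, c x y = c y x)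
    (f : V → ℝ) (a b : V) : c a b * (f a - f b) ^ 2 ≤ dirichlet c f f := by
  classical
  rcases eq_or_ne a b with rfl | hab
  · simpa using dirichlet_self_nonneg h0 f
  have hnn : ∀ e : V × V, 0 ≤ c e.1 e.2 * ((f e.1 - f e.2) * (f e.1 - f e.2)) := fun e =>
    mul_nonneg (h0 _ _) (mul_self_nonneg _)
  have h1 : ∑ e ∈ {(a, b), (b, a)}, c e.1 e.2 * ((f e.1 - f e.2) * (f e.1 - f e.2)) ≤
      ∑ e : V × V, c e.1 e.2 * ((f e.1 - f e.2) * (f e.1 - f e.2)) :=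
    Finset.sum_le_sum_of_subset_of_nonneg (Finset.subset_univ _) fun e _ _ => hnn e
  rw [Finset.sum_pair (by simp [hab]), ← Finset.univ_product_univ, Finset.sum_product] at h1
  simp only [hs b a] at h1
  rw [dirichlet]
  nlinarith

namespace IsKilled

variable {c : V → V → ℝ} {F : Set V} (hc : IsKilled c F)
include hc

lemma eq_zero {f : V → ℝ} (hf : ∀ x ∈ F, f x = 0) (h : dirichlet c f f ≤ 0) : f = 0 := by
  funext x
  obtain ⟨y, hy, hxy⟩ := hc.reach x
  obtain ⟨n, hn⟩ := exists_chain_bound hxy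
  have := hn f 0 fun a b hab => by
    have := (edge_le_dirichlet hc.nonneg hc.symm f a b).trans h
    have h2 : (f a - f b) ^ 2 ≤ 0 := by
      by_contra! h3
      exact absurd this (not_le.2 (mul_pos hab h3))
    rw [abs_nonpos_iff]
    exact pow_eq_zero_iff two_ne_zero |>.1 (le_antisymm h2 (sq_nonneg _))
  rw [mul_zero, abs_nonpos_iff, hf y hy, sub_zero] at this
  exact this

/-- The Dirichlet problem with source `b` off `F` and boundary value `0` on `F` has a solution. -/
lemma exists_solution (b : V → ℝ) :
    ∃ f : V → ℝ, (∀ x ∈ F, f x = 0) ∧ ∀ x ∉ F, lap c f x = b x := by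
  classical
  let T : (V → ℝ) →ₗ[ℝ] (V → ℝ) :=
    { toFun := fun f x => if x ∈ F then f x else lap c f x
      map_add' := fun f g => by
        funext x
        by_cases hx : x ∈ F
        · simp [hx]
        · simp only [hx, if_false, Pi.add_apply, lap, ← Finset.sum_add_distrib]
          exact Finset.sum_congr rfl fun y _ => by ring
      map_smul' := fun t f => by
        funext x
        by_cases hx : x ∈ F
        · simp [hx]
        · simp only [hx, if_false, Pi.smul_apply, lap, smul_eq_mul, RingHom.id_apply,
            Finset.mul_sum]
          exact Finset.sum_congr rfl fun y _ => by ring }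
  have hT : ∀ f x, T f x = if x ∈ F then f x else lap c f x := fun _ _ => rfl
  have hinj : Function.Injective T := by
    rw [← LinearMap.ker_eq_bot, LinearMap.ker_eq_bot']
    intro f hf
    have h0 : ∀ x ∈ F, f x = 0 := fun x hx => by simpa [hT, hx] using congrFun hf x
    refine hc.eq_zero h0 ?_
    rw [← sum_mul_lap hc.symm]
    refine (Finset.sum_eq_zero fun x _ => ?_).le
    by_cases hx : x ∈ F
    · simp [h0 x hx]
    · have := congrFun hf x
      rw [hT, if_neg hx] at this
      simp [this]
  obtain ⟨f, hf⟩ := LinearMap.injective_iff_surjective.1 hinj fun x => if x ∈ F then 0 else b x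
  refine ⟨f, fun x hx => ?_, fun x hx => ?_⟩
  · simpa [hT, hx] using congrFun hf x
  · simpa [hT, hx] using congrFun hf x

/-- The minimum principle, obtained by testing the Laplacian against the negative part. -/
lemma nonneg_of_lap_nonneg {f : V → ℝ} (hF : ∀ x ∈ F, 0 ≤ f x) (hL : ∀ x ∉ F, f x < 0 → 0 ≤ lap c f x)
    (x : V) : 0 ≤ f x := by
  set g : V → ℝ := fun x => min (f x) 0 with hg
  have h1 : dirichlet c g g ≤ dirichlet c f g := by
    refine div_le_div_of_nonneg_right (Finset.sum_le_sum fun x _ => Finset.sum_le_sum fun y _ =>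
      mul_le_mul_of_nonneg_left ?_ (hc.nonneg x y)) zero_le_two
    · simp only [hg]
      rcases le_total (f x) 0 with h | h <;> rcases le_total (f y) 0 with h' | h' <;>
        simp only [min_eq_left h, min_eq_right h, min_eq_left h', min_eq_right h'] <;> nlinarith
  have h2 : dirichlet c f g ≤ 0 := by
    rw [← sum_mul_lap hc.symm]
    refine Finset.sum_nonpos fun x _ => ?_
    by_cases hx : x ∈ F
    · simp [hg, min_eq_right (hF x hx)]
    rcases lt_or_ge (f x) 0 with h | h
    · exact mul_nonpos_of_nonpos_of_nonneg (min_le_right _ _) (hL x hx h)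
    · simp [hg, min_eq_right h]
  have h3 := congrFun (hc.eq_zero (f := g) (fun x hx => by simp [hg, hF x hx]) (h1.trans h2)) x
  simp only [hg, Pi.zero_apply, min_eq_right_iff] at h3
  exact h3

end IsKilled

/-- `g` is the Green function with pole `o` of the network killed on `F`. -/
structure IsGreen (c : V → V → ℝ) (F : Set V) (o : V) (g : V → ℝ) : Prop where
  notMem : o ∉ F
  zero : ∀ x ∈ F, g x = 0
  pole : lap c g o = 1
  harmonic : ∀ x ∉ F, x ≠ o → lap c g x = 0

lemma IsKilled.exists_green {c : V → V → ℝ} {F : Set V} (hc : IsKilled c F) {o : V} (ho : o ∉ F) :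
    ∃ g, IsGreen c F o g := by
  classical
  obtain ⟨g, h0, h1⟩ := hc.exists_solution fun x => if x = o then 1 else 0
  exact ⟨g, ho, h0, by simp [h1 o ho], fun x hx hxo => by simp [h1 x hx, hxo]⟩

namespace IsGreen

variable {c : V → V → ℝ} {F : Set V} {o : V} {g : V → ℝ} (hg : IsGreen c F o g)
include hg

lemma dirichlet_eq (hc : ∀ x y, c x y = c y x) {f : V → ℝ} (hf : ∀ x ∈ F, f x = 0) :
    dirichlet c g f = f o := by
  classical
  rw [← sum_mul_lap hc, Finset.sum_eq_single o]
  · rw [hg.pole, mul_one]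
  · intro x _ hx
    by_cases hxF : x ∈ F
    · rw [hf x hxF, zero_mul]
    · rw [hg.harmonic x hxF hx, mul_zero]
  · simp

lemma nonneg (hc : IsKilled c F) (x : V) : 0 ≤ g x := by
  refine hc.nonneg_of_lap_nonneg (fun x hx => (hg.zero x hx).ge) (fun x hx _ => ?_) x
  rcases eq_or_ne x o with rfl | hxo
  · rw [hg.pole]; exact zero_le_one
  · rw [hg.harmonic x hx hxo]

lemma le_pole (hc : IsKilled c F) (x : V) : g x ≤ g o := by
  have := hc.nonneg_of_lap_nonneg (f := fun x => g o - g x)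
    (fun x hx => by simpa [hg.zero x hx] using hg.nonneg hc o) (fun x hx hlt => ?_) x
  · linarith
  · rcases eq_or_ne x o with rfl | hxo
    · simp at hlt
    · have h := hg.harmonic x hx hxo
      have : lap c (fun x => g o - g x) x = - lap c g x := by
        simp only [lap, ← Finset.sum_neg_distrib]
        exact Finset.sum_congr rfl fun y _ => by ring
      rw [this, h, neg_zero]

lemma pole_pos (hc : IsKilled c F) : 0 < g o := by
  refine lt_of_le_of_ne (hg.nonneg hc o) fun h => ?_
  have h0 : g = 0 := funext fun x => le_antisymm ((hg.le_pole hc x).trans h.symm.le) (hg.nonneg hc x)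
  have := hg.pole
  simp [h0, lap] at this

/-- Dirichlet's principle: the effective resistance dominates the inverse energies. -/
lemma one_le_mul_dirichlet (hc : IsKilled c F) {f : V → ℝ} (hf : ∀ x ∈ F, f x = 0) (ho : f o = 1) :
    1 ≤ g o * dirichlet c f f := by
  have h := dirichlet_sq_le hc.nonneg g f
  rwa [hg.dirichlet_eq hc.symm hf, hg.dirichlet_eq hc.symm hg.zero, ho, one_pow] at h

lemma symm (hc : IsKilled c F) {o' : V} {g' : V → ℝ} (hg' : IsGreen c F o' g') : g o' = g' o := by
  rw [← hg.dirichlet_eq hc.symm hg'.zero, dirichlet_comm, hg'.dirichlet_eq hc.symm hg.zero]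

/-- Representation of the solution of a Dirichlet problem by the Green function. -/
lemma eq_sum (hc : IsKilled c F) {f b : V → ℝ} (hf : ∀ x ∈ F, f x = 0)
    (hb : ∀ x ∉ F, lap c f x = b x) : f o = ∑ x, g x * b x := by
  rw [← hg.dirichlet_eq hc.symm hf, dirichlet_comm, ← sum_mul_lap hc.symm]
  refine Finset.sum_congr rfl fun x _ => ?_
  by_cases hx : x ∈ F
  · rw [hg.zero x hx, zero_mul, zero_mul]
  · rw [hb x hx]

end IsGreen

end Network

/-! ### Mean hitting times of the jump process -/

/-- The exponential law with parameter `r` has mean `1 / r`: the density multiplied by `x` is the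
density of a Gamma law, up to the factor `1 / r`. -/
lemma lintegral_expMeasure {r : ℝ} (hr : 0 < r) :
    ∫⁻ x, ENNReal.ofReal x ∂(expMeasure r) = ENNReal.ofReal (1 / r) := by
  have h2 : (fun x => gammaPDF 1 r x * ENNReal.ofReal x) =
      fun x => ENNReal.ofReal (1 / r) * gammaPDF 2 r x := by
    funext x
    rcases lt_or_ge x 0 with hx | hx
    · simp [gammaPDF_of_neg hx]
    · rw [gammaPDF_of_nonneg hx, gammaPDF_of_nonneg hx, ← ENNReal.ofReal_mul' hx,
        ← ENNReal.ofReal_mul (by positivity)]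
      congr 1
      have h21 : (2 : ℝ) - 1 = 1 := by norm_num
      rw [Real.Gamma_one, Real.Gamma_two, sub_self, h21, Real.rpow_zero, Real.rpow_one,
        Real.rpow_one, Real.rpow_two]
      field_simp
  have hm : Measurable (gammaPDF 1 r) := (measurable_gammaPDFReal 1 r).ennreal_ofReal
  have hm2 : Measurable (gammaPDF 2 r) := (measurable_gammaPDFReal 2 r).ennreal_ofReal
  rw [expMeasure, gammaMeasure, lintegral_withDensity_eq_lintegral_mul _ hm (by fun_prop)]
  change ∫⁻ x, gammaPDF 1 r x * ENNReal.ofReal x = _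
  rw [h2, lintegral_const_mul _ hm2, lintegral_gammaPDF_eq_one two_pos hr, mul_one]

lemma expMeasure_pos {r : ℝ} : ∀ᵐ x ∂(expMeasure r), 0 < x := by
  rw [ae_iff]
  have : {x : ℝ | ¬ 0 < x} = Set.Iic 0 := by ext; simp
  rw [this, expMeasure, gammaMeasure, withDensity_apply _ measurableSet_Iic,
    ← setLIntegral_congr (Iio_ae_eq_Iic (a := (0 : ℝ)))]
  exact lintegral_gammaPDF_of_nonpos le_rfl

section Markov

variable {Λ : Finset Site} (p : Params) (β : ℝ)

/-- The Markov property of the marked jump chain at the time of one jump. -/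
lemma lintegral_law_succ (η : Config Λ) (n : ℕ)
    {φ : ((i : Finset.Iic n) → Config Λ × ℝ) → ℝ≥0∞} (hφ : Measurable φ)
    {g : Config Λ × ℝ → ℝ≥0∞} (hg : Measurable g) :
    ∫⁻ ω, φ (Preorder.frestrictLe n ω) * g (ω (n + 1)) ∂(law p β η) =
      ∫⁻ ω, φ (Preorder.frestrictLe n ω) * ∫⁻ y, g y ∂(stepKernel p β (ω n).1) ∂(law p β η) := by
  set κ : (n : ℕ) → Kernel ((i : Finset.Iic n) → Config Λ × ℝ) (Config Λ × ℝ) :=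
    fun n => (stepKernel p β).comap (lastState n) (measurable_lastState n) with hκ
  set u : (i : Finset.Iic 0) → Config Λ × ℝ := fun _ => (η, 0) with hu
  have hlaw : law p β η = Kernel.traj (X := fun _ => Config Λ × ℝ) κ 0 u := rfl
  have h1 := Kernel.partialTraj_compProd_traj (X := fun _ => Config Λ × ℝ) (κ := κ)
    (Nat.zero_le n) u
  have hk : Measurable fun q : ((i : Finset.Iic n) → Config Λ × ℝ) × (ℕ → Config Λ × ℝ) =>
      φ q.1 * g (q.2 (n + 1)) :=
    (hφ.comp measurable_fst).mul (hg.comp ((measurable_pi_apply (n + 1)).comp measurable_snd))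
  have hfr : Measurable fun ω : ℕ → Config Λ × ℝ => (Preorder.frestrictLe n ω, ω) :=
    (Preorder.measurable_frestrictLe n).prodMk measurable_id
  have hstep : Measurable fun ξ : Config Λ => ∫⁻ y, g y ∂(stepKernel p β ξ) :=
    Measurable.lintegral_kernel hg
  calc ∫⁻ ω, φ (Preorder.frestrictLe n ω) * g (ω (n + 1)) ∂(law p β η)
      = ∫⁻ q, φ q.1 * g (q.2 (n + 1)) ∂((law p β η).map fun ω => (Preorder.frestrictLe n ω, ω)) :=
        (lintegral_map hk hfr).symm
    _ = ∫⁻ h, ∫⁻ ω, φ h * g (ω (n + 1)) ∂(Kernel.traj (X := fun _ => Config Λ × ℝ) κ n h)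
          ∂(Kernel.partialTraj (X := fun _ => Config Λ × ℝ) κ 0 n u) := by
        rw [hlaw, ← h1, Measure.lintegral_compProd hk]
    _ = ∫⁻ h, φ h * ∫⁻ y, g y ∂(stepKernel p β (lastState n h))
          ∂(Kernel.partialTraj (X := fun _ => Config Λ × ℝ) κ 0 n u) := by
        refine lintegral_congr fun h => ?_
        have hgn : Measurable fun ω : ℕ → Config Λ × ℝ => g (ω (n + 1)) :=
          hg.comp (measurable_pi_apply (n + 1))
        rw [lintegral_const_mul _ hgn]
        congr 1
        have h3 := Kernel.map_traj_succ_self (X := fun _ => Config Λ × ℝ) (κ := κ) (a := n)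
        have h4 : κ n h = (Kernel.traj (X := fun _ => Config Λ × ℝ) κ n h).map
            (fun x => x (n + 1)) := by
          rw [← Kernel.map_apply _ (measurable_pi_apply (n + 1)), h3]
        rw [← lintegral_map hg (measurable_pi_apply (n + 1)), ← h4]
        rfl
    _ = _ := by
        have hm : Measurable fun h : (i : Finset.Iic n) → Config Λ × ℝ =>
            φ h * ∫⁻ y, g y ∂(stepKernel p β (lastState n h)) :=
          hφ.mul (hstep.comp (measurable_lastState n))
        rw [← Kernel.traj_map_frestrictLe_apply, ← hlaw,
          lintegral_map hm (Preorder.measurable_frestrictLe n)]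
        rfl

lemma law_zero (η : Config Λ) : ∀ᵐ ω ∂(law p β η), ω 0 = (η, 0) := by
  have h := Kernel.traj_map_frestrictLe_apply (X := fun _ => Config Λ × ℝ)
    (κ := fun n => (stepKernel p β).comap (lastState n) (measurable_lastState n)) 0 0
    (fun _ => ((η, 0) : Config Λ × ℝ))
  rw [Kernel.partialTraj_self, Kernel.id_apply] at h
  have h2 : ∀ᵐ y ∂((law p β η).map (Preorder.frestrictLe (π := fun _ => Config Λ × ℝ) 0)),
      y = fun _ => (η, 0) := by
    have : (law p β η).map (Preorder.frestrictLe (π := fun _ => Config Λ × ℝ) 0) =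
      Measure.dirac fun _ => (η, 0) := h
    rw [this]
    exact (ae_dirac_iff (measurableSet_singleton _)).2 rfl
  filter_upwards [ae_of_ae_map (Preorder.measurable_frestrictLe 0).aemeasurable h2] with ω hω
  exact congrFun hω ⟨0, Finset.mem_Iic.2 le_rfl⟩

open scoped Classical in
/-- The indicator of the event that the first `n + 1` visited states avoid `F`. -/
def survival (F : Set (Config Λ)) (n : ℕ) (ω : ℕ → Config Λ × ℝ) : ℝ≥0∞ :=
  if ∀ k ≤ n, (ω k).1 ∉ F then 1 else 0

open scoped Classical in
lemma exists_survival_eq (F : Set (Config Λ)) (n : ℕ) :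
    ∃ φ : ((i : Finset.Iic n) → Config Λ × ℝ) → ℝ≥0∞, Measurable φ ∧
      ∀ ω, survival F n ω = φ (Preorder.frestrictLe n ω) := by
  refine ⟨fun h => if ∀ i, (h i).1 ∉ F then 1 else 0, ?_, fun ω => ?_⟩
  · refine Measurable.ite ?_ measurable_const measurable_const
    have : {a : (i : Finset.Iic n) → Config Λ × ℝ | ∀ i, (a i).1 ∉ F} =
        ⋂ i, (fun a : (i : Finset.Iic n) → Config Λ × ℝ => (a i).1) ⁻¹' Fᶜ := by
      ext; simp
    rw [this]
    exact MeasurableSet.iInter fun i =>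
      (measurable_fst.comp (measurable_pi_apply i)) (Set.toFinite _).measurableSet
  · unfold survival
    congr 1
    exact propext ⟨fun h i => h i (Finset.mem_Iic.1 i.2),
      fun h k hk => h ⟨k, Finset.mem_Iic.2 hk⟩⟩

lemma measurable_survival (F : Set (Config Λ)) (n : ℕ) : Measurable (survival F n) := by
  obtain ⟨φ, hφ, h⟩ := exists_survival_eq F n
  rw [funext h]
  exact hφ.comp (Preorder.measurable_frestrictLe n)

lemma lintegral_survival_mul (η : Config Λ) (F : Set (Config Λ)) (n : ℕ)
    {g : Config Λ × ℝ → ℝ≥0∞} (hg : Measurable g) :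
    ∫⁻ ω, survival F n ω * g (ω (n + 1)) ∂(law p β η) =
      ∫⁻ ω, survival F n ω * ∫⁻ y, g y ∂(stepKernel p β (ω n).1) ∂(law p β η) := by
  obtain ⟨φ, hφ, h⟩ := exists_survival_eq F n
  simp only [h]
  exact lintegral_law_succ p β η n hφ hg

lemma survival_mul_of_zero {F : Set (Config Λ)} {f : Config Λ → ℝ≥0∞} (hf : ∀ ξ ∈ F, f ξ = 0)
    (n : ℕ) (ω : ℕ → Config Λ × ℝ) :
    survival F n ω * f (ω (n + 1)).1 = survival F (n + 1) ω * f (ω (n + 1)).1 := by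
  classical
  by_cases h : (ω (n + 1)).1 ∈ F
  · simp [hf _ h]
  · congr 1
    unfold survival
    congr 1
    refine propext ⟨fun h' k hk => ?_, fun h' k hk => h' k (hk.trans n.le_succ)⟩
    rcases Nat.le_succ_iff.1 hk with hk | rfl
    · exact h' k hk
    · exact h

/-- A function that vanishes on `F` and satisfies the first-step equations off `F` equals the expected
total holding time before `F` is reached, and `F` is reached almost surely. -/
lemma tsum_survival {η : Config Λ} {F : Set (Config Λ)} {f m : Config Λ → ℝ≥0∞} {ε : ℝ≥0∞}
    (hη : η ∉ F) (hf : ∀ ξ ∈ F, f ξ = 0) (hft : ∀ ξ, f ξ ≠ ∞) (hε : ε ≠ 0)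
    (hm : ∀ ξ ∉ F, ε ≤ m ξ)
    (hstep : ∀ ξ ∉ F, f ξ = m ξ + ∫⁻ y, f y.1 ∂(stepKernel p β ξ)) :
    ∑' n, ∫⁻ ω, survival F n ω * m (ω n).1 ∂(law p β η) = f η ∧
      Tendsto (fun n => ∫⁻ ω, survival F n ω ∂(law p β η)) atTop (𝓝 0) := by
  have hmeas : ∀ (g : Config Λ → ℝ≥0∞) n, Measurable fun ω : ℕ → Config Λ × ℝ => g (ω n).1 :=
    fun g n => (measurable_of_countable g).comp (measurable_fst.comp (measurable_pi_apply n))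
  set a : ℕ → ℝ≥0∞ := fun n => ∫⁻ ω, survival F n ω * f (ω n).1 ∂(law p β η) with ha
  set t : ℕ → ℝ≥0∞ := fun n => ∫⁻ ω, survival F n ω * m (ω n).1 ∂(law p β η) with ht
  have hrec : ∀ n, a n = t n + a (n + 1) := by
    intro n
    have h1 : a (n + 1) =
        ∫⁻ ω, survival F n ω * ∫⁻ y, f y.1 ∂(stepKernel p β (ω n).1) ∂(law p β η) := by
      rw [← lintegral_survival_mul p β η F n (g := fun y => f y.1)
        ((measurable_of_countable f).comp measurable_fst)]
      exact lintegral_congr fun ω => (survival_mul_of_zero hf n ω).symm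
    have hsm : Measurable fun ω => survival F n ω * m (ω n).1 :=
      (measurable_survival F n).mul (hmeas m n)
    rw [h1, ha, ht]
    simp only
    rw [← lintegral_add_left hsm]
    refine lintegral_congr fun ω => ?_
    by_cases h : (ω n).1 ∈ F
    · have : survival F n ω = 0 := if_neg fun h' => h' n le_rfl h
      simp [this]
    · rw [hstep _ h, mul_add]
  have ha0 : a 0 = f η := by
    have : a 0 = ∫⁻ _, f η ∂(law p β η) := by
      refine lintegral_congr_ae ?_
      filter_upwards [law_zero p β η] with ω hω
      have : survival F 0 ω = 1 := if_pos fun k hk => by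
        rw [Nat.le_zero.1 hk, hω]; exact hη
      rw [this, one_mul, hω]
    rw [this, lintegral_const, show law p β η Set.univ = 1 from ?_, mul_one]
    unfold law
    exact measure_univ
  have hsum : ∀ n, ∑ i ∈ Finset.range n, t i + a n = f η := by
    intro n
    induction n with
    | zero => simpa using ha0
    | succ n ih => rw [Finset.sum_range_succ, add_assoc, ← hrec, ih]
  have htsum : ∑' n, t n ≤ f η := by
    rw [ENNReal.tsum_eq_iSup_nat]
    exact iSup_le fun n => (hsum n).symm ▸ le_self_add
  set P : ℕ → ℝ≥0∞ := fun n => ∫⁻ ω, survival F n ω ∂(law p β η) with hP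
  have hPt : ∀ n, ε * P n ≤ t n := by
    intro n
    rw [hP, ht]
    simp only
    rw [← lintegral_const_mul _ (measurable_survival F n)]
    refine lintegral_mono fun ω => ?_
    by_cases h : (ω n).1 ∈ F
    · have : survival F n ω = 0 := if_neg fun h' => h' n le_rfl h
      simp [this]
    · rw [mul_comm]
      exact mul_le_mul_right (hm _ h) _
  have ht0 : Tendsto t atTop (𝓝 0) :=
    ENNReal.tendsto_atTop_zero_of_tsum_ne_top (ne_top_of_le_ne_top (hft η) htsum)
  have hεt : ε ≠ ∞ := ne_top_of_le_ne_top (hft η) ((hm η hη).trans ((hstep η hη) ▸ le_self_add))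
  have hP0 : Tendsto P atTop (𝓝 0) := by
    have h1 : Tendsto (fun n => ε⁻¹ * t n) atTop (𝓝 (ε⁻¹ * 0)) :=
      ENNReal.Tendsto.const_mul ht0 (Or.inr (ENNReal.inv_ne_top.2 hε))
    rw [mul_zero] at h1
    refine tendsto_of_tendsto_of_tendsto_of_le_of_le tendsto_const_nhds h1
      (fun _ => zero_le) fun n => ?_
    calc P n = ε⁻¹ * (ε * P n) := by rw [← mul_assoc, ENNReal.inv_mul_cancel hε hεt, one_mul]
      _ ≤ ε⁻¹ * t n := by gcongr; exact hPt n
  refine ⟨?_, hP0⟩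
  set M := ∑ ξ, f ξ with hM
  have hMt : M ≠ ∞ := ENNReal.sum_ne_top.2 fun ξ _ => hft ξ
  have haP : ∀ n, a n ≤ M * P n := by
    intro n
    rw [ha, hP]
    simp only
    rw [← lintegral_const_mul _ (measurable_survival F n)]
    refine lintegral_mono fun ω => ?_
    rw [mul_comm]
    exact mul_le_mul_left (Finset.single_le_sum (f := f) (fun _ _ => zero_le) (Finset.mem_univ _)) _
  have ha0' : Tendsto a atTop (𝓝 0) := by
    have h1 : Tendsto (fun n => M * P n) atTop (𝓝 (M * 0)) :=
      ENNReal.Tendsto.const_mul hP0 (Or.inr hMt)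
    rw [mul_zero] at h1
    exact tendsto_of_tendsto_of_tendsto_of_le_of_le tendsto_const_nhds h1 (fun _ => zero_le) haP
  have h1 : Tendsto (fun n => ∑ i ∈ Finset.range n, t i + a n) atTop (𝓝 (∑' n, t n + 0)) :=
    (ENNReal.summable.hasSum.tendsto_sum_nat).add ha0'
  simp only [hsum, add_zero] at h1
  exact tendsto_nhds_unique h1 tendsto_const_nhds |>.symm ▸ rfl

lemma stateAt_eq {ω : ℕ → Config Λ × ℝ} (hω : Monotone (jumpTime ω)) {t : ℝ} {n : ℕ}
    (h1 : jumpTime ω n ≤ t) (h2 : t < jumpTime ω (n + 1)) : stateAt ω t = (ω n).1 := by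
  have : sInf {n : ℕ | t < jumpTime ω (n + 1)} = n := by
    refine le_antisymm (Nat.sInf_le h2) (le_csInf ⟨n, h2⟩ fun m hm => ?_)
    by_contra! hmn
    exact absurd (hm.trans_le (hω (Nat.succ_le_of_lt hmn))) (not_lt.2 h1)
  rw [stateAt, this]

/-- Along a trajectory with positive holding times that reaches `F`, the hitting time is the sum of
the holding times spent before `F` is reached. -/
lemma hitTime_eq {F : Set (Config Λ)} {ω : ℕ → Config Λ × ℝ} (h00 : (ω 0).2 = 0)
    (h0 : (ω 0).1 ∉ F) (hpos : ∀ n, 0 < (ω (n + 1)).2) (hF : ∃ n, (ω n).1 ∈ F) :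
    hitTime F ω = ∑' n, survival F n ω * ENNReal.ofReal (ω (n + 1)).2 := by
  classical
  set N := Nat.find hF with hNdef
  have hN : (ω N).1 ∈ F := Nat.find_spec hF
  have hmin : ∀ k < N, (ω k).1 ∉ F := fun k hk => Nat.find_min hF hk
  have hN0 : N ≠ 0 := fun h => h0 (h ▸ hN)
  have hjump : ∀ n, jumpTime ω (n + 1) = jumpTime ω n + (ω (n + 1)).2 :=
    fun n => Finset.sum_range_succ _ _
  have hmono : StrictMono (jumpTime ω) := strictMono_nat_of_lt_succ fun n => by
    rw [hjump]; linarith [hpos n]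
  have hJ0 : jumpTime ω 0 = 0 := by simp [jumpTime, h00]
  have hJpos : 0 < jumpTime ω N := hJ0 ▸ hmono (Nat.pos_of_ne_zero hN0)
  have hbefore : ∀ t : ℝ, t < jumpTime ω N → stateAt ω t ∉ F := by
    intro t ht
    refine hmin _ (lt_of_le_of_lt (Nat.sInf_le (m := N - 1) ?_) (Nat.sub_one_lt hN0))
    simpa [Nat.sub_add_cancel (Nat.one_le_iff_ne_zero.2 hN0)] using ht
  have hat : stateAt ω (jumpTime ω N) ∈ F := by
    rw [stateAt_eq hmono.monotone le_rfl (hmono N.lt_succ_self)]; exact hN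
  have hlhs : hitTime F ω = ENNReal.ofReal (jumpTime ω N) := by
    refine le_antisymm ?_ (le_iInf₂ fun t ht => ?_)
    · refine iInf₂_le (Real.toNNReal (jumpTime ω N)) ?_
      rw [Real.coe_toNNReal _ hJpos.le]
      exact ⟨hat, jumpTime ω N / 2, by linarith, by linarith, hbefore _ (by linarith)⟩
    · by_contra! hlt
      refine hbefore t ?_ ht.1
      rw [← ENNReal.ofReal_coe_nnreal] at hlt
      exact (ENNReal.ofReal_lt_ofReal_iff hJpos).1 hlt
  have hs1 : ∀ n < N, survival F n ω = 1 := fun n hn =>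
    if_pos fun k hk => hmin k (hk.trans_lt hn)
  have hs0 : ∀ n ∉ Finset.range N, survival F n ω * ENNReal.ofReal (ω (n + 1)).2 = 0 := by
    intro n hn
    have : survival F n ω = 0 := if_neg fun h => h N (by simpa using hn) hN
    rw [this, zero_mul]
  rw [hlhs, tsum_eq_sum hs0]
  have hJN : jumpTime ω N = ∑ n ∈ Finset.range N, (ω (n + 1)).2 := by
    rw [jumpTime, Finset.sum_range_succ', h00, add_zero]
  rw [hJN, ENNReal.ofReal_sum_of_nonneg fun n _ => (hpos n).le]
  exact Finset.sum_congr rfl fun n hn => by rw [hs1 n (Finset.mem_range.1 hn), one_mul]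

lemma lintegral_stepKernel_snd {ξ : Config Λ} (hξ : 0 < totalRate p β ξ) {g : ℝ → ℝ≥0∞}
    (hg : Measurable g) :
    ∫⁻ y, g y.2 ∂(stepKernel p β ξ) = ∫⁻ x, g x ∂(expMeasure (totalRate p β ξ)) := by
  have h : stepKernel p β ξ = (jumpLaw p β ξ).prod (holdLaw p β ξ) := rfl
  have h2 : holdLaw p β ξ = expMeasure (totalRate p β ξ) := by simp [holdLaw, hξ]
  rw [h, ← lintegral_map hg measurable_snd, ← h2]
  congr 1
  exact Measure.snd_prod

lemma lintegral_stepKernel_fst {ξ : Config Λ} (hξ : 0 < totalRate p β ξ) (g : Config Λ → ℝ≥0∞) :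
    ∫⁻ y, g y.1 ∂(stepKernel p β ξ) =
      ∑ η', ENNReal.ofReal (rate p β ξ η' / totalRate p β ξ) * g η' := by
  have h : stepKernel p β ξ = (jumpLaw p β ξ).prod (holdLaw p β ξ) := rfl
  have hg : Measurable g := measurable_of_countable g
  rw [h, ← lintegral_map hg measurable_fst]
  have h1 : ((jumpLaw p β ξ).prod (holdLaw p β ξ)).map Prod.fst = jumpLaw p β ξ :=
    Measure.fst_prod
  rw [h1, jumpLaw, if_pos hξ, lintegral_finsetSum_measure]
  refine Finset.sum_congr rfl fun η' _ => ?_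
  rw [lintegral_smul_measure, lintegral_dirac' _ hg, smul_eq_mul]

instance (η : Config Λ) : IsProbabilityMeasure (law p β η) := by
  unfold law; infer_instance

lemma ae_hold_pos (hr : ∀ ξ : Config Λ, 0 < totalRate p β ξ) (η : Config Λ) :
    ∀ᵐ ω ∂(law p β η), ∀ n, 0 < (ω (n + 1)).2 := by
  rw [ae_all_iff]
  intro n
  set g : Config Λ × ℝ → ℝ≥0∞ := fun y => (Set.Iic (0 : ℝ)).indicator 1 y.2 with hgdef
  have hg1 : Measurable ((Set.Iic (0 : ℝ)).indicator (1 : ℝ → ℝ≥0∞)) :=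
    measurable_one.indicator measurableSet_Iic
  have hg : Measurable g := hg1.comp measurable_snd
  have h := lintegral_law_succ p β η n (φ := fun _ => 1) measurable_const hg
  have h2 : ∀ ξ : Config Λ, ∫⁻ y, g y ∂(stepKernel p β ξ) = 0 := by
    intro ξ
    rw [lintegral_stepKernel_snd p β (hr ξ) hg1, lintegral_eq_zero_iff hg1]
    filter_upwards [expMeasure_pos (r := totalRate p β ξ)] with x hx
    simp [hx]
  simp only [h2, mul_zero, one_mul, lintegral_zero] at h
  have hgn : Measurable fun ω : ℕ → Config Λ × ℝ => g (ω (n + 1)) :=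
    hg.comp (measurable_pi_apply (n + 1))
  rw [lintegral_eq_zero_iff hgn] at h
  filter_upwards [h] with ω hω
  by_contra! hle
  have : g (ω (n + 1)) = 1 := Set.indicator_of_mem (s := Set.Iic (0 : ℝ)) hle _
  rw [this] at hω
  exact one_ne_zero hω

/-- The mean hitting time is the solution of the first-step equations. -/
theorem meanHitTime_eq (hr : ∀ ξ : Config Λ, 0 < totalRate p β ξ) {F : Set (Config Λ)}
    {η : Config Λ} (hη : η ∉ F) {f : Config Λ → ℝ} (h0 : ∀ ξ, 0 ≤ f ξ) (hf : ∀ ξ ∈ F, f ξ = 0)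
    (hstep : ∀ ξ ∉ F, totalRate p β ξ * f ξ = 1 + ∑ ξ', rate p β ξ ξ' * f ξ') :
    meanHitTime p β η F = ENNReal.ofReal (f η) := by
  classical
  set fE : Config Λ → ℝ≥0∞ := fun ξ => ENNReal.ofReal (f ξ) with hfE
  set m : Config Λ → ℝ≥0∞ := fun ξ => ENNReal.ofReal (1 / totalRate p β ξ) with hm
  have hm0 : ∀ ξ, m ξ ≠ 0 := fun ξ => by
    simpa [hm] using hr ξ
  obtain ⟨ξ₀, _, hξ₀⟩ := Finset.exists_min_image Finset.univ m ⟨η, Finset.mem_univ η⟩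
  have hstepE : ∀ ξ ∉ F, fE ξ = m ξ + ∫⁻ y, fE y.1 ∂(stepKernel p β ξ) := by
    intro ξ hξ
    rw [lintegral_stepKernel_fst p β (hr ξ), hm, hfE]
    have hnn : ∀ ξ' : Config Λ, 0 ≤ rate p β ξ ξ' / totalRate p β ξ :=
      fun ξ' => div_nonneg (rate_nonneg p β ξ ξ') (hr ξ).le
    simp only [← ENNReal.ofReal_mul (hnn _)]
    rw [← ENNReal.ofReal_sum_of_nonneg fun ξ' _ => mul_nonneg (hnn ξ') (h0 ξ'),
      ← ENNReal.ofReal_add (div_nonneg zero_le_one (hr ξ).le)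
        (Finset.sum_nonneg fun ξ' _ => mul_nonneg (hnn ξ') (h0 ξ'))]
    congr 1
    have hne := (hr ξ).ne'
    have := hstep ξ hξ
    rw [Finset.sum_congr rfl fun ξ' _ => div_mul_eq_mul_div (rate p β ξ ξ') _ (f ξ'),
      ← Finset.sum_div, ← add_div, ← this, mul_div_cancel_left₀ _ hne]
  obtain ⟨hts, hP⟩ := tsum_survival p β (η := η) (F := F) (f := fE) (m := m) (ε := m ξ₀) hη
    (fun ξ hξ => by simp [hfE, hf ξ hξ]) (fun ξ => ENNReal.ofReal_ne_top) (hm0 ξ₀)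
    (fun ξ _ => hξ₀ ξ (Finset.mem_univ _)) hstepE
  have hreach : ∀ᵐ ω ∂(law p β η), ∃ n, (ω n).1 ∈ F := by
    rw [ae_iff]
    refine le_antisymm (ge_of_tendsto' hP fun n => ?_) zero_le
    have hset : MeasurableSet {ω : ℕ → Config Λ × ℝ | survival F n ω = 1} :=
      measurable_survival F n (measurableSet_singleton 1)
    calc law p β η {ω | ¬ ∃ n, (ω n).1 ∈ F}
        ≤ law p β η {ω | survival F n ω = 1} := by
          refine measure_mono fun ω hω => ?_
          simp only [Set.mem_ofPred_eq, not_exists] at hω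
          exact if_pos fun k _ => hω k
      _ = ∫⁻ ω, {ω | survival F n ω = 1}.indicator 1 ω ∂(law p β η) :=
          (lintegral_indicator_one hset).symm
      _ ≤ ∫⁻ ω, survival F n ω ∂(law p β η) := by
          refine lintegral_mono fun ω => ?_
          by_cases h : survival F n ω = 1
          · simp [h]
          · simp [h]
  have hg : Measurable fun x : ℝ => ENNReal.ofReal x := ENNReal.measurable_ofReal
  rw [meanHitTime]
  calc ∫⁻ ω, hitTime F ω ∂(law p β η)
      = ∫⁻ ω, ∑' n, survival F n ω * ENNReal.ofReal (ω (n + 1)).2 ∂(law p β η) := by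
        refine lintegral_congr_ae ?_
        filter_upwards [law_zero p β η, ae_hold_pos p β hr η, hreach] with ω h1 h2 h3
        exact hitTime_eq (by rw [h1]) (by rw [h1]; exact hη) h2 h3
    _ = ∑' n, ∫⁻ ω, survival F n ω * ENNReal.ofReal (ω (n + 1)).2 ∂(law p β η) := by
        refine lintegral_tsum fun n => Measurable.aemeasurable ?_
        exact (measurable_survival F n).mul
          (hg.comp (measurable_snd.comp (measurable_pi_apply (n + 1))))
    _ = ∑' n, ∫⁻ ω, survival F n ω * m (ω n).1 ∂(law p β η) := by
        refine tsum_congr fun n => ?_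
        have := lintegral_survival_mul p β η F n (g := fun y => ENNReal.ofReal y.2)
          (hg.comp measurable_snd)
        rw [this]
        refine lintegral_congr fun ω => ?_
        rw [lintegral_stepKernel_snd p β (hr _) hg, lintegral_expMeasure (hr _)]
    _ = ENNReal.ofReal (f η) := hts

end Markov

/-! ### Elementary moves and connectivity -/

section Moves

variable {Λ : Finset Site}

lemma nbr_symm {x y : Site} (h : nbr x y) : nbr y x := by
  unfold nbr at *
  rwa [abs_sub_comm y.1, abs_sub_comm y.2]

lemma nbr_ne {x y : Site} (h : nbr x y) : x ≠ y := by
  rintro rfl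
  simp [nbr] at h

lemma adj_create {η : Config Λ} {x : Λ} (hx : (x : Site) ∈ innerBoundary Λ) (h0 : η x = 0)
    {k : Fin 3} (hk : k ≠ 0) : (moves Λ).Adj η (Function.update η x k) := by
  rw [moves, SimpleGraph.fromRel_adj]
  refine ⟨fun h => hk ?_, Or.inl (Or.inr ⟨x, hx, h0, k, hk, rfl⟩)⟩
  rw [← h0, h, Function.update_self]

lemma update_comp_swap {η : Config Λ} {x y : Λ} (hx : η x = 0) (hy : η y = 0) (k : Fin 3) :
    Function.update η x k ∘ Equiv.swap x y = Function.update η y k := by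
  funext z
  rcases eq_or_ne z x with rfl | hzx
  · rcases eq_or_ne z y with rfl | hxy
    · simp
    · simp [Function.update_of_ne hxy, Function.update_of_ne hxy.symm, hx, hy]
  · rcases eq_or_ne z y with rfl | hzy
    · simp
    · simp [Equiv.swap_apply_of_ne_of_ne hzx hzy, Function.update_of_ne hzx,
        Function.update_of_ne hzy]

lemma adj_hop {η : Config Λ} {x y : Λ} (hxy : nbr x y) (hx : η x = 0) (hy : η y = 0)
    {k : Fin 3} (hk : k ≠ 0) :
    (moves Λ).Adj (Function.update η x k) (Function.update η y k) := by
  have hne : x ≠ y := fun h => nbr_ne hxy (congrArg _ h)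
  rw [moves, SimpleGraph.fromRel_adj]
  refine ⟨fun h => hk ?_, Or.inl (Or.inl ⟨x, y, hxy, ?_, ?_, ?_⟩)⟩
  · have := congrFun h x
    rwa [Function.update_self, Function.update_of_ne hne, hx] at this
  · rwa [Function.update_self]
  · rwa [Function.update_of_ne hne.symm]
  · exact (update_comp_swap hx hy k).symm

/-- A property of sites that holds in the internal boundary and propagates between neighbours can be
transported along any ray: as `Λ` is finite, the ray meets the internal boundary. -/
lemma ray_induction {w : Λ} {d : Site} (hd : nbr 0 d) {S P : Λ → Prop}
    (hS : ∀ (j : ℕ) (x : Λ), (x : Site) = w + j • d → S x)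
    (hb : ∀ y : Λ, (y : Site) ∈ innerBoundary Λ → S y → P y)
    (hs : ∀ x y : Λ, nbr x y → S x → S y → P y → P x) : P w := by
  by_contra hw
  have key : ∀ j : ℕ, ∃ x : Λ, (x : Site) = w + j • d ∧ ¬ P x := by
    intro j
    induction j with
    | zero => exact ⟨w, by simp, hw⟩
    | succ j ih =>
      obtain ⟨x, hx, hP⟩ := ih
      have hn : nbr (x : Site) (x + d) := by
        unfold nbr at *
        simpa using hd
      have hmem : (x : Site) + d ∈ Λ := by
        by_contra hmem
        exact hP (hb x ⟨x.2, _, hn, hmem⟩ (hS j x hx))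
      have hx' : (x : Site) + d = w + (j + 1) • d := by rw [hx, succ_nsmul, add_assoc]
      exact ⟨⟨_, hmem⟩, hx', fun h => hP (hs x ⟨_, hmem⟩ hn (hS j x hx) (hS (j + 1) _ hx') h)⟩
  choose u hu _ using key
  have hd0 : d ≠ 0 := (nbr_ne hd).symm
  have : Function.Injective u := by
    intro i j hij
    have h1 : (w : Site) + i • d = w + j • d := by rw [← hu, ← hu, hij]
    have h2 : (i : ℤ) • d = (j : ℤ) • d := by simpa using h1
    have h3 : ((i : ℤ) - j) • d = 0 := by rw [sub_smul, h2, sub_self]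
    rcases smul_eq_zero.1 h3 with h | h
    · omega
    · exact absurd h hd0
  exact not_injective_infinite_finite u this

lemma numParticles_update_zero_lt {η : Config Λ} {x : Λ} (hx : η x ≠ 0) :
    numParticles (Function.update η x 0) < numParticles η := by
  refine Finset.card_lt_card ⟨fun y hy => ?_, fun h => ?_⟩
  · simp only [Finset.mem_filter, Finset.mem_univ, true_and] at hy ⊢
    by_cases hyx : y = x
    · rw [hyx]; exact hx
    · rwa [Function.update_of_ne hyx] at hy
  · have : x ∈ Finset.univ.filter fun y => Function.update η x 0 y ≠ 0 := h (by simp [hx])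
    simp at this

/-- Every configuration can be emptied: the rightmost particle can be driven out of the box. -/
lemma reachable_emptyBox (η : Config Λ) : (moves Λ).Reachable η (emptyBox Λ) := by
  induction hn : numParticles η using Nat.strong_induction_on generalizing η with
  | _ n ih =>
    subst hn
    rcases (Finset.univ.filter fun x => η x ≠ 0).eq_empty_or_nonempty with h | h
    · have : η = emptyBox Λ := by
        funext x
        by_contra hx
        have hx' : x ∈ Finset.univ.filter fun x => η x ≠ 0 := by
          simp only [Finset.mem_filter, Finset.mem_univ, true_and]; exact hx
        rw [h] at hx'
        exact absurd hx' (Finset.notMem_empty _)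
      rw [this]
    · obtain ⟨x, hx, hmax⟩ := Finset.exists_max_image _ (fun x : Λ => (x : Site).1) h
      simp only [Finset.mem_filter, Finset.mem_univ, true_and] at hx hmax
      set η₀ := Function.update η x 0 with hη₀
      refine SimpleGraph.Reachable.trans ?_ (ih _ (numParticles_update_zero_lt hx) η₀ rfl)
      have h1 : (moves Λ).Reachable (Function.update η₀ x (η x)) η₀ := by
        refine ray_induction (w := x) (d := (1, 0)) (by simp [nbr]) (S := fun y => η₀ y = 0)
          (P := fun y => (moves Λ).Reachable (Function.update η₀ y (η x)) η₀) ?_ ?_ ?_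
        · intro j y hy
          by_cases hyx : y = x
          · simp [hη₀, hyx]
          · rw [hη₀, Function.update_of_ne hyx]
            by_contra hy0
            have h2 := hmax y hy0
            have h3 : (y : Site).1 = (x : Site).1 + j := by rw [hy]; simp
            have hj : j = 0 := by omega
            exact hyx (Subtype.ext (by rw [hy, hj]; simp))
        · intro y hy h0
          exact (adj_create hy h0 hx).symm.reachable
        · intro y z hyz h0 h0' hz
          exact (adj_hop hyz h0 h0' hx).reachable.trans hz
      have h2 : Function.update η₀ x (η x) = η := by simp [hη₀]
      rwa [h2] at h1

lemma moves_connected : (moves Λ).Connected :=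
  ⟨fun a b => (reachable_emptyBox a).trans (reachable_emptyBox b).symm⟩

lemma energy_emptyBox (p : Params) : energy p (emptyBox Λ) = 0 := by
  have h1 : numBonds (emptyBox Λ) = 0 := by
    rw [numBonds]
    convert Set.ncard_empty (Sym2 Λ)
    ext b
    simp [ActiveBond, emptyBox]
  have h2 : ∀ k : Fin 3, k ≠ 0 → numType (emptyBox Λ) k = 0 := fun k hk => by
    simp [numType, emptyBox, hk.symm]
  rw [energy, h1, h2 1 (by decide), h2 2 (by decide)]
  simp

end Moves

/-! ### Communication heights -/

section Landscape

variable {Λ : Finset Site} (p : Params)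

/-- `a` and `b` are connected by a path on which `S` holds throughout (or are equal). -/
def LinkedIn (S : Config Λ → Prop) (a b : Config Λ) : Prop :=
  Relation.ReflTransGen (fun a b => (moves Λ).Adj a b ∧ S a ∧ S b) a b

lemma LinkedIn.symm {S : Config Λ → Prop} {a b : Config Λ} (h : LinkedIn S a b) :
    LinkedIn S b a := by
  induction h with
  | refl => exact Relation.ReflTransGen.refl
  | tail _ h ih => exact Relation.ReflTransGen.head ⟨h.1.symm, h.2.2, h.2.1⟩ ih

lemma LinkedIn.mono {S T : Config Λ → Prop} (hST : ∀ ξ, S ξ → T ξ) {a b : Config Λ}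
    (h : LinkedIn S a b) : LinkedIn T a b := by
  induction h with
  | refl => exact Relation.ReflTransGen.refl
  | tail _ h ih => exact Relation.ReflTransGen.tail ih ⟨h.1, hST _ h.2.1, hST _ h.2.2⟩

lemma LinkedIn.exists_walk {S : Config Λ → Prop} {a b : Config Λ} (h : LinkedIn S a b)
    (ha : S a) : ∃ w : (moves Λ).Walk a b, ∀ ξ ∈ w.support, S ξ := by
  induction h with
  | refl => exact ⟨SimpleGraph.Walk.nil, by simpa using ha⟩
  | tail _ hbc ih =>
    obtain ⟨w, hw⟩ := ih
    refine ⟨w.concat hbc.1, fun ξ hξ => ?_⟩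
    rw [SimpleGraph.Walk.support_concat] at hξ
    simp only [List.mem_append, List.mem_singleton] at hξ
    rcases hξ with h | h
    · exact hw ξ h
    · exact h ▸ hbc.2.2

lemma linkedIn_of_walk {S : Config Λ → Prop} {a b : Config Λ} (w : (moves Λ).Walk a b)
    (hw : ∀ ξ ∈ w.support, S ξ) : LinkedIn S a b := by
  induction w with
  | nil => exact Relation.ReflTransGen.refl
  | cons hab w ih =>
    refine Relation.ReflTransGen.head ⟨hab, hw _ (by simp), hw _ (by simp)⟩
      (ih fun ξ hξ => hw ξ (by simp [hξ]))

lemma energy_le_height {a b ξ : Config Λ} (w : (moves Λ).Walk a b) (h : ξ ∈ w.support) :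
    energy p ξ ≤ height p w :=
  le_csSup (Set.toFinite _).bddAbove ⟨ξ, h, rfl⟩

lemma height_mem {a b : Config Λ} (w : (moves Λ).Walk a b) :
    ∃ ξ ∈ w.support, energy p ξ = height p w := by
  have : height p w ∈ energy p '' {ξ | ξ ∈ w.support} :=
    Set.Nonempty.csSup_mem ⟨_, a, w.start_mem_support, rfl⟩ (Set.toFinite _)
  obtain ⟨ξ, h, h'⟩ := this
  exact ⟨ξ, h, h'⟩

lemma height_le_iff {a b : Config Λ} (w : (moves Λ).Walk a b) (m : ℝ) :
    height p w ≤ m ↔ ∀ ξ ∈ w.support, energy p ξ ≤ m := by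
  refine ⟨fun h ξ hξ => (energy_le_height p w hξ).trans h, fun h => ?_⟩
  obtain ⟨ξ, hξ, h'⟩ := height_mem p w
  exact h' ▸ h ξ hξ

lemma finite_heights (a b : Config Λ) :
    (Set.range fun w : (moves Λ).Walk a b => height p w).Finite := by
  refine (Set.finite_range (energy p (Λ := Λ))).subset ?_
  rintro _ ⟨w, rfl⟩
  obtain ⟨ξ, -, h⟩ := height_mem p w
  exact ⟨ξ, h⟩

lemma commHeight_le {a b : Config Λ} (w : (moves Λ).Walk a b) : commHeight p a b ≤ height p w :=
  csInf_le (finite_heights p a b).bddBelow ⟨w, rfl⟩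

lemma exists_walk_height_eq (a b : Config Λ) :
    ∃ w : (moves Λ).Walk a b, height p w = commHeight p a b := by
  obtain ⟨w₀⟩ := moves_connected.preconnected a b
  exact Set.Nonempty.csInf_mem (s := Set.range fun w : (moves Λ).Walk a b => height p w)
    ⟨_, w₀, rfl⟩ (finite_heights p a b)

lemma finite_commHeights (A B : Set (Config Λ)) :
    {m | ∃ η ∈ A, ∃ η' ∈ B, m = commHeight p η η'}.Finite := by
  refine (Set.finite_range fun q : Config Λ × Config Λ => commHeight p q.1 q.2).subset ?_
  rintro _ ⟨a, -, b, -, rfl⟩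
  exact ⟨(a, b), rfl⟩

lemma commHeightSet_le {A B : Set (Config Λ)} {a b : Config Λ} (ha : a ∈ A) (hb : b ∈ B)
    (w : (moves Λ).Walk a b) : commHeightSet p A B ≤ height p w :=
  (csInf_le (finite_commHeights p A B).bddBelow ⟨a, ha, b, hb, rfl⟩).trans (commHeight_le p w)

lemma exists_isOptimal {A B : Set (Config Λ)} (hA : A.Nonempty) (hB : B.Nonempty) :
    ∃ (a b : Config Λ) (w : (moves Λ).Walk a b), IsOptimal p A B w := by
  obtain ⟨a₀, ha₀⟩ := hA
  obtain ⟨b₀, hb₀⟩ := hB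
  obtain ⟨a, ha, b, hb, h⟩ := Set.Nonempty.csInf_mem
    (s := {m | ∃ η ∈ A, ∃ η' ∈ B, m = commHeight p η η'}) ⟨_, a₀, ha₀, b₀, hb₀, rfl⟩
    (finite_commHeights p A B)
  obtain ⟨w, hw⟩ := exists_walk_height_eq p a b
  exact ⟨a, b, w, ha, hb, hw.trans h.symm⟩

variable {p}

lemma H1.nonempty {F : Set (Config Λ)} (h : H1 p F) : F.Nonempty := by
  obtain ⟨x, -, hx⟩ := Finset.exists_min_image Finset.univ (energy p (Λ := Λ))
    ⟨emptyBox Λ, Finset.mem_univ _⟩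
  exact ⟨x, h.stable_eq ▸ fun ξ => hx ξ (Finset.mem_univ ξ)⟩

lemma H1.energy_le {F : Set (Config Λ)} (h : H1 p F) {η : Config Λ} (hη : η ∈ F) (ξ : Config Λ) :
    energy p η ≤ energy p ξ := by
  rw [← h.stable_eq] at hη
  exact hη ξ

lemma H1.exists_lt {F : Set (Config Λ)} (h : H1 p F) {η : Config Λ} (hη : η ∉ F) :
    ∃ ξ : Config Λ, energy p ξ < energy p η := by
  by_contra! hcon
  exact hη (h.stable_eq ▸ hcon)

lemma H1.energy_neg {F : Set (Config Λ)} (h : H1 p F) {η : Config Λ} (hη : η ∈ F) :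
    energy p η < 0 := by
  obtain ⟨ξ, hξ⟩ := h.exists_lt h.empty_notMem
  rw [energy_emptyBox] at hξ
  exact (h.energy_le hη ξ).trans_lt hξ

lemma gammaStar_eq (F : Set (Config Λ)) : gammaStar p F = commHeightSet p {emptyBox Λ} F := by
  rw [gammaStar, energy_emptyBox, sub_zero]

/-- Every link from the empty to the full box reaches the height `Γ⋆`. -/
lemma not_linkedIn_lt {F : Set (Config Λ)} (h : H1 p F) {b : Config Λ} (hb : b ∈ F) :
    ¬ LinkedIn (fun ξ => energy p ξ < gammaStar p F) (emptyBox Λ) b := by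
  intro hl
  have hne : emptyBox Λ ≠ b := fun he => h.empty_notMem (he ▸ hb)
  have h0 : energy p (emptyBox Λ) < gammaStar p F := by
    rcases Relation.ReflTransGen.cases_head hl with he | ⟨c, hc, -⟩
    · exact absurd he hne
    · exact hc.2.1
  obtain ⟨w, hw⟩ := hl.exists_walk h0
  obtain ⟨ξ, hξ, he⟩ := height_mem p w
  have h1 := commHeightSet_le p (A := {emptyBox Λ}) rfl hb w
  rw [← gammaStar_eq, ← he] at h1
  exact absurd (hw ξ hξ) (not_lt.2 h1)

lemma exists_linkedIn_le {F : Set (Config Λ)} (h : H1 p F) :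
    ∃ b ∈ F, LinkedIn (fun ξ => energy p ξ ≤ gammaStar p F) (emptyBox Λ) b := by
  obtain ⟨a, b, w, ha, hb, hw⟩ := exists_isOptimal p (A := {emptyBox Λ}) ⟨_, rfl⟩ h.nonempty
  obtain rfl : a = emptyBox Λ := ha
  refine ⟨b, hb, linkedIn_of_walk w fun ξ hξ => ?_⟩
  rw [gammaStar_eq, ← hw]
  exact energy_le_height p w hξ

/-- Under (H2), a configuration of nonpositive energy other than the empty box descends to the full
box without climbing more than `V` above its own energy. -/
lemma linkedIn_of_nonpos {F : Set (Config Λ)} (h : H1 p F) {V : ℝ}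
    (hV : ∀ η, η ≠ emptyBox Λ → η ∉ F → stabLevel p η ≤ V) (η : Config Λ) (hη : energy p η ≤ 0)
    (hne : η ≠ emptyBox Λ) (hF : η ∉ F) :
    ∃ b ∈ F, LinkedIn (fun ξ => energy p ξ ≤ energy p η + V) η b := by
  induction hn : (Finset.univ.filter fun ξ : Config Λ => energy p ξ < energy p η).card
    using Nat.strong_induction_on generalizing η with
  | _ n ih =>
    subst hn
    obtain ⟨ξ₀, hξ₀⟩ := h.exists_lt hF
    obtain ⟨a, ξ, w, ha, hξ, hw⟩ := exists_isOptimal p (A := {η})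
      (B := {ξ : Config Λ | energy p ξ < energy p η}) ⟨_, rfl⟩ ⟨ξ₀, hξ₀⟩
    obtain rfl : a = η := ha
    have hlt : energy p ξ < energy p a := hξ
    have h1 := hV a hne hF
    rw [stabLevel, ← hw] at h1
    have hl : LinkedIn (fun ζ => energy p ζ ≤ energy p a + V) a ξ :=
      linkedIn_of_walk w fun ζ hζ => by linarith [energy_le_height p w hζ]
    by_cases hξF : ξ ∈ F
    · exact ⟨ξ, hξF, hl⟩
    · have hξe : ξ ≠ emptyBox Λ := by
        rintro rfl
        rw [energy_emptyBox] at hlt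
        linarith
      obtain ⟨b, hb, hl'⟩ := ih _ (Finset.card_lt_card ⟨fun ζ hζ => by
          simp only [Finset.mem_filter, Finset.mem_univ, true_and] at hζ ⊢
          linarith, fun hsub => by
          have : ξ ∈ Finset.univ.filter fun ζ : Config Λ => energy p ζ < energy p ξ :=
            hsub (by simpa using hlt)
          simp at this⟩) ξ (by linarith) hξe hξF rfl
      exact ⟨b, hb, hl.trans (hl'.mono fun ζ hζ => by linarith)⟩

end Landscape

/-! ### The prefactor as the capacity of a limiting network -/

section Prefactor

variable {Λ : Finset Site} (p : Params)

/-- The larger of the energies of the endpoints of an edge. -/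
def edgeLevel (a b : Config Λ) : ℝ := max (energy p a) (energy p b)

open scoped Classical in
/-- The conductances `e^{-β H(a)} c_β(a, b)`, multiplied by `e^{β Γ}`. -/
def cond (Γ β : ℝ) (a b : Config Λ) : ℝ :=
  if (moves Λ).Adj a b then Real.exp (-β * (edgeLevel p a b - Γ)) else 0

open scoped Classical in
/-- The limit of `cond` on functions that are constant along the edges of level below `Γ`. -/
def critCond (Γ : ℝ) (a b : Config Λ) : ℝ :=
  if (moves Λ).Adj a b ∧ edgeLevel p a b = Γ then 1 else 0

/-- The functions with values in `[0, 1]` that are `1` at the empty box and `0` on `F`. -/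
def boundaryFns (F : Set (Config Λ)) : Set (Config Λ → ℝ) :=
  {h | (∀ x, h x ∈ Set.Icc (0 : ℝ) 1) ∧ h (emptyBox Λ) = 1 ∧ ∀ x ∈ F, h x = 0}

/-- The functions in `boundaryFns F` that are constant along the edges of level below `Γ⋆`. -/
def admissible (F : Set (Config Λ)) : Set (Config Λ → ℝ) :=
  {h | h ∈ boundaryFns F ∧
    ∀ a b, (moves Λ).Adj a b → edgeLevel p a b < gammaStar p F → h a = h b}

/-- The energy of `h` in the limiting network, in which all edges of level `Γ⋆` have conductance one
and those of higher level are removed. -/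
def critForm (F : Set (Config Λ)) (h : Config Λ → ℝ) : ℝ :=
  dirichlet (critCond p (gammaStar p F)) h h

variable {p}

lemma edgeLevel_comm (a b : Config Λ) : edgeLevel p a b = edgeLevel p b a := max_comm _ _

lemma cond_nonneg (Γ β : ℝ) (a b : Config Λ) : 0 ≤ cond p Γ β a b := by
  unfold cond; split_ifs <;> positivity

lemma cond_comm (Γ β : ℝ) (a b : Config Λ) : cond p Γ β a b = cond p Γ β b a := by
  unfold cond; rw [edgeLevel_comm a b, SimpleGraph.adj_comm]

lemma critCond_nonneg (Γ : ℝ) (a b : Config Λ) : 0 ≤ critCond p Γ a b := by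
  unfold critCond; split_ifs <;> positivity

lemma critCond_comm (Γ : ℝ) (a b : Config Λ) : critCond p Γ a b = critCond p Γ b a := by
  unfold critCond; rw [edgeLevel_comm a b, SimpleGraph.adj_comm]

lemma isKilled_cond (Γ β : ℝ) {F : Set (Config Λ)} (hF : F.Nonempty) :
    IsKilled (cond p Γ β) F where
  nonneg := cond_nonneg Γ β
  symm := cond_comm Γ β
  reach x := by
    obtain ⟨y, hy⟩ := hF
    refine ⟨y, hy, ?_⟩
    obtain ⟨w⟩ := moves_connected.preconnected x y
    induction w with
    | nil => exact Relation.ReflTransGen.refl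
    | cons h _ ih =>
      refine Relation.ReflTransGen.head ?_ (ih hy)
      unfold cond
      rw [if_pos h]
      positivity

lemma mul_rate (Γ β : ℝ) (a b : Config Λ) :
    Real.exp (-β * (energy p a - Γ)) * rate p β a b = cond p Γ β a b := by
  unfold rate cond edgeLevel
  split_ifs
  · rw [← Real.exp_add]
    congr 1
    have : max (energy p a) (energy p b) = energy p a + max (energy p b - energy p a) 0 := by
      rcases le_total (energy p a) (energy p b) with h | h
      · rw [max_eq_right h, max_eq_left (by linarith)]; ring
      · rw [max_eq_left h, max_eq_right (by linarith)]; ring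
    rw [this]; ring
  · rw [mul_zero]

lemma totalRate_pos {F : Set (Config Λ)} (h : H1 p F) (β : ℝ) (ξ : Config Λ) :
    0 < totalRate p β ξ := by
  have : ∃ ξ', (moves Λ).Adj ξ ξ' := by
    obtain ⟨b, hb⟩ := h.nonempty
    have hne : ∃ c, ξ ≠ c := by
      by_cases hc : ξ = emptyBox Λ
      · exact ⟨b, fun he => h.empty_notMem (hc ▸ he ▸ hb)⟩
      · exact ⟨_, hc⟩
    obtain ⟨c, hc⟩ := hne
    obtain ⟨w⟩ := moves_connected.preconnected ξ c
    cases w with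
    | nil => exact absurd rfl hc
    | cons h _ => exact ⟨_, h⟩
  obtain ⟨ξ', hξ'⟩ := this
  refine Finset.sum_pos' (fun η _ => rate_nonneg p β ξ η) ⟨ξ', Finset.mem_univ _, ?_⟩
  unfold rate
  rw [if_pos hξ']
  positivity

/-- The mean hitting time in terms of the Green function of the rescaled network. -/
lemma meanHitTime_eq_sum {F : Set (Config Λ)} (h : H1 p F) (β : ℝ) {g : Config Λ → ℝ}
    (hg : IsGreen (cond p (gammaStar p F) β) F (emptyBox Λ) g) :
    ENNReal.ofReal (Real.exp (-β * gammaStar p F)) * meanHitTime p β (emptyBox Λ) F =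
      ENNReal.ofReal (∑ x, g x * Real.exp (-β * energy p x)) := by
  set Γ := gammaStar p F with hΓ
  have hK := isKilled_cond (p := p) Γ β h.nonempty
  obtain ⟨f, hf0, hf⟩ := hK.exists_solution fun x => Real.exp (-β * (energy p x - Γ))
  have hfnn := hK.nonneg_of_lap_nonneg (f := f) (fun x hx => (hf0 x hx).ge)
    (fun x hx _ => by rw [hf x hx]; positivity)
  have hstep : ∀ ξ ∉ F, totalRate p β ξ * f ξ = 1 + ∑ ξ', rate p β ξ ξ' * f ξ' := by
    intro ξ hξ
    have h1 := hf ξ hξ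
    simp only [lap, ← mul_rate] at h1
    have h2 : Real.exp (-β * (energy p ξ - Γ)) *
        (totalRate p β ξ * f ξ - ∑ ξ', rate p β ξ ξ' * f ξ') =
        Real.exp (-β * (energy p ξ - Γ)) * 1 := by
      rw [mul_one]
      refine Eq.trans ?_ h1
      rw [totalRate, Finset.sum_mul, ← Finset.sum_sub_distrib, Finset.mul_sum]
      exact Finset.sum_congr rfl fun _ _ => by ring
    have h3 := mul_left_cancel₀ (Real.exp_pos _).ne' h2
    linarith
  rw [meanHitTime_eq p β (totalRate_pos h β) h.empty_notMem hfnn hf0 hstep,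
    ← ENNReal.ofReal_mul (Real.exp_pos _).le, hg.eq_sum hK hf0 hf, Finset.mul_sum]
  congr 1
  refine Finset.sum_congr rfl fun x _ => ?_
  have : Real.exp (-β * energy p x) =
      Real.exp (-β * Γ) * Real.exp (-β * (energy p x - Γ)) := by
    rw [← Real.exp_add]; congr 1; ring
  rw [this]; ring

lemma isCompact_boundaryFns (F : Set (Config Λ)) : IsCompact (boundaryFns F) := by
  have h1 : IsCompact (Set.univ.pi fun _ : Config Λ => Set.Icc (0 : ℝ) 1) :=
    isCompact_univ_pi fun _ => isCompact_Icc
  have h2 : IsClosed {h : Config Λ → ℝ | h (emptyBox Λ) = 1 ∧ ∀ x ∈ F, h x = 0} := by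
    have : {h : Config Λ → ℝ | h (emptyBox Λ) = 1 ∧ ∀ x ∈ F, h x = 0} =
        {h | h (emptyBox Λ) = 1} ∩ ⋂ x ∈ F, {h | h x = 0} := by ext; simp
    rw [this]
    exact (isClosed_eq (continuous_apply _) continuous_const).inter
      (isClosed_biInter fun x _ => isClosed_eq (continuous_apply _) continuous_const)
  convert h1.inter_right h2 using 1
  ext h
  simp only [boundaryFns, Set.mem_inter_iff, Set.mem_univ_pi, Set.mem_ofPred_eq]

lemma isClosed_flat (Γ : ℝ) : IsClosed {h : Config Λ → ℝ |
    ∀ a b, (moves Λ).Adj a b → edgeLevel p a b < Γ → h a = h b} := by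
  have : {h : Config Λ → ℝ |
      ∀ a b, (moves Λ).Adj a b → edgeLevel p a b < Γ → h a = h b} =
      ⋂ (a) (b) (_ : (moves Λ).Adj a b) (_ : edgeLevel p a b < Γ), {h | h a = h b} := by
    ext; simp
  rw [this]
  exact isClosed_iInter fun a => isClosed_iInter fun b => isClosed_iInter fun _ =>
    isClosed_iInter fun _ => isClosed_eq (continuous_apply _) (continuous_apply _)

lemma continuous_critForm (F : Set (Config Λ)) : Continuous (critForm p F) := by
  unfold critForm dirichlet
  fun_prop

/-- The indicator of the well of the empty box is admissible. -/
lemma admissible_nonempty {F : Set (Config Λ)} (h : H1 p F) : (admissible p F).Nonempty := by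
  classical
  refine ⟨fun a => if LinkedIn (fun ξ => energy p ξ < gammaStar p F) (emptyBox Λ) a then 1 else 0,
    ⟨fun x => ?_, if_pos Relation.ReflTransGen.refl, fun x hx => if_neg (not_linkedIn_lt h hx)⟩,
    fun a b hab hlt => ?_⟩
  · simp only
    split_ifs <;> simp
  · obtain ⟨h1, h2⟩ := max_lt_iff.1 hlt
    exact if_congr ⟨fun hl => hl.tail ⟨hab, h1, h2⟩, fun hl => hl.tail ⟨hab.symm, h2, h1⟩⟩ rfl rfl

lemma exists_min_critForm {F : Set (Config Λ)} (h : H1 p F) :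
    ∃ h₀ ∈ admissible p F, ∀ f ∈ admissible p F, critForm p F h₀ ≤ critForm p F f := by
  have hc : IsCompact (admissible p F) :=
    (isCompact_boundaryFns F).inter_right (isClosed_flat (gammaStar p F))
  exact hc.exists_isMinOn (admissible_nonempty h) (continuous_critForm F).continuousOn

lemma critForm_pos {F : Set (Config Λ)} (h : H1 p F) {f : Config Λ → ℝ}
    (hf : f ∈ admissible p F) : 0 < critForm p F f := by
  have hnn : 0 ≤ critForm p F f := dirichlet_self_nonneg (critCond_nonneg _) f
  refine lt_of_le_of_ne hnn fun h0 => ?_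
  obtain ⟨b, hb, hl⟩ := exists_linkedIn_le h
  obtain ⟨n, hn⟩ := exists_chain_bound hl
  have := hn f 0 fun x y hxy => by
    rcases lt_or_eq_of_le (max_le hxy.2.1 hxy.2.2 : edgeLevel p x y ≤ gammaStar p F) with hlt | heq
    · rw [hf.2 x y hxy.1 hlt, sub_self, abs_zero]
    · have h1 := edge_le_dirichlet (critCond_nonneg (p := p) (gammaStar p F))
        (critCond_comm (gammaStar p F)) f x y
      rw [show dirichlet _ f f = 0 from h0.symm, critCond, if_pos ⟨hxy.1, heq⟩, one_mul] at h1
      rw [abs_nonpos_iff]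
      exact pow_eq_zero_iff two_ne_zero |>.1 (le_antisymm h1 (sq_nonneg _))
  rw [hf.1.2.1, hf.1.2.2 b hb] at this
  norm_num at this

/-- Functions that are nearly constant along the edges of level below `Γ⋆` nearly satisfy the lower
bound that holds on `admissible p F`, by compactness. -/
lemma exists_delta_critForm {F : Set (Config Λ)} {θ : ℝ}
    (hθ : ∀ f ∈ admissible p F, θ ≤ critForm p F f) {ε : ℝ} (hε : 0 < ε) :
    ∃ δ > 0, ∀ f ∈ boundaryFns F,
      (∀ a b, (moves Λ).Adj a b → edgeLevel p a b < gammaStar p F → |f a - f b| ≤ δ) →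
      θ - ε ≤ critForm p F f := by
  by_contra! hcon
  choose u hu1 hu2 hu3 using fun n : ℕ => hcon (1 / (n + 1 : ℝ)) (by positivity)
  obtain ⟨f, hf, φ, hφ, hlim⟩ := (isCompact_boundaryFns F).tendsto_subseq hu1
  have h0 : Tendsto (fun n => 1 / ((φ n : ℕ) + 1 : ℝ)) atTop (𝓝 0) :=
    tendsto_one_div_add_atTop_nhds_zero_nat.comp hφ.tendsto_atTop
  have hadm : f ∈ admissible p F := by
    refine ⟨hf, fun a b hab hlt => ?_⟩
    have h1 : Tendsto (fun n => |u (φ n) a - u (φ n) b|) atTop (𝓝 |f a - f b|) :=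
      (((continuous_apply a).tendsto f |>.comp hlim).sub
        ((continuous_apply b).tendsto f |>.comp hlim)).abs
    have h2 := le_of_tendsto_of_tendsto' h1 h0 fun n => hu2 (φ n) a b hab hlt
    exact sub_eq_zero.1 (abs_nonpos_iff.1 h2)
  have h1 : Tendsto (fun n => critForm p F (u (φ n))) atTop (𝓝 (critForm p F f)) :=
    ((continuous_critForm F).tendsto f).comp hlim
  have h2 := le_of_tendsto' h1 fun n => (hu3 (φ n)).le
  linarith [hθ f hadm]

lemma tendsto_exp_neg_mul {c : ℝ} (hc : 0 < c) :
    Tendsto (fun β : ℝ => Real.exp (-β * c)) atTop (𝓝 0) := by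
  refine Real.tendsto_exp_atBot.comp ?_
  have : (fun β : ℝ => -β * c) = fun β => β * (-c) := by funext; ring
  rw [this]
  exact tendsto_id.atTop_mul_const_of_neg (by linarith)

lemma tendsto_dirichlet_cond {F : Set (Config Λ)} {f : Config Λ → ℝ} (hf : f ∈ admissible p F) :
    Tendsto (fun β => dirichlet (cond p (gammaStar p F) β) f f) atTop (𝓝 (critForm p F f)) := by
  unfold critForm dirichlet
  refine Tendsto.div_const (tendsto_finsetSum _ fun a _ => tendsto_finsetSum _ fun b _ => ?_) _
  unfold cond critCond
  by_cases hab : (moves Λ).Adj a b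
  · simp only [hab, if_true, true_and]
    rcases lt_trichotomy (edgeLevel p a b) (gammaStar p F) with h | h | h
    · simp [hf.2 a b hab h]
    · simp [h]
    · rw [if_neg h.ne']
      exact (tendsto_exp_neg_mul (sub_pos.2 h)).mul_const _
  · simp [hab]

/-- The rescaled Green function at its pole converges to the inverse of the capacity of the limiting
network. -/
lemma tendsto_green {F : Set (Config Λ)} (h : H1 p F) {h₀ : Config Λ → ℝ}
    (hh : h₀ ∈ admissible p F) (hmin : ∀ f ∈ admissible p F, critForm p F h₀ ≤ critForm p F f)
    {g : ℝ → Config Λ → ℝ}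
    (hg : ∀ β, IsGreen (cond p (gammaStar p F) β) F (emptyBox Λ) (g β)) :
    Tendsto (fun β => g β (emptyBox Λ)) atTop (𝓝 (1 / critForm p F h₀)) := by
  set Γ := gammaStar p F with hΓ
  set o := emptyBox Λ
  set θ := critForm p F h₀ with hθ
  have hθpos : 0 < θ := critForm_pos h hh
  have hK : ∀ β, IsKilled (cond p Γ β) F := fun β => isKilled_cond Γ β h.nonempty
  have hgpos : ∀ β, 0 < g β o := fun β => (hg β).pole_pos (hK β)
  have hup : ∀ β, 1 / g β o ≤ dirichlet (cond p Γ β) h₀ h₀ := fun β => by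
    rw [div_le_iff₀ (hgpos β), mul_comm]
    exact (hg β).one_le_mul_dirichlet (hK β) hh.1.2.2 hh.1.2.1
  have hup_lim := tendsto_dirichlet_cond hh
  set e : ℝ → Config Λ → ℝ := fun β x => g β x / g β o with he
  have hemem : ∀ β, e β ∈ boundaryFns F := fun β => by
    refine ⟨fun x => ⟨div_nonneg ((hg β).nonneg (hK β) x) (hgpos β).le,
      (div_le_one (hgpos β)).2 ((hg β).le_pole (hK β) x)⟩, div_self (hgpos β).ne', fun x hx => ?_⟩
    simp only [he, (hg β).zero x hx, zero_div]
  have hedir : ∀ β, dirichlet (cond p Γ β) (e β) (e β) = 1 / g β o := fun β => by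
    have h1 : dirichlet (cond p Γ β) (e β) (e β) =
        dirichlet (cond p Γ β) (g β) (g β) / g β o ^ 2 := by
      rw [dirichlet, dirichlet, div_right_comm]
      congr 1
      rw [Finset.sum_div]
      refine Finset.sum_congr rfl fun x _ => ?_
      rw [Finset.sum_div]
      refine Finset.sum_congr rfl fun y _ => ?_
      simp only [he]
      ring
    rw [h1, (hg β).dirichlet_eq (hK β).symm (hg β).zero]
    have := (hgpos β).ne'
    field_simp
  have hcrit : ∀ β, critForm p F (e β) ≤ 1 / g β o := fun β => by
    rw [← hedir]
    refine div_le_div_of_nonneg_right (Finset.sum_le_sum fun x _ => Finset.sum_le_sum fun y _ =>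
      mul_le_mul_of_nonneg_right ?_ (mul_self_nonneg _)) zero_le_two
    unfold critCond cond
    by_cases hxy : (moves Λ).Adj x y
    · by_cases hl : edgeLevel p x y = gammaStar p F
      · simp [hxy, hl, hΓ]
      · simp only [hxy, hl, and_false, if_false, if_true]
        positivity
    · simp [hxy]
  have hlow : ∀ ε > 0, ∀ᶠ β in atTop, θ - ε ≤ 1 / g β o := by
    intro ε hε
    obtain ⟨δ, hδ, hδ'⟩ := exists_delta_critForm hmin hε
    have hev1 : ∀ᶠ β in atTop, dirichlet (cond p Γ β) h₀ h₀ ≤ θ + 1 :=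
      hup_lim.eventually_le_const (by linarith)
    have hev2 : ∀ᶠ β in atTop, ∀ a b : Config Λ, edgeLevel p a b < Γ →
        Real.exp (-β * (Γ - edgeLevel p a b)) * (θ + 1) ≤ δ ^ 2 := by
      rw [eventually_all]; intro a
      rw [eventually_all]; intro b
      by_cases hl : edgeLevel p a b < Γ
      · have := (tendsto_exp_neg_mul (sub_pos.2 hl)).mul_const (θ + 1)
        rw [zero_mul] at this
        filter_upwards [this.eventually_le_const (pow_pos hδ 2)] with β hβ _ using hβ
      · exact Eventually.of_forall fun β hl' => absurd hl' hl
    filter_upwards [hev1, hev2] with β h1 h2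
    refine (hδ' (e β) (hemem β) fun a b hab hl => ?_).trans (hcrit β)
    have h3 := edge_le_dirichlet (cond_nonneg (p := p) Γ β) (cond_comm Γ β) (e β) a b
    rw [hedir] at h3
    have h4 := h3.trans ((hup β).trans h1)
    rw [cond, if_pos hab] at h4
    have h5 := mul_le_mul_of_nonneg_left h4 (Real.exp_pos (-β * (Γ - edgeLevel p a b))).le
    rw [← mul_assoc, ← Real.exp_add] at h5
    have h6 : -β * (Γ - edgeLevel p a b) + -β * (edgeLevel p a b - Γ) = 0 := by ring
    rw [h6, Real.exp_zero, one_mul] at h5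
    exact abs_le_of_sq_le_sq (h5.trans (h2 a b hl)) hδ.le
  have hlim : Tendsto (fun β => 1 / g β o) atTop (𝓝 θ) := by
    rw [tendsto_order]
    refine ⟨fun a ha => ?_, fun a ha => ?_⟩
    · filter_upwards [hlow ((θ - a) / 2) (by linarith)] with β hβ
      linarith
    · filter_upwards [hup_lim.eventually_lt_const ha] with β hβ
      exact (hup β).trans_lt hβ
  have := hlim.inv₀ hθpos.ne'
  simpa using this

/-- A link from the pole to `F` below the level `M` bounds the Green function at its pole. -/
lemma exists_green_pole_le {F : Set (Config Λ)} (Γ : ℝ) {x y : Config Λ} {M : ℝ} (hy : y ∈ F)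
    (hl : LinkedIn (fun ξ => energy p ξ ≤ M) x y) :
    ∃ C : ℝ, ∀ (β : ℝ) (g : Config Λ → ℝ), 0 ≤ β → IsGreen (cond p Γ β) F x g →
      g x ≤ C * Real.exp (β * (M - Γ)) := by
  obtain ⟨n, hn⟩ := exists_chain_bound hl
  refine ⟨(n : ℝ) ^ 2, fun β g hβ hg => ?_⟩
  have hK : IsKilled (cond p Γ β) F := isKilled_cond Γ β ⟨y, hy⟩
  have hpos := hg.pole_pos hK
  set E := Real.exp (β * (M - Γ)) with hE
  have hEpos : 0 < E := Real.exp_pos _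
  have h1 := hn g (√(g x * E)) fun a b hab => by
    refine Real.abs_le_sqrt ?_
    have h2 := edge_le_dirichlet (cond_nonneg (p := p) Γ β) (cond_comm Γ β) g a b
    rw [hg.dirichlet_eq hK.symm hg.zero, cond, if_pos hab.1] at h2
    have h3 : E⁻¹ ≤ Real.exp (-β * (edgeLevel p a b - Γ)) := by
      rw [hE, ← Real.exp_neg]
      refine Real.exp_le_exp.2 ?_
      have := mul_le_mul_of_nonneg_left (max_le hab.2.1 hab.2.2) hβ
      unfold edgeLevel
      nlinarith
    have h4 := (mul_le_mul_of_nonneg_right h3 (sq_nonneg (g a - g b))).trans h2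
    rwa [inv_mul_le_iff₀ hEpos, mul_comm] at h4
  rw [hg.zero y hy, sub_zero, abs_of_pos hpos] at h1
  have h5 : g x * g x ≤ g x * ((n : ℝ) ^ 2 * E) := by
    calc g x * g x ≤ (n * √(g x * E)) * (n * √(g x * E)) := mul_self_le_mul_self hpos.le h1
      _ = (n : ℝ) ^ 2 * (√(g x * E) * √(g x * E)) := by ring
      _ = g x * ((n : ℝ) ^ 2 * E) := by rw [Real.mul_self_sqrt (by positivity)]; ring
  exact le_of_mul_le_mul_left h5 hpos

/-- The prefactor is the inverse of the capacity of the limiting network. -/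
theorem tendsto_meanHitTime {F : Set (Config Λ)} (h : H1 p F) (h2 : H2 p F) {h₀ : Config Λ → ℝ}
    (hh : h₀ ∈ admissible p F) (hmin : ∀ f ∈ admissible p F, critForm p F h₀ ≤ critForm p F f) :
    Tendsto (fun β : ℝ => ENNReal.ofReal (Real.exp (-β * gammaStar p F)) *
      meanHitTime p β (emptyBox Λ) F) atTop (𝓝 (ENNReal.ofReal (1 / critForm p F h₀))) := by
  set Γ := gammaStar p F with hΓ
  set o := emptyBox Λ with ho
  have hK : ∀ β, IsKilled (cond p Γ β) F := fun β => isKilled_cond Γ β h.nonempty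
  choose g hg using fun β => (hK β).exists_green h.empty_notMem
  rw [funext fun β => meanHitTime_eq_sum h β (hg β)]
  refine ENNReal.tendsto_ofReal ?_
  have hlim := tendsto_green h hh hmin hg
  classical
  have hsum : 1 / critForm p F h₀ = ∑ x : Config Λ, if x = o then 1 / critForm p F h₀ else 0 := by
    simp
  rw [hsum]
  refine tendsto_finsetSum _ fun x _ => ?_
  split_ifs with hx
  · rw [hx, ho, energy_emptyBox]
    simpa using hlim
  by_cases hxF : x ∈ F
  · simp [(hg _).zero x hxF]
  rcases lt_or_ge 0 (energy p x) with hpos | hneg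
  · have h0 := hlim.mul (tendsto_exp_neg_mul hpos)
    rw [mul_zero] at h0
    refine tendsto_of_tendsto_of_tendsto_of_le_of_le tendsto_const_nhds h0 (fun β => ?_) fun β => ?_
    · exact mul_nonneg ((hg β).nonneg (hK β) x) (Real.exp_pos _).le
    · exact mul_le_mul_of_nonneg_right ((hg β).le_pole (hK β) x) (Real.exp_pos _).le
  · obtain ⟨V, hVΓ, hV⟩ := h2
    obtain ⟨b, hb, hl⟩ := linkedIn_of_nonpos h hV x hneg hx hxF
    obtain ⟨C, hC⟩ := exists_green_pole_le Γ hb hl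
    choose g' hg' using fun β => (hK β).exists_green hxF
    have h0 := (tendsto_exp_neg_mul (sub_pos.2 hVΓ)).const_mul C
    rw [mul_zero] at h0
    refine tendsto_of_tendsto_of_tendsto_of_le_of_le' tendsto_const_nhds h0
      (Eventually.of_forall fun β => ?_) ?_
    · exact mul_nonneg ((hg β).nonneg (hK β) x) (Real.exp_pos _).le
    · filter_upwards [eventually_ge_atTop 0] with β hβ
      have h1 : g β x ≤ C * Real.exp (β * (energy p x + V - Γ)) := by
        rw [(hg β).symm (hK β) (hg' β)]
        exact ((hg' β).le_pole (hK β) o).trans (hC β _ hβ (hg' β))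
      calc g β x * Real.exp (-β * energy p x)
          ≤ C * Real.exp (β * (energy p x + V - Γ)) * Real.exp (-β * energy p x) := by gcongr
        _ = C * Real.exp (-β * (Γ - V)) := by
            rw [mul_assoc, ← Real.exp_add]; congr 2; ring

end Prefactor

/-! ### Gates and the region before the gate -/

section Gates

variable {Λ : Finset Site} {p : Params} {F : Set (Config Λ)}

lemma commHeightSet_eq (F : Set (Config Λ)) :
    commHeightSet p {emptyBox Λ} F = gammaStar p F := (gammaStar_eq F).symm

lemma isOptimal_of_le {b : Config Λ} (hb : b ∈ F) (w : (moves Λ).Walk (emptyBox Λ) b)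
    (hw : ∀ ξ ∈ w.support, energy p ξ ≤ gammaStar p F) : IsOptimal p {emptyBox Λ} F w := by
  refine ⟨rfl, hb, le_antisymm ?_ (commHeightSet_le p (A := {emptyBox Λ}) rfl hb w)⟩
  rw [commHeightSet_eq]
  exact (height_le_iff p w _).2 hw

lemma IsOptimal.energy_le {a b ξ : Config Λ} {w : (moves Λ).Walk a b}
    (hw : IsOptimal p {emptyBox Λ} F w) (hξ : ξ ∈ w.support) : energy p ξ ≤ gammaStar p F := by
  rw [gammaStar_eq, ← hw.2.2]
  exact energy_le_height p w hξ

lemma IsOptimal.exists_saddle {a b : Config Λ} {w : (moves Λ).Walk a b}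
    (hw : IsOptimal p {emptyBox Λ} F w) : ∃ ξ ∈ w.support, energy p ξ = gammaStar p F := by
  obtain ⟨ξ, hξ, h⟩ := height_mem p w
  exact ⟨ξ, hξ, by rw [h, hw.2.2, gammaStar_eq]⟩

lemma IsOptimal.mem_levelSet {a b ξ : Config Λ} {w : (moves Λ).Walk a b}
    (hw : IsOptimal p {emptyBox Λ} F w) (hξ : ξ ∈ w.support) (h : energy p ξ = gammaStar p F) :
    ξ ∈ levelSet p {emptyBox Λ} F := by
  refine ⟨?_, a, b, w, hw, hξ⟩
  rw [commHeightSet_eq]; exact h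

lemma energy_of_mem_levelSet {ξ : Config Λ} (h : ξ ∈ levelSet p {emptyBox Λ} F) :
    energy p ξ = gammaStar p F := by
  rw [gammaStar_eq]; exact h.1

lemma mem_levelSet_of_mem_gate {ξ : Config Λ} (h : ξ ∈ essentialGate p {emptyBox Λ} F) :
    ξ ∈ levelSet p {emptyBox Λ} F := by
  obtain ⟨W, hW, hξ⟩ := h
  exact hW.1.1 hξ

lemma exists_minimalGate {W : Set (Config Λ)} (hW : IsGate p {emptyBox Λ} F W) :
    ∃ W' ⊆ W, IsMinimalGate p {emptyBox Λ} F W' := by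
  obtain ⟨W', hle, hW'⟩ := (Set.toFinite {W | IsGate p {emptyBox Λ} F W}).exists_le_minimal hW
  refine ⟨W', hle, hW'.prop, fun W'' hlt => ?_⟩
  by_contra! hcon
  exact hlt.not_ge (hW'.le_of_le ⟨hlt.le.trans hW'.prop.1, hcon⟩ hlt.le)

/-- Every optimal path can be replaced by one whose saddles all belong to the essential gate and are
saddles of the given path: a path with a minimal set `S` of saddles has this property, because for
`s ∈ S` the saddles outside `S` together with `s` form a gate, and any minimal gate inside it
contains `s`. -/
lemma IsOptimal.exists_essential {a b : Config Λ} {w : (moves Λ).Walk a b}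
    (hw : IsOptimal p {emptyBox Λ} F w) :
    ∃ (a' b' : Config Λ) (w' : (moves Λ).Walk a' b'), IsOptimal p {emptyBox Λ} F w' ∧
      ∀ ξ ∈ w'.support, energy p ξ = gammaStar p F →
        ξ ∈ w.support ∧ ξ ∈ essentialGate p {emptyBox Λ} F := by
  set sad : Set (Set (Config Λ)) := {S | ∃ (a' b' : Config Λ) (w' : (moves Λ).Walk a' b'),
    IsOptimal p {emptyBox Λ} F w' ∧ S = {ξ | ξ ∈ w'.support ∧ energy p ξ = gammaStar p F}} with hsad
  obtain ⟨S, hle, hS⟩ := (Set.toFinite sad).exists_le_minimal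
    (a := {ξ | ξ ∈ w.support ∧ energy p ξ = gammaStar p F}) ⟨a, b, w, hw, rfl⟩
  obtain ⟨a', b', w', hw', hSw⟩ := hS.prop
  refine ⟨a', b', w', hw', fun s hs hsΓ => ?_⟩
  have hsS : s ∈ S := hSw ▸ ⟨hs, hsΓ⟩
  refine ⟨(hle hsS).1, ?_⟩
  have hgate : IsGate p {emptyBox Λ} F (levelSet p {emptyBox Λ} F \ S ∪ {s}) := by
    refine ⟨?_, fun c d v hv => ?_⟩
    · rintro ξ (h | rfl)
      · exact h.1
      · exact hw'.mem_levelSet hs hsΓ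
    · by_contra! hcon
      have hsub : {ξ | ξ ∈ v.support ∧ energy p ξ = gammaStar p F} ⊆ S \ {s} := by
        rintro ξ ⟨h1, h2⟩
        have h3 := hcon ξ h1
        simp only [Set.mem_union, Set.mem_sdiff, Set.mem_singleton_iff, not_or, not_and,
          not_not] at h3
        exact ⟨h3.1 (hv.mem_levelSet h1 h2), h3.2⟩
      have h4 := hS.le_of_le ⟨c, d, v, hv, rfl⟩ (hsub.trans Set.sdiff_subset)
      exact (hsub (h4 hsS)).2 rfl
  obtain ⟨W, hWsub, hW⟩ := exists_minimalGate hgate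
  obtain ⟨ξ, hξ, hξW⟩ := hW.1.2 a' b' w' hw'
  rcases hWsub hξW with h | h
  · exact absurd (hSw ▸ ⟨hξ, energy_of_mem_levelSet h.1⟩) h.2
  · exact ⟨W, hW, (h : ξ = s) ▸ hξW⟩

lemma IsOptimal.exists_mem_gate {a b : Config Λ} {w : (moves Λ).Walk a b}
    (hw : IsOptimal p {emptyBox Λ} F w) :
    ∃ ξ ∈ w.support, ξ ∈ essentialGate p {emptyBox Λ} F := by
  obtain ⟨a', b', w', hw', h⟩ := hw.exists_essential
  obtain ⟨ξ, hξ, he⟩ := hw'.exists_saddle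
  exact ⟨ξ, h ξ hξ he⟩

/-! ### Counting particles -/

lemma numType_update {η : Config Λ} {x : Λ} (hx : η x = 0) (k : Fin 3) {j : Fin 3} (hj : j ≠ 0) :
    numType (Function.update η x k) j = numType η j + if k = j then 1 else 0 := by
  classical
  unfold numType
  split_ifs with hkj
  · subst hkj
    rw [← Finset.card_insert_of_notMem (a := x) (by simp [hx, hj.symm])]
    congr 1
    ext y
    by_cases hy : y = x
    · simp [hy]
    · simp [hy]
  · rw [add_zero]
    congr 1
    ext y
    by_cases hy : y = x
    · simp [hy, hkj, hx, hj.symm]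
    · simp [hy]

lemma numParticles_update {η : Config Λ} {x : Λ} (hx : η x = 0) {k : Fin 3} (hk : k ≠ 0) :
    numParticles (Function.update η x k) = numParticles η + 1 := by
  classical
  unfold numParticles
  rw [← Finset.card_insert_of_notMem (a := x) (by simp [hx])]
  congr 1
  ext y
  by_cases hy : y = x
  · simp [hy, hk]
  · simp [hy]

lemma ActiveBond.symm {η : Config Λ} {x y : Λ} (h : ActiveBond η x y) : ActiveBond η y x :=
  ⟨h.2.1, h.1, nbr_symm h.2.2.1, by rw [mul_comm]; exact h.2.2.2⟩

lemma ActiveBond.ne_zero {η : Config Λ} {x y : Λ} (h : ActiveBond η x y) : η x ≠ 0 := by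
  intro h0
  have := h.2.2.2
  simp [h0] at this

lemma ActiveBond.ne {η : Config Λ} {x y : Λ} (h : ActiveBond η x y) : x ≠ y :=
  fun he => nbr_ne h.2.2.1 (congrArg _ he)

lemma numBonds_eq_zero {η : Config Λ} (h : ∀ x y, ¬ ActiveBond η x y) : numBonds η = 0 := by
  rw [numBonds]
  convert Set.ncard_empty (Sym2 Λ)
  ext b
  simp [h]

lemma energy_le_types (hp : p.Metastable) (η : Config Λ) :
    energy p η ≤ p.Δ₁ * numType η 1 + p.Δ₂ * numType η 2 := by
  unfold energy
  have : 0 ≤ p.U * numBonds η := mul_nonneg hp.U_pos.le (Nat.cast_nonneg _)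
  linarith

lemma numType_emptyBox {k : Fin 3} (hk : k ≠ 0) : numType (emptyBox Λ) k = 0 := by
  simp [numType, emptyBox, hk.symm]

lemma energy_single (x : Λ) (k : Fin 3) :
    energy p (Function.update (emptyBox Λ) x k) =
      p.Δ₁ * (if k = 1 then 1 else 0) + p.Δ₂ * (if k = 2 then 1 else 0) := by
  have h0 : numBonds (Function.update (emptyBox Λ) x k) = 0 := numBonds_eq_zero fun y z h => by
    have hz : ∀ y, Function.update (emptyBox Λ) x k y ≠ 0 → y = x := fun y hy => by
      by_contra hyx
      exact hy (by rw [Function.update_of_ne hyx]; rfl)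
    exact h.ne ((hz y h.ne_zero).trans (hz z h.symm.ne_zero).symm)
  rw [energy, h0, numType_update rfl k (by decide), numType_update rfl k (by decide),
    numType_emptyBox (by decide), numType_emptyBox (by decide)]
  push_cast
  ring

lemma exists_single_of_adj_emptyBox {η : Config Λ} (h : (moves Λ).Adj (emptyBox Λ) η) :
    ∃ x k, k ≠ 0 ∧ η = Function.update (emptyBox Λ) x k := by
  rw [moves, SimpleGraph.fromRel_adj] at h
  obtain ⟨-, (⟨x, y, -, hx, -⟩ | ⟨x, -, -, k, hk, rfl⟩) | (⟨x, y, -, hx, -, h⟩ |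
    ⟨x, -, -, k, hk, h⟩)⟩ := h
  · exact absurd rfl hx
  · exact ⟨x, k, hk, rfl⟩
  · have := congrFun h y
    simp only [Function.comp_apply, Equiv.swap_apply_right] at this
    exact absurd this.symm hx
  · have := congrFun h x
    rw [Function.update_self] at this
    exact absurd this.symm hk

lemma gammaStar_pos (hp : p.Metastable) (h : H1 p F) : 0 < gammaStar p F := by
  obtain ⟨b, hb, hl⟩ := exists_linkedIn_le h
  rcases Relation.ReflTransGen.cases_head hl with he | ⟨c, ⟨hadj, -, hc⟩, -⟩
  · exact absurd (he ▸ hb) h.empty_notMem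
  · obtain ⟨x, k, hk, rfl⟩ := exists_single_of_adj_emptyBox hadj
    refine lt_of_lt_of_le ?_ hc
    have h2 := hp.Δ₁_pos.trans_le hp.Δ₁_le_Δ₂
    rw [energy_single]
    fin_cases k
    · exact absurd rfl hk
    · simpa using hp.Δ₁_pos
    · simpa using h2

lemma freeAt_of_innerBoundary {ξ : Config Λ} {x : Λ} (hx : (x : Site) ∈ innerBoundary Λ)
    (h0 : ξ x = 0) : FreeAt ξ x := by
  refine ⟨h0, fun y h => ?_⟩
  obtain ⟨-, z, hz, hz'⟩ := hx
  exact hz' (h.1.2 z hz)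

lemma activeBond_addTwo_iff {ξ : Config Λ} {x : Λ} (hx : FreeAt ξ x) (a b : Λ) :
    ActiveBond (addTwo ξ x) a b ↔ ActiveBond ξ a b := by
  by_cases ha : a = x
  · subst ha
    exact ⟨fun h => absurd h (hx.2 b), fun h => absurd hx.1 h.ne_zero⟩
  · by_cases hb : b = x
    · subst hb
      exact ⟨fun h => absurd h.symm (hx.2 a), fun h => absurd hx.1 h.symm.ne_zero⟩
    · simp [ActiveBond, addTwo, ha, hb]

lemma energy_addTwo {ξ : Config Λ} {x : Λ} (hx : FreeAt ξ x) :
    energy p (addTwo ξ x) = energy p ξ + p.Δ₂ := by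
  have h0 : numBonds (addTwo ξ x) = numBonds ξ := by
    simp only [numBonds, activeBond_addTwo_iff hx]
  have h1 : numType (addTwo ξ x) 1 = numType ξ 1 := by
    simpa [addTwo] using numType_update hx.1 2 (j := 1) (by decide)
  have h2 : numType (addTwo ξ x) 2 = numType ξ 2 + 1 := by
    simpa [addTwo] using numType_update hx.1 2 (j := 2) (by decide)
  rw [energy, energy, h0, h1, h2]
  push_cast
  ring

variable (p F) in
/-- The configurations that are reached from the empty box without exceeding the height `Γ⋆` and
without visiting the essential gate. -/
def BeforeGate (ξ : Config Λ) : Prop :=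
  LinkedIn (fun ζ => energy p ζ ≤ gammaStar p F ∧ ζ ∉ essentialGate p {emptyBox Λ} F)
    (emptyBox Λ) ξ

lemma emptyBox_notMem_gate (hp : p.Metastable) (h : H1 p F) :
    emptyBox Λ ∉ essentialGate p {emptyBox Λ} F := fun hG => by
  have := energy_of_mem_levelSet (mem_levelSet_of_mem_gate hG)
  rw [energy_emptyBox] at this
  exact (gammaStar_pos hp h).ne this

lemma BeforeGate.exists_walk (hp : p.Metastable) (h : H1 p F) {ξ : Config Λ}
    (hξ : BeforeGate p F ξ) : ∃ w : (moves Λ).Walk (emptyBox Λ) ξ, ∀ ζ ∈ w.support,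
      energy p ζ ≤ gammaStar p F ∧ ζ ∉ essentialGate p {emptyBox Λ} F :=
  LinkedIn.exists_walk hξ
    ⟨by rw [energy_emptyBox]; exact (gammaStar_pos hp h).le, emptyBox_notMem_gate hp h⟩

lemma BeforeGate.prop (hp : p.Metastable) (h : H1 p F) {ξ : Config Λ} (hξ : BeforeGate p F ξ) :
    energy p ξ ≤ gammaStar p F ∧ ξ ∉ essentialGate p {emptyBox Λ} F := by
  obtain ⟨w, hw⟩ := hξ.exists_walk hp h
  exact hw ξ w.end_mem_support

lemma beforeGate_emptyBox : BeforeGate p F (emptyBox Λ) := Relation.ReflTransGen.refl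

lemma BeforeGate.notMem (hp : p.Metastable) (h : H1 p F) {ξ : Config Λ} (hξ : BeforeGate p F ξ) :
    ξ ∉ F := fun hF => by
  obtain ⟨w, hw⟩ := hξ.exists_walk hp h
  obtain ⟨ζ, hζ, hG⟩ := (isOptimal_of_le hF w fun ζ hζ => (hw ζ hζ).1).exists_mem_gate
  exact (hw ζ hζ).2 hG

/-- A step out of the region before the gate is a first entrance of the essential gate. -/
lemma BeforeGate.entrance (hp : p.Metastable) (h : H1 p F) {ξ η : Config Λ}
    (hξ : BeforeGate p F ξ) (hadj : (moves Λ).Adj ξ η) (he : energy p η ≤ gammaStar p F)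
    (hη : ¬ BeforeGate p F η) : Entrance p F ξ η := by
  have hG : η ∈ essentialGate p {emptyBox Λ} F := by
    by_contra hG
    exact hη (hξ.tail ⟨hadj, hξ.prop hp h, he, hG⟩)
  obtain ⟨w₁, hw₁⟩ := hξ.exists_walk hp h
  obtain ⟨-, a, b, w, hw, hmem⟩ := mem_levelSet_of_mem_gate hG
  classical
  refine ⟨emptyBox Λ, b, w₁.append (SimpleGraph.Walk.cons hadj (w.dropUntil η hmem)), w₁.length,
    isOptimal_of_le hw.2.1 _ fun ζ hζ => ?_, ?_, ?_, ?_, hG, fun j hj => ?_⟩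
  · rw [SimpleGraph.Walk.mem_support_append_iff, SimpleGraph.Walk.support_cons,
      List.mem_cons] at hζ
    rcases hζ with h' | rfl | h'
    · exact (hw₁ ζ h').1
    · exact (hξ.prop hp h).1
    · exact hw.energy_le (w.support_dropUntil_subset_support hmem h')
  · simp
  · simp [SimpleGraph.Walk.getVert_append]
  · simp [SimpleGraph.Walk.getVert_append]
  · have : (w₁.append (SimpleGraph.Walk.cons hadj (w.dropUntil η hmem))).getVert j =
        w₁.getVert j := by
      rw [SimpleGraph.Walk.getVert_append]
      split_ifs with hlt
      · rfl
      · have : j = w₁.length := by omega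
        subst this
        simp
    rw [this]
    exact (hw₁ _ (w₁.getVert_mem_support j)).2

lemma Entrance.beforeGate {ξ η : Config Λ} (he : Entrance p F ξ η) : BeforeGate p F ξ := by
  obtain ⟨a, b, w, k, hw, hk, rfl, -, -, hj⟩ := he
  obtain rfl : a = emptyBox Λ := hw.1
  have key : ∀ j ≤ k, BeforeGate p F (w.getVert j) := by
    intro j
    induction j with
    | zero => intro _; rw [SimpleGraph.Walk.getVert_zero]; exact beforeGate_emptyBox
    | succ j ih =>
      intro hjk
      exact (ih (by omega)).tail ⟨w.adj_getVert_succ (by omega),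
        ⟨hw.energy_le (w.getVert_mem_support _), hj j (by omega)⟩,
        hw.energy_le (w.getVert_mem_support _), hj (j + 1) hjk⟩
  exact key k le_rfl

lemma Entrance.energy_eq {ξ η : Config Λ} (he : Entrance p F ξ η) :
    energy p η = gammaStar p F := by
  obtain ⟨a, b, w, k, -, -, -, -, hG, -⟩ := he
  exact energy_of_mem_levelSet (mem_levelSet_of_mem_gate hG)

lemma BeforeGate.of_lt (hp : p.Metastable) (h : H1 p F) {ξ η : Config Λ}
    (hξ : BeforeGate p F ξ) (hadj : (moves Λ).Adj ξ η) (he : energy p η < gammaStar p F) :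
    BeforeGate p F η := by
  by_contra hη
  exact he.ne (hξ.entrance hp h hadj he.le hη).energy_eq

lemma BeforeGate.of_linkedIn (hp : p.Metastable) (h : H1 p F) {ξ η : Config Λ}
    (hξ : BeforeGate p F ξ) (hl : LinkedIn (fun ζ => energy p ζ < gammaStar p F) ξ η) :
    BeforeGate p F η := by
  induction hl with
  | refl => exact hξ
  | tail _ hs ih => exact ih.of_lt hp h hs.1 hs.2.2

/-- As the gate is entered by the creation of a particle of type `2`, steps that do not increase the
number of these particles do not leave the region before the gate. -/
lemma BeforeGate.of_numType_le {L : ℕ} (hp : p.Metastable) (h : H1 p F) (h3 : H3 p F L)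
    {ξ η : Config Λ} (hξ : BeforeGate p F ξ) (hadj : (moves Λ).Adj ξ η)
    (he : energy p η ≤ gammaStar p F) (hn : numType η 2 ≤ numType ξ 2) : BeforeGate p F η := by
  by_contra hη
  obtain ⟨x, -, hx, rfl⟩ := h3.enter _ _ (hξ.entrance hp h hadj he hη)
  have : numType (addTwo ξ x) 2 = numType ξ 2 + 1 := by
    simpa [addTwo] using numType_update hx 2 (j := 2) (by decide)
  omega

end Gates

/-! ### Protocritical droplets -/

section Droplets

variable {Λ : Finset Site} {p : Params} {F : Set (Config Λ)} {L : ℕ}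

lemma exists_linkedIn_of_commHeightSet_lt {ζ : Config Λ} {m : ℝ} (hF : F.Nonempty)
    (hζ : commHeightSet p {ζ} F < m) :
    energy p ζ < m ∧ ∃ b ∈ F, LinkedIn (fun ξ => energy p ξ < m) ζ b := by
  obtain ⟨a, b, w, ha, hb, hw⟩ := exists_isOptimal p (A := {ζ}) ⟨_, rfl⟩ hF
  obtain rfl : a = ζ := ha
  have hlt : ∀ ξ ∈ w.support, energy p ξ < m := fun ξ hξ =>
    (energy_le_height p w hξ).trans_lt (hw ▸ hζ)
  exact ⟨hlt _ w.start_mem_support, b, hb, linkedIn_of_walk w hlt⟩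

lemma notMem_innerBoundary {x : Site} (hx : x ∈ innerSites Λ) : x ∉ innerBoundary Λ :=
  fun ⟨_, y, hy, hy'⟩ => hy' (hx.2 y hy)

lemma beforeGate_of_mem_proto {ξ : Config Λ} (hξ : ξ ∈ proto p F) : BeforeGate p F ξ := by
  obtain ⟨η, hη⟩ := hξ
  exact hη.beforeGate

lemma H3.notMem_innerBoundary (h3 : H3 p F L) {ξ : Config Λ} (hξ : ξ ∈ proto p F) {x : Λ}
    (hx : ξ x ≠ 0) : (x : Site) ∉ innerBoundary Λ :=
  Kawasaki.notMem_innerBoundary ((h3.single ξ hξ).2.1 x hx)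

lemma H3.energy_proto (h3 : H3 p F L) {ξ : Config Λ} (hξ : ξ ∈ proto p F) :
    energy p ξ + p.Δ₂ = gammaStar p F := by
  obtain ⟨η, hη⟩ := hξ
  obtain ⟨x, hx, h0, rfl⟩ := h3.enter ξ η hη
  rw [← energy_addTwo (freeAt_of_innerBoundary hx h0), hη.energy_eq]

lemma H3.energy_critical (h3 : H3 p F L) {ξ : Config Λ} (hξ : ξ ∈ proto p F) {x : Λ}
    (hx : FreeAt ξ x) : energy p (addTwo ξ x) = gammaStar p F := by
  rw [energy_addTwo hx, h3.energy_proto hξ]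

lemma addTwo_self (ξ : Config Λ) (x : Λ) : addTwo ξ x x = 2 := Function.update_self ..

lemma addTwo_of_ne (ξ : Config Λ) {x y : Λ} (h : y ≠ x) : addTwo ξ x y = ξ y :=
  Function.update_of_ne h ..

/-- A type `2` particle bonded to a configuration is bonded to a type `1` particle. -/
lemma eq_one_of_activeBond {ξ : Config Λ} {z y : Λ} (h : ActiveBond (addTwo ξ z) z y) :
    ξ y = 1 ∧ nbr z y := by
  have h1 := h.2.2.2
  rw [addTwo_self, addTwo_of_ne _ h.ne.symm] at h1
  refine ⟨?_, h.2.2.1⟩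
  generalize ξ y = k at h1
  fin_cases k <;> simp_all

/-- A protocritical droplet consists of at least two particles. If it were a single particle, then by
attachment it would be of type `1`, and the attached pair could also be assembled by first bringing
in the type `2` particle, so without entering the gate by the creation of a type `2` particle. -/
lemma H3.exists_ne (hp : p.Metastable) (h : H1 p F) (h3 : H3 p F L) {ξ : Config Λ}
    (hξ : ξ ∈ proto p F) (y : Λ) : ∃ y', y' ≠ y ∧ ξ y' ≠ 0 := by
  by_contra! hcon
  obtain ⟨ζ, ⟨x, z, -, -, hz, ⟨y₁, hb⟩, rfl⟩, hζ⟩ := h3.good ξ hξ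
  obtain ⟨hy₁, hnbr⟩ := eq_one_of_activeBond hb
  obtain rfl : y₁ = y := by
    by_contra hne
    rw [hcon y₁ hne] at hy₁
    exact absurd hy₁ (by decide)
  have hξeq : ξ = Function.update (emptyBox Λ) y₁ 1 := by
    funext x
    by_cases hx : x = y₁
    · subst hx; rw [hy₁, Function.update_self]
    · rw [hcon x hx, Function.update_of_ne hx]; rfl
  have hzy : z ≠ y₁ := hb.ne
  have hΓ : p.Δ₁ + p.Δ₂ = gammaStar p F := by
    rw [← h3.energy_proto hξ, hξeq, energy_single]
    simp
  have hΔ₁ := hp.Δ₁_pos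
  have hΔ₂ : p.Δ₂ < gammaStar p F := by linarith
  -- the single particle of type `2` lies before the gate, wherever it is
  have h2 : ∀ w : Λ, BeforeGate p F (Function.update (emptyBox Λ) w 2) := by
    intro w
    have he : ∀ v : Λ, energy p (Function.update (emptyBox Λ) v 2) < gammaStar p F := fun v => by
      rw [energy_single]; simpa using hΔ₂
    exact ray_induction (w := w) (d := (1, 0)) (by simp [nbr]) (S := fun _ => True)
      (fun _ _ _ => trivial)
      (fun v hv _ => beforeGate_emptyBox.of_lt hp h (adj_create hv rfl (by decide)) (he v))
      (fun u v huv _ _ hv => hv.of_lt hp h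
        (adj_hop (nbr_symm huv) rfl rfl (by decide)) (he u))
  -- the particle of type `1` now enters along the ray that leads from `z` to `y₁` and beyond
  set η := Function.update (emptyBox Λ) z 2 with hη
  have hηz : η z = 2 := Function.update_self ..
  have hη0 : ∀ v, v ≠ z → η v = 0 := fun v hv => by rw [hη, Function.update_of_ne hv]; rfl
  have hη1 : numType η 1 = 0 := by
    rw [hη, numType_update rfl 2 (by decide), numType_emptyBox (by decide)]; simp
  have hη2 : numType η 2 = 1 := by
    rw [hη, numType_update rfl 2 (by decide), numType_emptyBox (by decide)]; simp
  have hn2 : ∀ v, η v = 0 → numType (Function.update η v 1) 2 = 1 := fun v hv => by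
    rw [numType_update hv 1 (by decide), hη2]; simp
  have he : ∀ v, η v = 0 → energy p (Function.update η v 1) ≤ gammaStar p F := fun v hv => by
    refine (energy_le_types hp _).trans ?_
    rw [hn2 v hv, numType_update hv 1 (by decide), hη1, ← hΓ]
    simp
  have hkey : BeforeGate p F (Function.update η y₁ 1) := by
    refine ray_induction (w := y₁) (d := (y₁ : Site) - z) ?_ (S := fun v => η v = 0)
      (P := fun v => BeforeGate p F (Function.update η v 1)) ?_ ?_ ?_
    · unfold nbr at hnbr ⊢
      simp only [Prod.fst_zero, Prod.snd_zero, Prod.fst_sub, Prod.snd_sub, zero_sub, abs_neg]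
      rw [abs_sub_comm, abs_sub_comm (y₁ : Site).2]
      exact hnbr
    · intro j v hv
      refine hη0 v fun hvz => ?_
      rw [hvz] at hv
      have h5 : ((j + 1 : ℕ) : ℤ) • ((y₁ : Site) - z) = 0 := by
        rw [natCast_zsmul, succ_nsmul]
        calc j • ((y₁ : Site) - z) + ((y₁ : Site) - z) =
          ((y₁ : Site) + j • ((y₁ : Site) - z)) - z := by abel
          _ = 0 := by rw [← hv, sub_self]
      rcases smul_eq_zero.1 h5 with h6 | h6
      · omega
      · exact hzy (Subtype.ext (sub_eq_zero.1 h6).symm)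
    · intro v hv hv0
      refine (h2 z).of_numType_le hp h h3 (adj_create hv hv0 (by decide)) (he v hv0) ?_
      rw [hn2 v hv0, ← hη, hη2]
    · intro u v huv hu0 hv0 hv
      refine hv.of_numType_le hp h h3 (adj_hop (nbr_symm huv) hv0 hu0 (by decide)) (he u hu0) ?_
      rw [hn2 u hu0, hn2 v hv0]
  have hζeq : addTwo ξ z = Function.update η y₁ 1 := by
    rw [hξeq, hη, addTwo, Function.update_comm hzy]
  obtain ⟨-, b, hbF, hl⟩ := exists_linkedIn_of_commHeightSet_lt h.nonempty hζ
  rw [hζeq] at hl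
  exact (hkey.of_linkedIn hp h hl).notMem hp h hbF

lemma exists_exit_edge {a b : Config Λ} (w : (moves Λ).Walk a b) {Q : Config Λ → Prop} (ha : Q a)
    (hb : ¬ Q b) : ∃ c d, (moves Λ).Adj c d ∧ c ∈ w.support ∧ d ∈ w.support ∧ Q c ∧ ¬ Q d := by
  induction w with
  | nil => exact absurd ha hb
  | @cons a v b hadj w ih =>
    by_cases hv : Q v
    · obtain ⟨c, d, h1, h2, h3, h4⟩ := ih hv hb
      exact ⟨c, d, h1, by simp [h2], by simp [h3], h4⟩
    · exact ⟨a, v, hadj, by simp, by simp, ha, hv⟩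

/-- Protocritical droplets belong to the well of the empty box. -/
lemma H3.linkedIn_proto (hp : p.Metastable) (h : H1 p F) (h3 : H3 p F L) {ξ : Config Λ}
    (hξ : ξ ∈ proto p F) :
    LinkedIn (fun ζ => energy p ζ < gammaStar p F) (emptyBox Λ) ξ := by
  set Γ := gammaStar p F with hΓ
  set S : Config Λ → Prop := fun ζ => energy p ζ ≤ Γ ∧
    (ζ ∈ essentialGate p {emptyBox Λ} F → ∃ x, ξ x = 0 ∧ ζ = addTwo ξ x) with hS
  have hSfree : ∀ x, FreeAt ξ x → S (addTwo ξ x) := fun x hx =>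
    ⟨(h3.energy_critical hξ hx).le, fun _ => ⟨x, hx.1, rfl⟩⟩
  have hSlt : ∀ ζ, energy p ζ < Γ → S ζ := fun ζ hζ =>
    ⟨hζ.le, fun hG => absurd (energy_of_mem_levelSet (mem_levelSet_of_mem_gate hG)) hζ.ne⟩
  have hSξ : S ξ := hSlt ξ (by
    have := h3.energy_proto hξ
    have := hp.Δ₁_pos.trans_le hp.Δ₁_le_Δ₂
    linarith)
  obtain ⟨ζ, ⟨x, z, ⟨y, hy, hyf, hyx⟩, hxz, hz, -, rfl⟩, hζ⟩ := h3.good ξ hξ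
  obtain ⟨hζlt, b, hb, hl⟩ := exists_linkedIn_of_commHeightSet_lt h.nonempty hζ
  have l1 : LinkedIn S (emptyBox Λ) ξ :=
    LinkedIn.mono (fun ζ hζ => ⟨hζ.1, fun hG => absurd hG hζ.2⟩) (beforeGate_of_mem_proto hξ)
  have l2 : LinkedIn S ξ (addTwo ξ y) :=
    Relation.ReflTransGen.single ⟨adj_create hy hyf.1 (by decide), hSξ, hSfree y hyf⟩
  have l3 : FreeAt ξ x ∧ LinkedIn S (addTwo ξ y) (addTwo ξ x) := by
    clear hxz
    induction hyx with
    | refl => exact ⟨hyf, Relation.ReflTransGen.refl⟩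
    | tail _ hs ih =>
      exact ⟨hs.2, ih.2.tail ⟨adj_hop hs.1 ih.1.1 hs.2.1 (by decide), hSfree _ ih.1,
        hSfree _ hs.2⟩⟩
  have l4 : LinkedIn S (addTwo ξ x) (addTwo ξ z) :=
    Relation.ReflTransGen.single ⟨adj_hop hxz l3.1.1 hz (by decide), hSfree x l3.1, hSlt _ hζlt⟩
  have l5 : LinkedIn S (emptyBox Λ) b :=
    (((l1.trans l2).trans l3.2).trans l4).trans (hl.mono hSlt)
  obtain ⟨w, hw⟩ := l5.exists_walk (hSlt _ (by rw [energy_emptyBox]; exact gammaStar_pos hp h))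
  obtain ⟨a', b', w', hw', hsad⟩ :=
    (isOptimal_of_le hb w fun ζ hζ => (hw ζ hζ).1).exists_essential
  obtain rfl : a' = emptyBox Λ := hw'.1
  obtain ⟨c, d, hcd, hc, hd, hQc, hQd⟩ := exists_exit_edge w'
    (Q := fun ζ => energy p ζ < Γ ∧ LinkedIn (fun ζ => energy p ζ < Γ) (emptyBox Λ) ζ)
    ⟨by rw [energy_emptyBox]; exact gammaStar_pos hp h, Relation.ReflTransGen.refl⟩
    (fun hQ => not_linkedIn_lt h hw'.2.1 hQ.2)
  have hdΓ : energy p d = Γ := by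
    refine le_antisymm (hw'.energy_le hd) (not_lt.1 fun hlt => hQd ⟨hlt, hQc.2.tail ⟨hcd, hQc.1, hlt⟩⟩)
  obtain ⟨hdw, hdG⟩ := hsad d hd hdΓ
  obtain ⟨u, hu, hdu⟩ := (hw d hdw).2 hdG
  have hcB : BeforeGate p F c := beforeGate_emptyBox.of_linkedIn hp h hQc.2
  obtain ⟨v, hv, hcv, hdv⟩ := h3.enter c d
    (hcB.entrance hp h hcd hdΓ.le fun hB => (hB.prop hp h).2 hdG)
  have heq : addTwo ξ u = addTwo c v := hdu ▸ hdv
  have huv : v = u := by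
    by_contra hne
    have h6 := congrFun heq v
    rw [addTwo_self, addTwo_of_ne _ hne] at h6
    exact h3.notMem_innerBoundary hξ (h6 ▸ by decide) hv
  subst huv
  have : ξ = c := by
    funext t
    by_cases ht : t = v
    · rw [ht, hu, hcv]
    · have h6 := congrFun heq t
      rwa [addTwo_of_ne _ ht, addTwo_of_ne _ ht] at h6
  exact this ▸ hQc.2

lemma bondGraph_reachable {ξ : Config Λ} (hξ : numDroplets ξ = 1) (x y : {x : Λ // ξ x ≠ 0}) :
    (bondGraph ξ).Reachable x y := by
  have := (Nat.card_eq_one_iff_unique.1 hξ).1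
  exact SimpleGraph.ConnectedComponent.exact (Subsingleton.elim _ _)

lemma bondGraph_adj {ξ : Config Λ} {x y : {x : Λ // ξ x ≠ 0}} :
    (bondGraph ξ).Adj x y ↔ ActiveBond ξ x y := by
  rw [bondGraph, SimpleGraph.fromRel_adj]
  exact ⟨fun h => h.2.elim id fun h => h.symm, fun h => ⟨fun he => h.ne (congrArg _ he), Or.inl h⟩⟩

/-- No particle of a protocritical droplet is free. -/
lemma H3.exists_activeBond (hp : p.Metastable) (h : H1 p F) (h3 : H3 p F L) {ξ : Config Λ}
    (hξ : ξ ∈ proto p F) {x : Λ} (hx : ξ x ≠ 0) : ∃ y, ActiveBond ξ x y := by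
  obtain ⟨y, hyx, hy⟩ := h3.exists_ne hp h hξ x
  obtain ⟨w⟩ := bondGraph_reachable (h3.single ξ hξ).1 ⟨x, hx⟩ ⟨y, hy⟩
  cases w with
  | nil => exact absurd rfl hyx
  | cons hadj _ => exact ⟨_, bondGraph_adj.1 hadj⟩

/-- A critical droplet determines its protocritical droplet and its free particle. -/
lemma H3.addTwo_injective (hp : p.Metastable) (h : H1 p F) (h3 : H3 p F L) {ξ ξ' : Config Λ}
    (hξ : ξ ∈ proto p F) {x x' : Λ} (hx : FreeAt ξ x)
    (hx' : FreeAt ξ' x') (heq : addTwo ξ x = addTwo ξ' x') : ξ = ξ' ∧ x = x' := by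
  have hxx : x' = x := by
    by_contra hne
    have h1 : ξ x' ≠ 0 := by
      rw [← addTwo_of_ne ξ hne, heq, addTwo_self]; decide
    obtain ⟨y, hy⟩ := h3.exists_activeBond hp h hξ h1
    exact hx'.2 y (heq ▸ (activeBond_addTwo_iff hx x' y).2 hy)
  subst hxx
  refine ⟨funext fun t => ?_, rfl⟩
  by_cases ht : t = x'
  · rw [ht, hx.1, hx'.1]
  · have h6 := congrFun heq t
    rwa [addTwo_of_ne _ ht, addTwo_of_ne _ ht] at h6

lemma nbr_parity {x y : Site} (h : nbr x y) : (x.1 + x.2 + y.1 + y.2) % 2 = 1 := by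
  unfold nbr at h
  rcases abs_cases (x.1 - y.1) with ⟨h1, -⟩ | ⟨h1, -⟩ <;>
    rcases abs_cases (x.2 - y.2) with ⟨h2, -⟩ | ⟨h2, -⟩ <;> omega

/-- In a single droplet the type of a particle is determined by the parity of its site. -/
lemma parity_eq {ξ : Config Λ} (hξ : numDroplets ξ = 1) {x y : Λ} (hx : ξ x ≠ 0) (hy : ξ y ≠ 0) :
    (((ξ x : ℕ) : ℤ) + (x : Site).1 + (x : Site).2) % 2 =
      (((ξ y : ℕ) : ℤ) + (y : Site).1 + (y : Site).2) % 2 := by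
  obtain ⟨w⟩ := bondGraph_reachable hξ ⟨x, hx⟩ ⟨y, hy⟩
  suffices ∀ (a b : {x : Λ // ξ x ≠ 0}) (w : (bondGraph ξ).Walk a b),
      (((ξ a : ℕ) : ℤ) + (a : Site).1 + (a : Site).2) % 2 =
      (((ξ b : ℕ) : ℤ) + (b : Site).1 + (b : Site).2) % 2 from this _ _ w
  intro a b w
  induction w with
  | nil => rfl
  | @cons a c b hadj w ih =>
    rw [← ih]
    have h1 := bondGraph_adj.1 hadj
    have h2 := nbr_parity h1.2.2.1
    have h3 : ((ξ a : ℕ) + (ξ c : ℕ)) % 2 = 1 := by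
      have h4 := h1.2.2.2
      generalize ξ a = i at h4 ⊢
      generalize ξ c = j at h4 ⊢
      fin_cases i <;> fin_cases j <;> simp_all
    omega

lemma numDroplets_addTwo_le {ξ : Config Λ} (hξ : numDroplets ξ = 1) {x : Λ} (hx : FreeAt ξ x)
    {y : Λ} (hy : ξ y ≠ 0) : numDroplets (addTwo ξ x) ≤ 2 := by
  have hxne : ∀ v, ξ v ≠ 0 → v ≠ x := fun v hv he => hv (he ▸ hx.1)
  have hne : ∀ v, ξ v ≠ 0 → addTwo ξ x v ≠ 0 := fun v hv => by
    rwa [addTwo_of_ne _ (hxne v hv)]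
  have hx2 : addTwo ξ x x ≠ 0 := by rw [addTwo_self]; decide
  let f : bondGraph ξ →g bondGraph (addTwo ξ x) :=
    { toFun := fun v => ⟨v, hne v v.2⟩
      map_rel' := fun {a b} hab => bondGraph_adj.2
        ((activeBond_addTwo_iff hx a b).2 (bondGraph_adj.1 hab)) }
  let c : Fin 2 → (bondGraph (addTwo ξ x)).ConnectedComponent :=
    ![(bondGraph (addTwo ξ x)).connectedComponentMk ⟨x, hx2⟩,
      (bondGraph (addTwo ξ x)).connectedComponentMk ⟨y, hne y hy⟩]
  have hc : Function.Surjective c := by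
    intro C
    induction C using SimpleGraph.ConnectedComponent.ind with
    | _ v =>
      obtain ⟨v, hv⟩ := v
      by_cases hvx : v = x
      · subst hvx; exact ⟨0, rfl⟩
      · have hv' : ξ v ≠ 0 := by rwa [addTwo_of_ne _ hvx] at hv
        refine ⟨1, SimpleGraph.ConnectedComponent.sound ?_⟩
        exact (bondGraph_reachable hξ ⟨y, hy⟩ ⟨v, hv'⟩).map f
  simpa [numDroplets] using Nat.card_le_card_of_surjective c hc

/-- If a particle of a protocritical droplet hops, it is disconnected from the rest of the droplet,
by parity. So, with a free particle that is not close to the droplet, the number of droplets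
increases. -/
lemma H3.numDroplets_hop (hp : p.Metastable) (h : H1 p F) (h3 : H3 p F L) {ξ : Config Λ}
    (hξ : ξ ∈ proto p F) {x u u' : Λ} (hx : FreeAt ξ x) (huu : nbr u u') (hu : ξ u ≠ 0)
    (hu' : addTwo ξ x u' = 0) (hxu : ¬ nbr x u') :
    numDroplets (addTwo ξ x) < numDroplets (addTwo ξ x ∘ Equiv.swap u u') := by
  classical
  have hsing := (h3.single ξ hξ).1
  refine (numDroplets_addTwo_le hsing hx hu).trans_lt ?_
  set ζ := addTwo ξ x ∘ Equiv.swap u u' with hζ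
  have hu'x : u' ≠ x := by
    rintro rfl
    rw [addTwo_self] at hu'
    exact absurd hu' (by decide)
  have hux : u ≠ x := fun he => hu (he ▸ hx.1)
  have hξu' : ξ u' = 0 := by rwa [addTwo_of_ne _ hu'x] at hu'
  have hζx : ζ x = 2 := by
    rw [hζ, Function.comp_apply, Equiv.swap_apply_of_ne_of_ne hux.symm hu'x.symm, addTwo_self]
  have hζu' : ζ u' = ξ u := by
    rw [hζ, Function.comp_apply, Equiv.swap_apply_right, addTwo_of_ne _ hux]
  have hζu : ζ u = 0 := by rw [hζ, Function.comp_apply, Equiv.swap_apply_left, hu']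
  have hζv : ∀ v, v ≠ u → v ≠ u' → v ≠ x → ζ v = ξ v := fun v h1 h2 h3 => by
    rw [hζ, Function.comp_apply, Equiv.swap_apply_of_ne_of_ne h1 h2, addTwo_of_ne _ h3]
  -- the free particle stays free
  have hfree : ∀ v, ¬ ActiveBond ζ x v := by
    intro v hv
    by_cases hvu : v = u'
    · exact hxu (hvu ▸ hv.2.2.1)
    · have hvu2 : v ≠ u := fun he => hv.symm.ne_zero (he ▸ hζu)
      refine hx.2 v ⟨hv.1, hv.2.1, hv.2.2.1, ?_⟩
      have := hv.2.2.2
      rwa [hζx, hζv v hvu2 hvu hv.ne.symm, ← addTwo_of_ne ξ hv.ne.symm, ← addTwo_self ξ x] at this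
  -- the hopping particle has become free
  have hhop : ∀ v, ¬ ActiveBond ζ u' v := by
    intro v hv
    have hvx : v ≠ x := by rintro rfl; exact hfree _ hv.symm
    have hvu : v ≠ u := fun he => hv.symm.ne_zero (he ▸ hζu)
    have hvu' : v ≠ u' := hv.ne.symm
    have h1 := hv.2.2.2
    rw [hζu', hζv v hvu hvu' hvx] at h1
    have h2 : ξ v ≠ 0 := by
      intro h0
      simp [h0] at h1
    have h4 := parity_eq hsing hu h2
    have h5 := nbr_parity huu
    have h6 := nbr_parity hv.2.2.1
    have h7 : ((ξ u : ℕ) + (ξ v : ℕ)) % 2 = 1 := by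
      generalize ξ u = i at h1 ⊢
      generalize ξ v = j at h1 ⊢
      fin_cases i <;> fin_cases j <;> simp_all
    omega
  obtain ⟨y, hyu, hy⟩ := h3.exists_ne hp h hξ u
  have hyx : y ≠ x := fun he => hy (he ▸ hx.1)
  have hyu' : y ≠ u' := fun he => hy (he ▸ hξu')
  have hζy : ζ y ≠ 0 := by rwa [hζv y hyu hyu' hyx]
  let col : {v : Λ // ζ v ≠ 0} → Fin 3 := fun v => if v.1 = x then 0 else if v.1 = u' then 1 else 2
  have hcol : ∀ v w (q : (bondGraph ζ).Walk v w), col v = col w := by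
    intro v w q
    induction q with
    | nil => rfl
    | @cons a b c hab _ ih =>
      rw [← ih]
      have hab' := bondGraph_adj.1 hab
      have ha1 : a.1 ≠ x := fun he => hfree b (he ▸ hab')
      have ha2 : a.1 ≠ u' := fun he => hhop b (he ▸ hab')
      have hb1 : b.1 ≠ x := fun he => hfree a (he ▸ hab'.symm)
      have hb2 : b.1 ≠ u' := fun he => hhop a (he ▸ hab'.symm)
      simp [col, ha1, ha2, hb1, hb2]
  let f : (bondGraph ζ).ConnectedComponent → Fin 3 :=
    SimpleGraph.ConnectedComponent.lift col fun v w q _ => hcol v w q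
  have hf : Function.Surjective f := by
    intro i
    fin_cases i
    · exact ⟨(bondGraph ζ).connectedComponentMk ⟨x, by rw [hζx]; decide⟩, by simp [f, col]⟩
    · exact ⟨(bondGraph ζ).connectedComponentMk ⟨u', by rwa [hζu']⟩, by simp [f, col, hu'x]⟩
    · exact ⟨(bondGraph ζ).connectedComponentMk ⟨y, hζy⟩, by simp [f, col, hyx, hyu']⟩
  have := Nat.card_le_card_of_surjective f hf
  rw [Nat.card_eq_fintype_card, Fintype.card_fin] at this
  exact this

end Droplets

/-! ### Reduction to the random walk of the free particle -/

section Reduction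

variable {Λ : Finset Site}

/-- The configuration `ξ` with an additional particle of type `2` at a site of `Λ`, or outside `Λ`
(represented by `none`). -/
def insertTwo (ξ : Config Λ) : Option Λ → Config Λ
  | none => ξ
  | some x => addTwo ξ x

open scoped Classical in
/-- The network of a particle that moves in `Λ` and enters and leaves through `∂⁻Λ`; the vertex `none`
stands for the outside. -/
def walkCond (Λ : Finset Site) : Option Λ → Option Λ → ℝ
  | none, none => 0
  | none, some y => if (y : Site) ∈ innerBoundary Λ then 1 else 0
  | some x, none => if (x : Site) ∈ innerBoundary Λ then 1 else 0
  | some x, some y => if nbr (x : Site) y then 1 else 0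

open scoped Classical in
lemma walkCond_comm (o o' : Option Λ) : walkCond Λ o o' = walkCond Λ o' o := by
  rcases o with _ | x <;> rcases o' with _ | y
  · rfl
  · rfl
  · rfl
  · simp only [walkCond]
    exact if_congr ⟨nbr_symm, nbr_symm⟩ rfl rfl

lemma walkCond_eq (o o' : Option Λ) : walkCond Λ o o' = 0 ∨ walkCond Λ o o' = 1 := by
  rcases o with _ | x <;> rcases o' with _ | y <;> simp only [walkCond] <;> try split_ifs
  all_goals simp

lemma walkCond_nonneg (o o' : Option Λ) : 0 ≤ walkCond Λ o o' := by
  rcases walkCond_eq o o' with h | h <;> simp [h]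

/-- The additional particle is in `Λ` and is free. -/
def IsFree (ξ : Config Λ) : Option Λ → Prop
  | none => False
  | some x => FreeAt ξ x

/-- The additional particle can be inserted without exceeding the energy `Γ`. -/
def IsOpenSite (p : Params) (Γ : ℝ) (ξ : Config Λ) : Option Λ → Prop
  | none => True
  | some x => ξ x = 0 ∧ energy p (addTwo ξ x) ≤ Γ

open scoped Classical in
/-- The part of the network of a single particle that is available in the presence of `ξ` below the
energy `Γ`. -/
def freeCond (p : Params) (Γ : ℝ) (ξ : Config Λ) (o o' : Option Λ) : ℝ :=
  if (IsFree ξ o ∧ IsOpenSite p Γ ξ o') ∨ (IsOpenSite p Γ ξ o ∧ IsFree ξ o')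
  then walkCond Λ o o' else 0

/-- `x` is within distance two of a particle of `ξ`. -/
def Near (ξ : Config Λ) (x : Λ) : Prop :=
  ∃ y : Λ, ξ y ≠ 0 ∧ |(x : Site).1 - (y : Site).1| ≤ 2 ∧ |(x : Site).2 - (y : Site).2| ≤ 2

variable {p : Params} {F : Set (Config Λ)} {L : ℕ}

open scoped Classical in
lemma freeCond_comm (Γ : ℝ) (ξ : Config Λ) (o o' : Option Λ) :
    freeCond p Γ ξ o o' = freeCond p Γ ξ o' o := by
  unfold freeCond
  rw [walkCond_comm o o']
  exact if_congr (by tauto) rfl rfl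

lemma freeCond_nonneg (Γ : ℝ) (ξ : Config Λ) (o o' : Option Λ) : 0 ≤ freeCond p Γ ξ o o' := by
  unfold freeCond
  split_ifs
  · exact walkCond_nonneg o o'
  · exact le_rfl

variable (p F) in
/-- The finite set of protocritical droplets. -/
def protoFinset : Finset (Config Λ) := (Set.toFinite (proto p F)).toFinset

lemma mem_protoFinset {ξ : Config Λ} : ξ ∈ protoFinset p F ↔ ξ ∈ proto p F :=
  Set.Finite.mem_toFinset _

lemma near_of_nbr_nbr {ξ : Config Λ} {x u v : Λ} (h1 : nbr (x : Site) u) (h2 : nbr (u : Site) v)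
    (hv : ξ v ≠ 0) : Near ξ x := by
  refine ⟨v, hv, ?_⟩
  unfold nbr at h1 h2
  have a1 := abs_nonneg ((x : Site).1 - (u : Site).1)
  have a2 := abs_nonneg ((x : Site).2 - (u : Site).2)
  have b1 := abs_nonneg ((u : Site).1 - (v : Site).1)
  have b2 := abs_nonneg ((u : Site).2 - (v : Site).2)
  have c1 := abs_sub_le (x : Site).1 (u : Site).1 (v : Site).1
  have c2 := abs_sub_le (x : Site).2 (u : Site).2 (v : Site).2
  constructor <;> omega

/-- A hop, in either direction. -/
lemma adj_cases {a b : Config Λ} (h : (moves Λ).Adj a b) :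
    (∃ u u' : Λ, nbr (u : Site) u' ∧ a u ≠ 0 ∧ a u' = 0 ∧ b = a ∘ Equiv.swap u u') ∨
    (∃ v : Λ, a v = 0 ∧ ∃ k : Fin 3, k ≠ 0 ∧ b = Function.update a v k) ∨
    (∃ v : Λ, (v : Site) ∈ innerBoundary Λ ∧ a v ≠ 0 ∧ b = Function.update a v 0) := by
  rw [moves, SimpleGraph.fromRel_adj] at h
  obtain ⟨-, (⟨u, u', h1, h2, h3, h4⟩ | ⟨v, h1, h2, k, hk, h3⟩) | (⟨u, u', h1, h2, h3, h4⟩ |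
    ⟨v, h1, h2, k, hk, h3⟩)⟩ := h
  · exact Or.inl ⟨u, u', h1, h2, h3, h4⟩
  · exact Or.inr (Or.inl ⟨v, h2, k, hk, h3⟩)
  · refine Or.inl ⟨u', u, nbr_symm h1, ?_, ?_, ?_⟩
    · rw [h4, Function.comp_apply, Equiv.swap_apply_right]; exact h2
    · rw [h4, Function.comp_apply, Equiv.swap_apply_left]; exact h3
    · rw [h4, Equiv.swap_comm u' u]
      funext t
      simp
  · refine Or.inr (Or.inr ⟨v, h1, ?_, ?_⟩)
    · rw [h3, Function.update_self]; exact hk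
    · rw [h3, Function.update_idem, ← h2, Function.update_eq_self]

/-- From a critical droplet with a free particle far from the droplet, all moves below the height
`Γ⋆` are moves of the free particle, which remains free or leaves the box. -/
lemma H3.critical_move (hp : p.Metastable) (h : H1 p F) (h3 : H3 p F L) {ξ : Config Λ}
    (hξ : ξ ∈ proto p F) {x : Λ} (hx : FreeAt ξ x) (hnear : ¬ Near ξ x) {b : Config Λ}
    (hadj : (moves Λ).Adj (addTwo ξ x) b) (hb : energy p b ≤ gammaStar p F) :
    b = ξ ∨ ∃ x' : Λ, b = addTwo ξ x' ∧ FreeAt ξ x' ∧ nbr (x : Site) x' := by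
  have habove := h3.above ξ hξ _ ⟨x, hx, rfl⟩ b hadj
  have hcr : addTwo ξ x x ≠ 0 := by rw [addTwo_self]; decide
  rcases adj_cases hadj with ⟨u, u', huu, hu, hu', rfl⟩ | ⟨v, hv, k, hk, rfl⟩ | ⟨v, hv, hv0, rfl⟩
  · by_cases hux : u = x
    · subst hux
      have hne : u' ≠ u := fun he => hcr (he ▸ hu')
      have hξu' : ξ u' = 0 := by rwa [addTwo_of_ne _ hne] at hu'
      refine Or.inr ⟨u', update_comp_swap hx.1 hξu' 2, ⟨hξu', fun y hy => hnear ?_⟩, huu⟩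
      obtain ⟨hy1, hy2⟩ := eq_one_of_activeBond hy
      exact near_of_nbr_nbr huu hy2 (by rw [hy1]; decide)
    · have hξu : ξ u ≠ 0 := by rwa [addTwo_of_ne _ hux] at hu
      have := habove (Or.inr (h3.numDroplets_hop hp h hξ hx huu hξu hu'
        fun hn => hnear (near_of_nbr_nbr hn (nbr_symm huu) hξu)))
      exact absurd hb (not_le.2 this)
  · have := habove (Or.inl (by rw [numParticles_update hv hk]; exact Nat.lt_succ_self _))
    exact absurd hb (not_le.2 this)
  · left
    have hvx : v = x := by
      by_contra hne
      rw [addTwo_of_ne _ hne] at hv0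
      exact h3.notMem_innerBoundary hξ hv0 hv
    subst hvx
    rw [addTwo, Function.update_idem, ← hx.1, Function.update_eq_self]

/-- Upper bound on the limiting capacity: test functions for the random walk of the free particle, one
for each protocritical droplet, are combined into a test function on configurations. It is one before
the gate, and on critical droplets it is given by the position of the free particle. -/
theorem H3.exists_critForm_le (hp : p.Metastable) (h : H1 p F) (h3 : H3 p F L)
    (g : Config Λ → Option Λ → ℝ) (hg1 : ∀ ξ ∈ proto p F, g ξ none = 1)
    (hg : ∀ ξ ∈ proto p F, ∀ x, g ξ (some x) ∈ Set.Icc (0 : ℝ) 1)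
    (hnear : ∀ ξ ∈ proto p F, ∀ x, Near ξ x → g ξ (some x) = 0) :
    ∃ f ∈ admissible p F,
      critForm p F f ≤ ∑ ξ ∈ protoFinset p F, dirichlet (walkCond Λ) (g ξ) (g ξ) := by
  classical
  set Γ := gammaStar p F with hΓ
  let crit : Config Λ → Prop := fun ζ =>
    ∃ q : Config Λ × Λ, q.1 ∈ proto p F ∧ FreeAt q.1 q.2 ∧ ζ = addTwo q.1 q.2
  let f : Config Λ → ℝ := fun ζ => if BeforeGate p F ζ then 1 else
    if hc : crit ζ then g hc.choose.1 (some hc.choose.2) else 0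
  have f1 : ∀ ζ, BeforeGate p F ζ → f ζ = 1 := fun ζ hζ => if_pos hζ
  have f2 : ∀ ξ ∈ proto p F, ∀ x, FreeAt ξ x → ¬ BeforeGate p F (addTwo ξ x) →
      f (addTwo ξ x) = g ξ (some x) := by
    intro ξ hξ x hx hB
    have hc : crit (addTwo ξ x) := ⟨(ξ, x), hξ, hx, rfl⟩
    obtain ⟨e1, e2⟩ := h3.addTwo_injective hp h hξ hx hc.choose_spec.2.1
      hc.choose_spec.2.2
    simp only [f, if_neg hB, dif_pos hc]
    rw [← e1, ← e2]
  have f3 : ∀ ζ, ¬ BeforeGate p F ζ → ¬ crit ζ → f ζ = 0 := fun ζ h1 h2 => by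
    simp only [f, if_neg h1, dif_neg h2]
  have hcritE : ∀ ζ, crit ζ → energy p ζ = Γ := by
    rintro ζ ⟨⟨ξ, x⟩, hξ, hx, rfl⟩
    exact h3.energy_critical hξ hx
  have hbd : f ∈ boundaryFns F := by
    refine ⟨fun ζ => ?_, f1 _ beforeGate_emptyBox, fun ζ hζ => f3 ζ (fun hB => hB.notMem hp h hζ)
      fun hc => ?_⟩
    · by_cases hB : BeforeGate p F ζ
      · rw [f1 ζ hB]; simp
      · by_cases hc : crit ζ
        · obtain ⟨⟨ξ, x⟩, hξ, hx, rfl⟩ := hc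
          rw [f2 ξ hξ x hx hB]
          exact hg ξ hξ x
        · rw [f3 ζ hB hc]; simp
    · have h5 := hcritE ζ hc
      have h6 := h.energy_neg hζ
      have h7 := gammaStar_pos hp h
      rw [h5] at h6
      exact absurd h7 (not_lt.2 h6.le)
  have hflat : ∀ a b, (moves Λ).Adj a b → edgeLevel p a b < Γ → f a = f b := by
    intro a b hab hl
    obtain ⟨ha, hb⟩ := max_lt_iff.1 hl
    by_cases hB : BeforeGate p F a
    · rw [f1 a hB, f1 b (hB.of_lt hp h hab hb)]
    · have hB' : ¬ BeforeGate p F b := fun hB' => hB (hB'.of_lt hp h hab.symm ha)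
      rw [f3 a hB fun hc => ha.ne (hcritE a hc), f3 b hB' fun hc => hb.ne (hcritE b hc)]
  refine ⟨f, ⟨hbd, hflat⟩, ?_⟩
  -- the edges on which the test function is not constant
  have hedge : ∀ a b, (moves Λ).Adj a b → energy p a ≤ Γ → energy p b ≤ Γ → f a ≠ f b →
      ∃ ξ ∈ proto p F, ∃ o o', insertTwo ξ o = a ∧ insertTwo ξ o' = b ∧ walkCond Λ o o' = 1 ∧
        f a = g ξ o ∧ f b = g ξ o' := by
    have case1 : ∀ a b, (moves Λ).Adj a b → energy p b ≤ Γ → BeforeGate p F a →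
        ¬ BeforeGate p F b → ∃ ξ ∈ proto p F, ∃ o o', insertTwo ξ o = a ∧ insertTwo ξ o' = b ∧
          walkCond Λ o o' = 1 ∧ f a = g ξ o ∧ f b = g ξ o' := by
      intro a b hab hb hBa hBb
      have he := hBa.entrance hp h hab hb hBb
      obtain ⟨x, hx, hx0, rfl⟩ := h3.enter a b he
      refine ⟨a, ⟨_, he⟩, none, some x, rfl, rfl, by simp [walkCond, hx], ?_,
        f2 a ⟨_, he⟩ x (freeAt_of_innerBoundary hx hx0) hBb⟩
      rw [f1 a hBa, hg1 a ⟨_, he⟩]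
    have case2 : ∀ a b, (moves Λ).Adj a b → energy p b ≤ Γ → ¬ BeforeGate p F a →
        ¬ BeforeGate p F b → f a ≠ 0 → ∃ ξ ∈ proto p F, ∃ o o', insertTwo ξ o = a ∧
          insertTwo ξ o' = b ∧ walkCond Λ o o' = 1 ∧ f a = g ξ o ∧ f b = g ξ o' := by
      intro a b hab hb hBa hBb hfa
      have hc : crit a := by
        by_contra hc
        exact hfa (f3 a hBa hc)
      obtain ⟨⟨ξ, x⟩, hξ, hx, rfl⟩ := hc
      simp only at hξ hx hab hBa hfa ⊢
      have hfa' := f2 ξ hξ x hx hBa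
      have hn : ¬ Near ξ x := fun hn => hfa (by rw [hfa', hnear ξ hξ x hn])
      rcases h3.critical_move hp h hξ hx hn hab hb with rfl | ⟨x', rfl, hx', hxx⟩
      · exact absurd (beforeGate_of_mem_proto hξ) hBb
      · exact ⟨ξ, hξ, some x, some x', rfl, rfl, by simp [walkCond, hxx], hfa',
          f2 ξ hξ x' hx' hBb⟩
    intro a b hab ha hb hne
    by_cases hBa : BeforeGate p F a
    · by_cases hBb : BeforeGate p F b
      · exact absurd ((f1 a hBa).trans (f1 b hBb).symm) hne
      · exact case1 a b hab hb hBa hBb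
    · by_cases hBb : BeforeGate p F b
      · obtain ⟨ξ, hξ, o, o', h1, h2, h4, h5, h6⟩ := case1 b a hab.symm ha hBb hBa
        exact ⟨ξ, hξ, o', o, h2, h1, by rw [walkCond_comm]; exact h4, h6, h5⟩
      · by_cases hfa : f a = 0
        · obtain ⟨ξ, hξ, o, o', h1, h2, h4, h5, h6⟩ := case2 b a hab.symm ha hBb hBa
            fun hfb => hne (hfa.trans hfb.symm)
          exact ⟨ξ, hξ, o', o, h2, h1, by rw [walkCond_comm]; exact h4, h6, h5⟩
        · exact case2 a b hab hb hBa hBb hfa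
  -- summation over these edges
  set X : Config Λ → Option Λ → Option Λ → ℝ := fun ξ o o' =>
    walkCond Λ o o' * ((g ξ o - g ξ o') * (g ξ o - g ξ o')) with hX
  have hXnn : ∀ ξ o o', 0 ≤ X ξ o o' := fun ξ o o' =>
    mul_nonneg (walkCond_nonneg o o') (mul_self_nonneg _)
  have hterm : ∀ a b, critCond p Γ a b * ((f a - f b) * (f a - f b)) ≤
      ∑ ξ ∈ protoFinset p F, ∑ o, ∑ o',
        if insertTwo ξ o = a ∧ insertTwo ξ o' = b then X ξ o o' else 0 := by
    intro a b
    have hnn : ∀ ξ o o', 0 ≤ if insertTwo ξ o = a ∧ insertTwo ξ o' = b then X ξ o o' else 0 :=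
      fun ξ o o' => by split_ifs; exacts [hXnn ξ o o', le_rfl]
    by_cases hzero : critCond p Γ a b * ((f a - f b) * (f a - f b)) = 0
    · rw [hzero]
      exact Finset.sum_nonneg fun ξ _ => Finset.sum_nonneg fun o _ =>
        Finset.sum_nonneg fun o' _ => hnn ξ o o'
    · have hcc : (moves Λ).Adj a b ∧ edgeLevel p a b = Γ := by
        by_contra hcc
        exact hzero (by rw [critCond, if_neg hcc, zero_mul])
      have hne : f a ≠ f b := fun he => hzero (by rw [he, sub_self, mul_zero, mul_zero])
      obtain ⟨ξ, hξ, o, o', h1, h2, h4, h5, h6⟩ := hedge a b hcc.1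
        ((le_max_left _ _).trans hcc.2.le) ((le_max_right _ _).trans hcc.2.le) hne
      calc critCond p Γ a b * ((f a - f b) * (f a - f b)) = X ξ o o' := by
            simp only [critCond, if_pos hcc, hX, h4, h5, h6]
        _ = if insertTwo ξ o = a ∧ insertTwo ξ o' = b then X ξ o o' else 0 := by
            rw [if_pos ⟨h1, h2⟩]
        _ ≤ ∑ o', if insertTwo ξ o = a ∧ insertTwo ξ o' = b then X ξ o o' else 0 :=
            Finset.single_le_sum (f := fun o' =>
              if insertTwo ξ o = a ∧ insertTwo ξ o' = b then X ξ o o' else 0)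
              (fun o' _ => hnn ξ o o') (Finset.mem_univ o')
        _ ≤ ∑ o, ∑ o', if insertTwo ξ o = a ∧ insertTwo ξ o' = b then X ξ o o' else 0 :=
            Finset.single_le_sum (f := fun o => ∑ o',
              if insertTwo ξ o = a ∧ insertTwo ξ o' = b then X ξ o o' else 0)
              (fun o _ => Finset.sum_nonneg fun o' _ => hnn ξ o o') (Finset.mem_univ o)
        _ ≤ _ := Finset.single_le_sum (f := fun ξ => ∑ o, ∑ o',
              if insertTwo ξ o = a ∧ insertTwo ξ o' = b then X ξ o o' else 0)
              (fun ξ _ => Finset.sum_nonneg fun o _ => Finset.sum_nonneg fun o' _ => hnn ξ o o')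
              (mem_protoFinset.2 hξ)
  rw [critForm, dirichlet]
  simp only [dirichlet]
  rw [← Finset.sum_div]
  refine div_le_div_of_nonneg_right ?_ zero_le_two
  calc ∑ a, ∑ b, critCond p (gammaStar p F) a b * ((f a - f b) * (f a - f b))
      ≤ ∑ a, ∑ b, ∑ ξ ∈ protoFinset p F, ∑ o, ∑ o',
        if insertTwo ξ o = a ∧ insertTwo ξ o' = b then X ξ o o' else 0 :=
        Finset.sum_le_sum fun a _ => Finset.sum_le_sum fun b _ => hterm a b
    _ = ∑ q : Config Λ × Config Λ, ∑ ξ ∈ protoFinset p F, ∑ r : Option Λ × Option Λ,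
        if insertTwo ξ r.1 = q.1 ∧ insertTwo ξ r.2 = q.2 then X ξ r.1 r.2 else 0 := by
        simp only [Fintype.sum_prod_type]
    _ = ∑ ξ ∈ protoFinset p F, ∑ r : Option Λ × Option Λ, ∑ q : Config Λ × Config Λ,
        if insertTwo ξ r.1 = q.1 ∧ insertTwo ξ r.2 = q.2 then X ξ r.1 r.2 else 0 := by
        rw [Finset.sum_comm]
        exact Finset.sum_congr rfl fun ξ _ => Finset.sum_comm
    _ = ∑ ξ ∈ protoFinset p F, ∑ o, ∑ o', X ξ o o' := by
        refine Finset.sum_congr rfl fun ξ _ => ?_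
        rw [Fintype.sum_prod_type]
        refine Finset.sum_congr rfl fun o _ => Finset.sum_congr rfl fun o' _ => ?_
        rw [Finset.sum_eq_single (insertTwo ξ o, insertTwo ξ o')]
        · simp
        · rintro ⟨a, b⟩ _ hne
          refine if_neg fun hab => hne ?_
          exact Prod.ext hab.1.symm hab.2.symm
        · simp

/-- Lower bound on the limiting capacity: the networks of the free particle in the presence of the
various protocritical droplets are disjoint. -/
theorem H3.sum_dirichlet_le (hp : p.Metastable) (h3 : H3 p F L) (f : Config Λ → ℝ) :
    ∑ ξ ∈ protoFinset p F, dirichlet (freeCond p (gammaStar p F) ξ)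
      (fun o => f (insertTwo ξ o)) (fun o => f (insertTwo ξ o)) ≤ critForm p F f := by
  classical
  set Γ := gammaStar p F with hΓ
  have hΔ₂ := hp.Δ₁_pos.trans_le hp.Δ₁_le_Δ₂
  have hopen : ∀ ξ ∈ proto p F, ∀ o, IsOpenSite p Γ ξ o → energy p (insertTwo ξ o) ≤ Γ := by
    rintro ξ hξ (_ | x) ho
    · have := h3.energy_proto hξ
      simp only [insertTwo]
      linarith
    · exact ho.2
  have hfree : ∀ ξ ∈ proto p F, ∀ o, IsFree ξ o →
      energy p (insertTwo ξ o) = Γ ∧ IsOpenSite p Γ ξ o := by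
    rintro ξ hξ (_ | x) ho
    · exact ho.elim
    · have := h3.energy_critical hξ (x := x) ho
      exact ⟨this, (ho : FreeAt ξ x).1, this.le⟩
  -- an edge of one of the small networks
  have hvalid : ∀ ξ ∈ proto p F, ∀ o o', freeCond p Γ ξ o o' ≠ 0 →
      freeCond p Γ ξ o o' = 1 ∧ IsOpenSite p Γ ξ o ∧ IsOpenSite p Γ ξ o' ∧ o ≠ o' ∧
        critCond p Γ (insertTwo ξ o) (insertTwo ξ o') = 1 := by
    intro ξ hξ o o' hne
    have hc : (IsFree ξ o ∧ IsOpenSite p Γ ξ o') ∨ (IsOpenSite p Γ ξ o ∧ IsFree ξ o') := by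
      by_contra hc
      exact hne (if_neg hc)
    have he : freeCond p Γ ξ o o' = walkCond Λ o o' := if_pos hc
    have hw : walkCond Λ o o' = 1 := (walkCond_eq o o').resolve_left (he ▸ hne)
    have ho : IsOpenSite p Γ ξ o := hc.elim (fun hc => (hfree ξ hξ o hc.1).2) fun hc => hc.1
    have ho' : IsOpenSite p Γ ξ o' := hc.elim (fun hc => hc.2) fun hc => (hfree ξ hξ o' hc.2).2
    have hlev : edgeLevel p (insertTwo ξ o) (insertTwo ξ o') = Γ := by
      refine le_antisymm (max_le (hopen ξ hξ o ho) (hopen ξ hξ o' ho')) ?_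
      rcases hc with hc | hc
      · exact (hfree ξ hξ o hc.1).1.ge.trans (le_max_left _ _)
      · exact (hfree ξ hξ o' hc.2).1.ge.trans (le_max_right _ _)
    have hoo : o ≠ o' ∧ (moves Λ).Adj (insertTwo ξ o) (insertTwo ξ o') := by
      rcases o with _ | x <;> rcases o' with _ | y <;>
        simp only [walkCond, ite_eq_left_iff, zero_ne_one, imp_false, not_not] at hw
      · exact ⟨by simp, adj_create hw ho'.1 (by decide)⟩
      · exact ⟨by simp, (adj_create hw ho.1 (by decide)).symm⟩
      · refine ⟨fun hxy => nbr_ne hw ?_, adj_hop hw ho.1 ho'.1 (by decide)⟩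
        rw [Option.some.inj hxy]
    refine ⟨he.trans hw, ho, ho', hoo.1, ?_⟩
    rw [critCond, if_pos ⟨hoo.2, hlev⟩]
  have hins : ∀ (ξ : Config Λ) (o : Option Λ) (v : Λ), o ≠ some v → insertTwo ξ o v = ξ v := by
    rintro ξ (_ | x) v hv
    · rfl
    · exact addTwo_of_ne ξ fun he => hv (by rw [he])
  -- the droplet is the common part of the two ends of the edge
  have hmeet : ∀ ξ ∈ proto p F, ∀ o o', freeCond p Γ ξ o o' ≠ 0 → ∀ v,
      ξ v = if insertTwo ξ o v ≠ 0 ∧ insertTwo ξ o' v ≠ 0 then insertTwo ξ o v else 0 := by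
    intro ξ hξ o o' hne v
    obtain ⟨-, ho, ho', hoo, -⟩ := hvalid ξ hξ o o' hne
    by_cases h1 : o = some v
    · subst h1
      rw [hins ξ o' v hoo.symm, ho.1]
      simp
    · by_cases h2 : o' = some v
      · subst h2
        rw [hins ξ o v hoo, ho'.1]
        simp
      · rw [hins ξ o v h1, hins ξ o' v h2]
        by_cases h3 : ξ v = 0 <;> simp [h3]
  have hinsinj : ∀ (ξ : Config Λ) o o', IsOpenSite p Γ ξ o → IsOpenSite p Γ ξ o' →
      insertTwo ξ o = insertTwo ξ o' → o = o' := by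
    have key : ∀ (ξ : Config Λ) x o', IsOpenSite p Γ ξ (some x) →
        insertTwo ξ (some x) = insertTwo ξ o' → some x = o' := by
      intro ξ x o' ho he
      by_contra hne
      have h1 := congrFun he x
      rw [hins ξ o' x (Ne.symm hne), ho.1] at h1
      change addTwo ξ x x = 0 at h1
      rw [addTwo_self] at h1
      exact absurd h1 (by decide)
    intro ξ o o' ho ho' he
    rcases o with _ | x
    · rcases o' with _ | y
      · rfl
      · exact (key ξ y none ho' he.symm).symm
    · exact key ξ x o' ho he
  set T : Finset (Config Λ × Option Λ × Option Λ) :=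
    (protoFinset p F ×ˢ Finset.univ ×ˢ Finset.univ).filter
      fun t => freeCond p Γ t.1 t.2.1 t.2.2 ≠ 0 with hT
  set Y : Config Λ × Option Λ × Option Λ → ℝ := fun t => freeCond p Γ t.1 t.2.1 t.2.2 *
    ((f (insertTwo t.1 t.2.1) - f (insertTwo t.1 t.2.2)) *
      (f (insertTwo t.1 t.2.1) - f (insertTwo t.1 t.2.2))) with hY
  set Z : Config Λ × Config Λ → ℝ := fun q =>
    critCond p Γ q.1 q.2 * ((f q.1 - f q.2) * (f q.1 - f q.2)) with hZ
  let φ : Config Λ × Option Λ × Option Λ → Config Λ × Config Λ :=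
    fun t => (insertTwo t.1 t.2.1, insertTwo t.1 t.2.2)
  have hTmem : ∀ t ∈ T, t.1 ∈ proto p F ∧ freeCond p Γ t.1 t.2.1 t.2.2 ≠ 0 := by
    intro t ht
    simp only [hT, Finset.mem_filter, Finset.mem_product, mem_protoFinset] at ht
    exact ⟨ht.1.1, ht.2⟩
  have hφ : Set.InjOn φ T := by
    rintro ⟨ξ, o, o'⟩ ht ⟨ξ₂, o₂, o₂'⟩ ht₂ he
    obtain ⟨h1, h2⟩ := hTmem _ ht
    obtain ⟨h1', h2'⟩ := hTmem _ ht₂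
    simp only [φ, Prod.mk.injEq] at he h1 h2 h1' h2'
    have hξ : ξ = ξ₂ := by
      funext v
      rw [hmeet ξ h1 o o' h2 v, hmeet ξ₂ h1' o₂ o₂' h2' v, he.1, he.2]
    subst hξ
    obtain ⟨-, ho, ho', -⟩ := hvalid ξ h1 o o' h2
    obtain ⟨-, ho₂, ho₂', -⟩ := hvalid ξ h1 o₂ o₂' h2'
    rw [hinsinj ξ o o₂ ho ho₂ he.1, hinsinj ξ o' o₂' ho' ho₂' he.2]
  have hYZ : ∀ t ∈ T, Y t = Z (φ t) := by
    intro t ht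
    obtain ⟨h1, h2⟩ := hTmem t ht
    obtain ⟨e1, -, -, -, e2⟩ := hvalid _ h1 _ _ h2
    simp only [hY, hZ, φ, e1, e2]
  have hsum : ∑ t ∈ protoFinset p F ×ˢ Finset.univ ×ˢ Finset.univ, Y t ≤ ∑ q, Z q := by
    calc ∑ t ∈ protoFinset p F ×ˢ Finset.univ ×ˢ Finset.univ, Y t = ∑ t ∈ T, Y t := by
          refine (Finset.sum_subset (Finset.filter_subset _ _) fun t ht hn => ?_).symm
          have h0 : freeCond p Γ t.1 t.2.1 t.2.2 = 0 := by
            by_contra h0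
            exact hn (Finset.mem_filter.2 ⟨ht, h0⟩)
          simp only [hY, h0, zero_mul]
      _ = ∑ t ∈ T, Z (φ t) := Finset.sum_congr rfl hYZ
      _ = ∑ q ∈ T.image φ, Z q := (Finset.sum_image hφ).symm
      _ ≤ ∑ q, Z q := Finset.sum_le_sum_of_subset_of_nonneg (Finset.subset_univ _) fun q _ _ =>
          mul_nonneg (critCond_nonneg Γ _ _) (mul_self_nonneg _)
  rw [critForm, dirichlet]
  simp only [dirichlet]
  rw [← Finset.sum_div]
  refine div_le_div_of_nonneg_right ?_ zero_le_two
  simp only [Finset.sum_product, Fintype.sum_prod_type] at hsum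
  exact hsum

end Reduction

/-! ### The logarithmic growth of lattice resistances -/

section Sums

lemma sum_Icc_le {f : ℤ → ℝ} (hf : ∀ x, 0 ≤ f x) (R : ℕ) :
    ∑ x ∈ Finset.Icc (-(R : ℤ)) R, f x ≤
      ∑ j ∈ Finset.range (R + 1), f j + ∑ j ∈ Finset.range (R + 1), f (-1 - j) := by
  classical
  have h1 : ∑ j ∈ Finset.range (R + 1), f j =
      ∑ x ∈ (Finset.range (R + 1)).image fun j : ℕ => (j : ℤ), f x :=
    (Finset.sum_image fun a _ b _ h => by simpa using h).symm
  have h2 : ∑ j ∈ Finset.range (R + 1), f (-1 - j) =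
      ∑ x ∈ (Finset.range (R + 1)).image fun j : ℕ => (-1 - j : ℤ), f x :=
    (Finset.sum_image fun a _ b _ h => by simpa using h).symm
  rw [h1, h2, ← Finset.sum_union]
  · refine Finset.sum_le_sum_of_subset_of_nonneg (fun x hx => ?_) fun x _ _ => hf x
    simp only [Finset.mem_Icc, Finset.mem_union, Finset.mem_image, Finset.mem_range] at hx ⊢
    rcases le_or_gt 0 x with h | h
    · exact Or.inl ⟨x.toNat, by omega, by omega⟩
    · exact Or.inr ⟨(-1 - x).toNat, by omega, by omega⟩
  · rw [Finset.disjoint_left]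
    intro x hx hx'
    simp only [Finset.mem_image, Finset.mem_range] at hx hx'
    obtain ⟨a, -, rfl⟩ := hx
    obtain ⟨b, -, hb⟩ := hx'
    omega

lemma arctan_add_div_le (t : ℝ) : Real.arctan t + t / (1 + t ^ 2) ≤ Real.pi / 2 := by
  set θ := Real.arctan t with hθ
  have hpos : 0 < 1 + t ^ 2 := by positivity
  have h1 : t / (1 + t ^ 2) = Real.sin (Real.pi - 2 * θ) / 2 := by
    rw [Real.sin_pi_sub, Real.sin_two_mul, hθ, Real.sin_arctan, Real.cos_arctan]
    have h2 := Real.mul_self_sqrt hpos.le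
    have h3 : √(1 + t ^ 2) ≠ 0 := (Real.sqrt_pos.2 hpos).ne'
    field_simp
    rw [Real.sq_sqrt hpos.le]
  have h2 : Real.sin (Real.pi - 2 * θ) ≤ Real.pi - 2 * θ :=
    Real.sin_le (by linarith [Real.arctan_lt_pi_div_two t])
  rw [h1]
  linarith

/-- The squared gradient of the logarithm, summed over a column at distance `a` from the origin. -/
lemma sum_column_le {a : ℝ} (ha : 0 < a) (N : ℕ) :
    ∑ j ∈ Finset.range N, a ^ 2 / (a ^ 2 + (j : ℝ) ^ 2) ^ 2 ≤ 1 / a ^ 2 + Real.pi / (4 * a) := by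
  have hpos : ∀ y : ℝ, 0 < a ^ 2 + y ^ 2 := fun y => by positivity
  set f : ℝ → ℝ := fun y => a ^ 2 / (a ^ 2 + y ^ 2) ^ 2 with hf
  set G : ℝ → ℝ := fun y => (Real.arctan (y / a) / a + y / (a ^ 2 + y ^ 2)) / 2 with hG
  have hderiv : ∀ y, HasDerivAt G (f y) y := by
    intro y
    have h1 : HasDerivAt (fun y : ℝ => Real.arctan (y / a)) (1 / (1 + (y / a) ^ 2) * (1 / a)) y :=
      ((hasDerivAt_id y).div_const a).arctan
    have h2 : HasDerivAt (fun y : ℝ => a ^ 2 + y ^ 2) (2 * y) y := by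
      simpa using (hasDerivAt_pow 2 y).const_add (a ^ 2)
    have h3 := (hasDerivAt_id y).div h2 (hpos y).ne'
    refine (((h1.div_const a).add h3).div_const 2).congr_deriv ?_
    have h4 := (hpos y).ne'
    simp only [hf, id]
    field_simp
    ring
  have hanti : AntitoneOn f (Set.Icc (0 : ℝ) (0 + N)) := by
    intro x hx y hy hxy
    simp only [hf]
    have := hpos x
    have hx0 := hx.1
    gcongr
  have hcont : Continuous f := by
    simp only [hf]
    exact continuous_const.div (by fun_prop) fun y => by have := hpos y; positivity
  have hint : ∫ y in (0 : ℝ)..(0 + N), f y = G (0 + N) - G 0 :=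
    intervalIntegral.integral_eq_sub_of_hasDerivAt (fun y _ => hderiv y)
      (hcont.intervalIntegrable _ _)
  have hG0 : G 0 = 0 := by simp [hG]
  have hGN : G (0 + N) ≤ Real.pi / (4 * a) := by
    have h1 := arctan_add_div_le ((0 + N : ℝ) / a)
    have h2 : (0 + N : ℝ) / (a ^ 2 + (0 + N : ℝ) ^ 2) =
        ((0 + N : ℝ) / a / (1 + ((0 + N : ℝ) / a) ^ 2)) / a := by
      have := (hpos (0 + N)).ne'
      field_simp
    simp only [hG]
    rw [h2, ← add_div, div_div, div_le_div_iff₀ (by positivity) (by positivity)]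
    nlinarith
  have hsum := hanti.sum_le_integral
  rw [hint, hG0, sub_zero] at hsum
  have hf0 : f 0 = 1 / a ^ 2 := by
    simp only [hf]
    field_simp
    ring
  calc ∑ j ∈ Finset.range N, f j ≤ ∑ j ∈ Finset.range (N + 1), f j :=
        Finset.sum_le_sum_of_subset_of_nonneg (Finset.range_mono (Nat.le_succ N)) fun j _ _ => by
          simp only [hf]; positivity
    _ = ∑ j ∈ Finset.range N, f (0 + (j + 1 : ℕ)) + f 0 := by
        rw [Finset.sum_range_succ']
        simp
    _ ≤ 1 / a ^ 2 + Real.pi / (4 * a) := by rw [hf0]; linarith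

lemma sum_inv_le_log {R : ℕ} : ∑ j ∈ Finset.range R, 1 / ((j : ℝ) + 1) ≤ 1 + Real.log R := by
  have := harmonic_le_one_add_log R
  rw [harmonic] at this
  push_cast at this
  simpa [one_div] using this

lemma sum_inv_sq_le (R : ℕ) : ∑ j ∈ Finset.range R, 1 / ((j : ℝ) + 1) ^ 2 ≤ 2 := by
  have h := sum_Ioo_inv_sq_le (α := ℝ) 0 (R + 1)
  have h2 : Finset.Ioo 0 (R + 1) = Finset.Ico (0 + 1) (R + 1) := by
    ext j; simp only [Finset.mem_Ioo, Finset.mem_Ico]; omega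
  rw [h2, ← Finset.sum_Ico_add' (fun i : ℕ => ((i : ℝ) ^ 2)⁻¹) 0 R 1] at h
  simpa [one_div] using h

end Sums

section Flow

/-- The Dirichlet energy of a function in the square of radius `R` of the lattice. -/
def latticeEnergy (R : ℕ) (φ : ℤ → ℤ → ℝ) : ℝ :=
  ∑ x ∈ Finset.Icc (-(R : ℤ)) R, ∑ y ∈ Finset.Icc (-(R : ℤ)) R,
    ((φ (x + 1) y - φ x y) ^ 2 + (φ x (y + 1) - φ x y) ^ 2)

/-- The angle under which the dual edge of `(x, y) → (x + 1, y)` is seen from the origin. These angles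
form a flow of strength `2 * π` from the origin to infinity. -/
def angle (x y : ℤ) : ℝ :=
  Real.arctan (((y : ℝ) + 1 / 2) / ((x : ℝ) + 1 / 2)) -
    Real.arctan (((y : ℝ) - 1 / 2) / ((x : ℝ) + 1 / 2))

lemma half_ne (x : ℤ) : (x : ℝ) + 1 / 2 ≠ 0 := by
  intro h
  have h1 : (2 * x + 1 : ℝ) = 0 := by linarith
  have h2 : (2 * x + 1 : ℤ) = 0 := by exact_mod_cast h1
  omega

lemma arctan_div_add_arctan_div {s t : ℝ} (hs : s ≠ 0) (ht : t ≠ 0) :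
    Real.arctan (s / t) + Real.arctan (t / s) = Real.pi / 2 * (SignType.sign (s * t) : ℝ) := by
  have h : t / s = (s / t)⁻¹ := (inv_div s t).symm
  rcases lt_or_gt_of_ne (mul_ne_zero hs ht) with h1 | h1
  · have h2 : s / t < 0 := by
      rw [div_eq_mul_inv]
      rcases mul_neg_iff.1 h1 with ⟨a, b⟩ | ⟨a, b⟩
      · exact mul_neg_of_pos_of_neg a (inv_lt_zero.2 b)
      · exact mul_neg_of_neg_of_pos a (inv_pos.2 b)
    rw [sign_neg h1, h, Real.arctan_inv_of_neg h2]
    simp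
  · have h2 : 0 < s / t := by
      rcases mul_pos_iff.1 h1 with ⟨a, b⟩ | ⟨a, b⟩
      · exact div_pos a b
      · exact div_pos_of_neg_of_neg a b
    rw [sign_pos h1, h, Real.arctan_inv_of_pos h2]
    simp

/-- The angles form a unit flow, up to the factor `2 * π`. -/
lemma angle_divergence (x y : ℤ) :
    angle x y - angle (x - 1) y + angle y x - angle (y - 1) x =
      if x = 0 ∧ y = 0 then 2 * Real.pi else 0 := by
  have hx := half_ne x
  have hy := half_ne y
  have hx' := half_ne (x - 1)
  have hy' := half_ne (y - 1)
  have e1 : ∀ z : ℤ, (((z - 1 : ℤ) : ℝ) + 1 / 2) = (z : ℝ) - 1 / 2 := fun z => by push_cast; ring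
  rw [e1] at hx' hy'
  have a1 := arctan_div_add_arctan_div hx hy
  have a2 := arctan_div_add_arctan_div hx hy'
  have a3 := arctan_div_add_arctan_div hx' hy
  have a4 := arctan_div_add_arctan_div hx' hy'
  have key : angle x y - angle (x - 1) y + angle y x - angle (y - 1) x =
      Real.pi / 2 * ((SignType.sign (((x : ℝ) + 1 / 2) * ((y : ℝ) + 1 / 2)) : ℝ) -
        SignType.sign (((x : ℝ) + 1 / 2) * ((y : ℝ) - 1 / 2)) -
        SignType.sign (((x : ℝ) - 1 / 2) * ((y : ℝ) + 1 / 2)) +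
        SignType.sign (((x : ℝ) - 1 / 2) * ((y : ℝ) - 1 / 2))) := by
    simp only [angle, e1]
    linarith
  rw [key]
  have sgn : ∀ z : ℤ, (z ≤ -1 ∧ (z : ℝ) + 1 / 2 < 0 ∧ (z : ℝ) - 1 / 2 < 0) ∨
      (z = 0 ∧ 0 < (z : ℝ) + 1 / 2 ∧ (z : ℝ) - 1 / 2 < 0) ∨
      (1 ≤ z ∧ 0 < (z : ℝ) + 1 / 2 ∧ 0 < (z : ℝ) - 1 / 2) := by
    intro z
    rcases lt_trichotomy z 0 with h | h | h
    · left
      have h1 : z ≤ -1 := by omega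
      have : (z : ℝ) ≤ -1 := by exact_mod_cast h1
      exact ⟨h1, by linarith, by linarith⟩
    · right; left
      subst h
      norm_num
    · right; right
      have : (1 : ℝ) ≤ z := by exact_mod_cast h
      exact ⟨h, by linarith, by linarith⟩
  simp only [sign_mul]
  rcases sgn x with ⟨h1, h2, h3⟩ | ⟨h1, h2, h3⟩ | ⟨h1, h2, h3⟩ <;>
  rcases sgn y with ⟨h4, h5, h6⟩ | ⟨h4, h5, h6⟩ | ⟨h4, h5, h6⟩ <;>
  split_ifs with hc <;>
  first
  | (exfalso; omega)
  | (simp only [sign_pos, sign_neg, h2, h3, h5, h6]; norm_num; try ring)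

lemma arctan_sub_le {s t m : ℝ} (hst : s ≤ t) (hm : ∀ u ∈ Set.Icc s t, m ≤ u ^ 2) (hm0 : 0 ≤ m) :
    Real.arctan t - Real.arctan s ≤ (t - s) / (1 + m) := by
  have h := Convex.image_sub_le_mul_sub_of_deriv_le (convex_Icc s t)
    (f := Real.arctan) Real.continuous_arctan.continuousOn
    Real.differentiable_arctan.differentiableOn (C := 1 / (1 + m)) (fun u hu => by
      rw [Real.deriv_arctan]
      have := hm u (interior_subset hu)
      change 1 / (1 + u ^ 2) ≤ 1 / (1 + m)
      gcongr) s (Set.left_mem_Icc.2 hst) t (Set.right_mem_Icc.2 hst) hst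
  rw [div_eq_mul_one_div, mul_comm]
  exact h

lemma angle_neg_sub (x y : ℤ) : angle (-1 - x) y = -angle x y := by
  have e : ((-1 - x : ℤ) : ℝ) + 1 / 2 = -((x : ℝ) + 1 / 2) := by push_cast; ring
  simp only [angle, e, div_neg, Real.arctan_neg]
  ring

lemma angle_neg (x y : ℤ) : angle x (-y) = angle x y := by
  simp only [angle]
  push_cast
  rw [show (-(y : ℝ) + 1 / 2) = -((y : ℝ) - 1 / 2) by ring,
    show (-(y : ℝ) - 1 / 2) = -((y : ℝ) + 1 / 2) by ring, neg_div, neg_div, Real.arctan_neg,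
    Real.arctan_neg]
  ring

lemma angle_sq_le (x j : ℕ) : angle x j ^ 2 ≤
    ((x : ℝ) + 1 / 2) ^ 2 / (((x : ℝ) + 1 / 2) ^ 2 + ((j - 1 : ℕ) : ℝ) ^ 2) ^ 2 := by
  set a : ℝ := (x : ℝ) + 1 / 2 with ha
  have hapos : 0 < a := by positivity
  set m : ℝ := ((j - 1 : ℕ) : ℝ) with hm
  have hm0 : 0 ≤ m := Nat.cast_nonneg _
  have hle : ((j : ℝ) - 1 / 2) / a ≤ ((j : ℝ) + 1 / 2) / a := by gcongr; linarith
  have h0 : 0 ≤ angle x j := by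
    simp only [angle, Int.cast_natCast]
    exact sub_nonneg.2 (Real.arctan_strictMono.monotone hle)
  have h1 : angle x j ≤ (1 / a) / (1 + (m / a) ^ 2) := by
    have h2 := arctan_sub_le hle (m := (m / a) ^ 2) (fun u hu => ?_) (by positivity)
    · simp only [angle, Int.cast_natCast]
      refine h2.trans_eq ?_
      congr 1
      rw [← sub_div]
      ring
    · rcases Nat.eq_zero_or_pos j with rfl | hj
      · simp [hm, sq_nonneg]
      · have h3 : m = (j : ℝ) - 1 := by rw [hm]; push_cast [Nat.cast_sub hj]; ring
        have h4 : m / a ≤ u := le_trans (by gcongr; linarith) hu.1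
        have : 0 ≤ m / a := by positivity
        gcongr
  calc angle x j ^ 2 ≤ ((1 / a) / (1 + (m / a) ^ 2)) ^ 2 := by gcongr
    _ = a ^ 2 / (a ^ 2 + m ^ 2) ^ 2 := by
      have : 0 < a ^ 2 + m ^ 2 := by positivity
      field_simp

/-- The energy of the flow through the edges of one column. -/
lemma sum_angle_sq_le (x R : ℕ) : ∑ y ∈ Finset.Icc (-(R : ℤ)) R, angle x y ^ 2 ≤
    3 / ((x : ℝ) + 1 / 2) ^ 2 + Real.pi / (2 * ((x : ℝ) + 1 / 2)) := by
  set a : ℝ := (x : ℝ) + 1 / 2 with ha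
  have hapos : 0 < a := by positivity
  refine (sum_Icc_le (fun y => sq_nonneg _) R).trans ?_
  have h1 : ∑ j ∈ Finset.range (R + 1), angle x (j : ℤ) ^ 2 ≤
      1 / a ^ 2 + (1 / a ^ 2 + Real.pi / (4 * a)) := by
    calc ∑ j ∈ Finset.range (R + 1), angle x (j : ℤ) ^ 2
        ≤ ∑ j ∈ Finset.range (R + 1), a ^ 2 / (a ^ 2 + ((j - 1 : ℕ) : ℝ) ^ 2) ^ 2 :=
          Finset.sum_le_sum fun j _ => angle_sq_le x j
      _ = ∑ j ∈ Finset.range R, a ^ 2 / (a ^ 2 + (j : ℝ) ^ 2) ^ 2 + 1 / a ^ 2 := by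
          rw [Finset.sum_range_succ']
          simp
          field_simp
      _ ≤ _ := by linarith [sum_column_le hapos R]
  have h2 : ∑ j ∈ Finset.range (R + 1), angle x (-1 - (j : ℤ)) ^ 2 ≤
      1 / a ^ 2 + Real.pi / (4 * a) := by
    refine le_trans (Finset.sum_le_sum fun j _ => ?_) (sum_column_le hapos (R + 1))
    have h3 := angle_sq_le x (j + 1)
    rw [← angle_neg, show -(((j + 1 : ℕ) : ℤ)) = -1 - (j : ℤ) by push_cast; ring] at h3
    exact h3.trans_eq (by simp [ha])
  calc _ ≤ (1 / a ^ 2 + (1 / a ^ 2 + Real.pi / (4 * a))) + (1 / a ^ 2 + Real.pi / (4 * a)) :=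
        add_le_add h1 h2
    _ = 3 / a ^ 2 + Real.pi / (2 * a) := by field_simp; ring

/-- The energy of the flow through the edges in one direction. -/
lemma sum_sum_angle_sq_le (R : ℕ) :
    ∑ x ∈ Finset.Icc (-(R : ℤ)) R, ∑ y ∈ Finset.Icc (-(R : ℤ)) R, angle x y ^ 2 ≤
      Real.pi * Real.log R + 60 := by
  have hpi := Real.pi_pos
  have hpi4 := Real.pi_le_four
  refine (sum_Icc_le (f := fun x => ∑ y ∈ Finset.Icc (-(R : ℤ)) R, angle x y ^ 2)
    (fun x => Finset.sum_nonneg fun y _ => sq_nonneg _) R).trans ?_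
  have h0 : ∀ j : ℕ, ∑ y ∈ Finset.Icc (-(R : ℤ)) R, angle (-1 - j) y ^ 2 =
      ∑ y ∈ Finset.Icc (-(R : ℤ)) R, angle j y ^ 2 := fun j => by
    simp only [angle_neg_sub, neg_sq]
  simp only [h0]
  have h1 : ∑ j ∈ Finset.range (R + 1), ∑ y ∈ Finset.Icc (-(R : ℤ)) R, angle j y ^ 2 ≤
      (∑ j ∈ Finset.range R, (3 * (1 / ((j : ℝ) + 1) ^ 2) + Real.pi / 2 * (1 / ((j : ℝ) + 1)))) +
        (12 + Real.pi) := by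
    refine (Finset.sum_le_sum fun j _ => sum_angle_sq_le j R).trans ?_
    rw [Finset.sum_range_succ']
    refine add_le_add (Finset.sum_le_sum fun j _ => ?_) ?_
    · have hj : (0 : ℝ) ≤ j := Nat.cast_nonneg j
      push_cast
      obtain ⟨b, hb⟩ : ∃ b, b = (j : ℝ) + 1 + 1 / 2 := ⟨_, rfl⟩
      have hjb : (j : ℝ) + 1 ≤ b := by linarith
      rw [← hb]
      have e1 : 3 / b ^ 2 ≤ 3 * (1 / ((j : ℝ) + 1) ^ 2) := by
        rw [← div_eq_mul_one_div]; gcongr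
      have e2 : Real.pi / (2 * b) ≤ Real.pi / 2 * (1 / ((j : ℝ) + 1)) := by
        rw [div_mul_div_comm, mul_one]; gcongr
      linarith
    · norm_num
  rw [Finset.sum_add_distrib, ← Finset.mul_sum, ← Finset.mul_sum] at h1
  have h2 := sum_inv_sq_le R
  have h3 := mul_le_mul_of_nonneg_left (sum_inv_le_log (R := R)) (by positivity : 0 ≤ Real.pi / 2)
  linarith

lemma sum_Icc_shift {f : ℤ → ℝ} {R : ℕ} (h1 : f (-R) = 0) (h2 : f (R + 1) = 0) :
    ∑ x ∈ Finset.Icc (-(R : ℤ)) R, f (x + 1) = ∑ x ∈ Finset.Icc (-(R : ℤ)) R, f x := by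
  have e1 : Finset.Icc (-(R : ℤ)) R = Finset.Ico (-(R : ℤ)) (R + 1) := by
    ext x; simp only [Finset.mem_Icc, Finset.mem_Ico]; omega
  rw [e1, Finset.sum_Ico_add' f]
  have h3 : ∑ x ∈ Finset.Ico (-(R : ℤ) + 1) (R + 1), f x =
      ∑ x ∈ Finset.Ico (-(R : ℤ) + 1) (R + 1 + 1), f x := by
    refine Finset.sum_subset (Finset.Ico_subset_Ico_right (by omega)) fun x hx hx' => ?_
    rw [Finset.mem_Ico] at hx hx'
    rw [show x = R + 1 by omega, h2]
  have h4 : ∑ x ∈ Finset.Ico (-(R : ℤ) + 1) (R + 1), f x =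
      ∑ x ∈ Finset.Ico (-(R : ℤ)) (R + 1), f x := by
    refine Finset.sum_subset (Finset.Ico_subset_Ico_left (by omega)) fun x hx hx' => ?_
    rw [Finset.mem_Ico] at hx hx'
    rw [show x = -R by omega, h1]
  rw [← h3, h4]

/-- A function that vanishes near the boundary of the square of radius `R` has energy at least
`2 * π / log R`, to leading order, in units of its squared value at the origin. This is the
Cauchy–Schwarz inequality for the product of its gradient with the flow `angle`. -/
theorem sq_le_mul_latticeEnergy {R : ℕ} {φ : ℤ → ℤ → ℝ}
    (hφ : ∀ x y : ℤ, (R : ℤ) ≤ |x| ∨ (R : ℤ) ≤ |y| → φ x y = 0) :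
    (2 * Real.pi * φ 0 0) ^ 2 ≤ (2 * Real.pi * Real.log R + 120) * latticeEnergy R φ := by
  set I := Finset.Icc (-(R : ℤ)) R with hI
  have hbd1 : (R : ℤ) ≤ |(-(R : ℤ))| := by rw [abs_neg]; exact le_abs_self _
  have hbd2 : (R : ℤ) ≤ |((R : ℤ) + 1)| := le_trans (by omega) (le_abs_self _)
  have hT : ∑ x ∈ I, ∑ y ∈ I, (angle x y * (φ x y - φ (x + 1) y) +
      angle y x * (φ x y - φ x (y + 1))) = 2 * Real.pi * φ 0 0 := by
    have h1 : ∑ x ∈ I, ∑ y ∈ I, angle x y * φ (x + 1) y =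
        ∑ x ∈ I, ∑ y ∈ I, angle (x - 1) y * φ x y := by
      refine Finset.sum_comm.trans (Eq.trans (Finset.sum_congr rfl fun y _ => ?_) Finset.sum_comm)
      have := sum_Icc_shift (f := fun x => angle (x - 1) y * φ x y) (R := R)
        (by simp only [hφ _ _ (Or.inl hbd1), mul_zero])
        (by simp only [hφ _ _ (Or.inl hbd2), mul_zero])
      simpa using this
    have h2 : ∑ x ∈ I, ∑ y ∈ I, angle y x * φ x (y + 1) =
        ∑ x ∈ I, ∑ y ∈ I, angle (y - 1) x * φ x y := by
      refine Finset.sum_congr rfl fun x _ => ?_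
      have := sum_Icc_shift (f := fun y => angle (y - 1) x * φ x y) (R := R)
        (by simp only [hφ _ _ (Or.inr hbd1), mul_zero])
        (by simp only [hφ _ _ (Or.inr hbd2), mul_zero])
      simpa using this
    have h0 : (0 : ℤ) ∈ I := by simp [hI]
    calc ∑ x ∈ I, ∑ y ∈ I, (angle x y * (φ x y - φ (x + 1) y) +
          angle y x * (φ x y - φ x (y + 1)))
        = ∑ x ∈ I, ∑ y ∈ I, (angle x y + angle y x) * φ x y -
          ∑ x ∈ I, ∑ y ∈ I, angle x y * φ (x + 1) y -
          ∑ x ∈ I, ∑ y ∈ I, angle y x * φ x (y + 1) := by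
          simp only [← Finset.sum_sub_distrib]
          exact Finset.sum_congr rfl fun x _ => Finset.sum_congr rfl fun y _ => by ring
      _ = ∑ x ∈ I, ∑ y ∈ I, (if x = 0 ∧ y = 0 then 2 * Real.pi else 0) * φ x y := by
          rw [h1, h2]
          simp only [← Finset.sum_sub_distrib, ← angle_divergence]
          exact Finset.sum_congr rfl fun x _ => Finset.sum_congr rfl fun y _ => by ring
      _ = 2 * Real.pi * φ 0 0 := by
          rw [Finset.sum_eq_single_of_mem 0 h0, Finset.sum_eq_single_of_mem 0 h0]
          · simp
          · intro y _ hy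
            rw [if_neg fun h => hy h.2, zero_mul]
          · intro x _ hx
            exact Finset.sum_eq_zero fun y _ => by rw [if_neg fun h => hx h.1, zero_mul]
  have hCS := Finset.sum_mul_sq_le_sq_mul_sq (I ×ˢ I ×ˢ (Finset.univ : Finset Bool))
    (fun t => if t.2.2 then angle t.1 t.2.1 else angle t.2.1 t.1)
    (fun t => if t.2.2 then φ t.1 t.2.1 - φ (t.1 + 1) t.2.1 else φ t.1 t.2.1 - φ t.1 (t.2.1 + 1))
  simp only [Finset.sum_product, Fintype.sum_bool, if_true, Bool.false_eq_true, if_false] at hCS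
  rw [hT] at hCS
  refine hCS.trans ?_
  have hE : ∑ x ∈ I, ∑ y ∈ I, ((φ x y - φ (x + 1) y) ^ 2 + (φ x y - φ x (y + 1)) ^ 2) =
      latticeEnergy R φ :=
    Finset.sum_congr rfl fun x _ => Finset.sum_congr rfl fun y _ => by ring
  rw [hE]
  refine mul_le_mul_of_nonneg_right ?_ (Finset.sum_nonneg fun x _ => Finset.sum_nonneg fun y _ => by
    positivity)
  simp only [Finset.sum_add_distrib]
  have h1 := sum_sum_angle_sq_le R
  have h2 : ∑ x ∈ I, ∑ y ∈ I, angle y x ^ 2 ≤ Real.pi * Real.log R + 60 := by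
    rw [Finset.sum_comm]
    exact h1
  linarith

end Flow

section Potential

/-- The logarithm of the Euclidean distance from the origin (zero at the origin). -/
def logDist (x y : ℤ) : ℝ := Real.log ((x : ℝ) ^ 2 + (y : ℝ) ^ 2) / 2

lemma logDist_comm (x y : ℤ) : logDist x y = logDist y x := by
  simp only [logDist, add_comm]

lemma logDist_neg (x y : ℤ) : logDist (-x) y = logDist x y := by
  simp [logDist]

lemma logDist_neg' (x y : ℤ) : logDist x (-y) = logDist x y := by
  simp [logDist]

/-- The gradient of the logarithm. At the origin the convention `log 0 = 0` makes it vanish. -/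
lemma logDist_sub_sq_le (x j : ℕ) : (logDist (x + 1) j - logDist x j) ^ 2 ≤
    (((x : ℝ) + 1 / 2) / ((x : ℝ) ^ 2 + (j : ℝ) ^ 2)) ^ 2 := by
  by_cases h0 : (x : ℝ) ^ 2 + (j : ℝ) ^ 2 = 0
  · have hx : (x : ℝ) = 0 := by nlinarith [sq_nonneg (x : ℝ), sq_nonneg (j : ℝ)]
    have hj : (j : ℝ) = 0 := by nlinarith [sq_nonneg (x : ℝ), sq_nonneg (j : ℝ)]
    simp [logDist, hx, hj]
  have hpos : 0 < (x : ℝ) ^ 2 + (j : ℝ) ^ 2 := lt_of_le_of_ne (by positivity) (Ne.symm h0)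
  have hpos' : 0 < ((x : ℝ) + 1) ^ 2 + (j : ℝ) ^ 2 := by positivity
  have hle : (x : ℝ) ^ 2 + (j : ℝ) ^ 2 ≤ ((x : ℝ) + 1) ^ 2 + (j : ℝ) ^ 2 := by gcongr; linarith
  have e : logDist (x + 1) j - logDist x j =
      Real.log ((((x : ℝ) + 1) ^ 2 + (j : ℝ) ^ 2) / ((x : ℝ) ^ 2 + (j : ℝ) ^ 2)) / 2 := by
    rw [Real.log_div hpos'.ne' h0]
    simp only [logDist]
    push_cast
    ring
  rw [e]
  have h1 : 0 ≤ Real.log ((((x : ℝ) + 1) ^ 2 + (j : ℝ) ^ 2) / ((x : ℝ) ^ 2 + (j : ℝ) ^ 2)) :=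
    Real.log_nonneg ((one_le_div hpos).2 hle)
  have h2 := Real.log_le_sub_one_of_pos (div_pos hpos' hpos)
  have h3 : (((x : ℝ) + 1) ^ 2 + (j : ℝ) ^ 2) / ((x : ℝ) ^ 2 + (j : ℝ) ^ 2) - 1 =
      2 * (((x : ℝ) + 1 / 2) / ((x : ℝ) ^ 2 + (j : ℝ) ^ 2)) := by
    field_simp
    ring
  refine pow_le_pow_left₀ (by linarith) ?_ 2
  linarith

lemma logDist_sub_sq_neg (x y : ℤ) : (logDist (-1 - x + 1) y - logDist (-1 - x) y) ^ 2 =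
    (logDist (x + 1) y - logDist x y) ^ 2 := by
  rw [show -1 - x + 1 = -x by ring, show -1 - x = -(x + 1) by ring, logDist_neg, logDist_neg]
  ring

/-- The energy of the logarithm in a column that does not contain the origin. -/
lemma sum_logDist_sq_le (x R : ℕ) :
    ∑ y ∈ Finset.Icc (-(R : ℤ)) R,
      (logDist ((x + 1 : ℕ) + 1) y - logDist (x + 1 : ℕ) y) ^ 2 ≤
    7 * (1 / ((x : ℝ) + 1) ^ 2) + Real.pi / 2 * (1 / ((x : ℝ) + 1)) := by
  set b : ℝ := (x : ℝ) + 1 with hb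
  have hb1 : 1 ≤ b := by simp [hb]
  have hbpos : 0 < b := by linarith
  set w : ℕ → ℝ := fun j => ((b + 1 / 2) / b) ^ 2 * (b ^ 2 / (b ^ 2 + (j : ℝ) ^ 2) ^ 2) with hw
  have hw0 : ∀ j, 0 ≤ w j := fun j => by simp only [hw]; positivity
  have hterm : ∀ j : ℕ, (logDist ((x + 1 : ℕ) + 1) j - logDist (x + 1 : ℕ) j) ^ 2 ≤ w j := by
    intro j
    refine (logDist_sub_sq_le (x + 1) j).trans_eq ?_
    have : 0 < b ^ 2 + (j : ℝ) ^ 2 := by positivity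
    simp only [hw]
    rw [Nat.cast_add_one, ← hb]
    field_simp
  have hwsum : ∀ N, ∑ j ∈ Finset.range N, w j ≤
      ((b + 1 / 2) / b) ^ 2 * (1 / b ^ 2 + Real.pi / (4 * b)) := fun N => by
    simp only [hw]
    rw [← Finset.mul_sum]
    exact mul_le_mul_of_nonneg_left (sum_column_le hbpos N) (by positivity)
  have h1 : ∑ j ∈ Finset.range (R + 1),
      (logDist ((x + 1 : ℕ) + 1) (j : ℤ) - logDist (x + 1 : ℕ) (j : ℤ)) ^ 2 ≤
      ((b + 1 / 2) / b) ^ 2 * (1 / b ^ 2 + Real.pi / (4 * b)) :=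
    (Finset.sum_le_sum fun j _ => hterm j).trans (hwsum _)
  have h2 : ∑ j ∈ Finset.range (R + 1),
      (logDist ((x + 1 : ℕ) + 1) (-1 - (j : ℤ)) - logDist (x + 1 : ℕ) (-1 - (j : ℤ))) ^ 2 ≤
      ((b + 1 / 2) / b) ^ 2 * (1 / b ^ 2 + Real.pi / (4 * b)) := by
    refine le_trans (Finset.sum_le_sum (g := fun j => w (j + 1)) fun j _ => ?_) (le_trans ?_
      (hwsum (R + 1 + 1)))
    · have h3 := hterm (j + 1)
      rw [← logDist_neg', ← logDist_neg' (x + 1 : ℕ)] at h3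
      rw [show -1 - (j : ℤ) = -((j + 1 : ℕ) : ℤ) by push_cast; ring]
      exact h3
    · rw [Finset.sum_range_succ' _ (R + 1)]
      linarith [hw0 0]
  refine (sum_Icc_le (fun y => sq_nonneg _) R).trans ((add_le_add h1 h2).trans ?_)
  -- with `t = 1 / b ≤ 1` this is an inequality between polynomials
  set t : ℝ := 1 / b with ht
  have ht0 : 0 < t := by positivity
  have ht1 : t ≤ 1 := by rw [ht, div_le_one hbpos]; exact hb1
  have e1 : (b + 1 / 2) / b = 1 + t / 2 := by rw [ht]; field_simp
  have e2 : 1 / b ^ 2 = t ^ 2 := by rw [ht]; field_simp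
  have e3 : Real.pi / (4 * b) = Real.pi * t / 4 := by rw [ht]; field_simp
  rw [e1, e2, e3]
  have hpi := Real.pi_lt_d2
  have hpi0 := Real.pi_pos
  have ht3 : t ^ 3 ≤ t ^ 2 := pow_le_pow_of_le_one ht0.le ht1 (by norm_num)
  have ht4 : t ^ 4 ≤ t ^ 2 := pow_le_pow_of_le_one ht0.le ht1 (by norm_num)
  have ht2 : 0 < t ^ 2 := by positivity
  have h5 : Real.pi * t ^ 2 ≤ 3.15 * t ^ 2 := by gcongr
  have h6 : Real.pi * t ^ 3 ≤ 3.15 * t ^ 2 := by gcongr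
  nlinarith

/-- The energy of the logarithm in the column of the origin. -/
lemma sum_logDist_sq_zero_le (R : ℕ) :
    ∑ y ∈ Finset.Icc (-(R : ℤ)) R, (logDist (0 + 1) y - logDist 0 y) ^ 2 ≤ 1 := by
  have hterm : ∀ j : ℕ, (logDist (0 + 1) (j + 1 : ℕ) - logDist 0 (j + 1 : ℕ)) ^ 2 ≤
      1 / 4 * (1 / ((j : ℝ) + 1) ^ 2) := by
    intro j
    have h1 := logDist_sub_sq_le 0 (j + 1)
    have hj : (1 : ℝ) ≤ (j : ℝ) + 1 := by simp
    push_cast at h1 ⊢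
    refine h1.trans ?_
    have h2 : 1 / (((j : ℝ) + 1) ^ 2) ^ 2 ≤ 1 / ((j : ℝ) + 1) ^ 2 := by
      have h3 : (1 : ℝ) ≤ ((j : ℝ) + 1) ^ 2 := one_le_pow₀ hj
      gcongr
      nlinarith
    calc ((0 + 1 / 2 : ℝ) / (0 ^ 2 + ((j : ℝ) + 1) ^ 2)) ^ 2 =
        1 / 4 * (1 / (((j : ℝ) + 1) ^ 2) ^ 2) := by field_simp; norm_num; ring
      _ ≤ _ := by gcongr
  have hsum : ∀ N, ∑ j ∈ Finset.range N,
      (logDist (0 + 1) (j + 1 : ℕ) - logDist 0 (j + 1 : ℕ)) ^ 2 ≤ 1 / 2 := by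
    intro N
    refine (Finset.sum_le_sum fun j _ => hterm j).trans ?_
    rw [← Finset.mul_sum]
    linarith [sum_inv_sq_le N]
  refine (sum_Icc_le (fun y => sq_nonneg _) R).trans ?_
  have h1 : ∑ j ∈ Finset.range (R + 1), (logDist (0 + 1) (j : ℤ) - logDist 0 (j : ℤ)) ^ 2 ≤ 1 / 2 := by
    rw [Finset.sum_range_succ']
    have h0 : (logDist (0 + 1) ((0 : ℕ) : ℤ) - logDist 0 ((0 : ℕ) : ℤ)) ^ 2 = 0 := by
      simp [logDist]
    rw [h0, add_zero]
    exact hsum R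
  have h2 : ∑ j ∈ Finset.range (R + 1),
      (logDist (0 + 1) (-1 - (j : ℤ)) - logDist 0 (-1 - (j : ℤ))) ^ 2 ≤ 1 / 2 := by
    refine (Finset.sum_le_sum fun j _ => le_of_eq ?_).trans (hsum (R + 1))
    rw [show -1 - (j : ℤ) = -((j + 1 : ℕ) : ℤ) by push_cast; ring, logDist_neg', logDist_neg']
  exact (add_le_add h1 h2).trans (by norm_num)

/-- The energy of the logarithm of the distance. -/
theorem latticeEnergy_logDist_le (R : ℕ) :
    latticeEnergy R logDist ≤ 2 * Real.pi * Real.log R + 68 := by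
  have hpi := Real.pi_le_four
  have h1 : ∑ x ∈ Finset.Icc (-(R : ℤ)) R, ∑ y ∈ Finset.Icc (-(R : ℤ)) R,
      (logDist (x + 1) y - logDist x y) ^ 2 ≤ Real.pi * Real.log R + 34 := by
    refine (sum_Icc_le (f := fun x => ∑ y ∈ Finset.Icc (-(R : ℤ)) R,
      (logDist (x + 1) y - logDist x y) ^ 2)
      (fun x => Finset.sum_nonneg fun y _ => sq_nonneg _) R).trans ?_
    simp only [logDist_sub_sq_neg]
    have h2 : ∑ j ∈ Finset.range (R + 1), ∑ y ∈ Finset.Icc (-(R : ℤ)) R,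
        (logDist ((j : ℤ) + 1) y - logDist j y) ^ 2 ≤
        (∑ j ∈ Finset.range R, (7 * (1 / ((j : ℝ) + 1) ^ 2) + Real.pi / 2 * (1 / ((j : ℝ) + 1)))) +
          1 := by
      rw [Finset.sum_range_succ']
      exact add_le_add (Finset.sum_le_sum fun j _ => sum_logDist_sq_le j R)
        (sum_logDist_sq_zero_le R)
    rw [Finset.sum_add_distrib, ← Finset.mul_sum, ← Finset.mul_sum] at h2
    have h3 := sum_inv_sq_le R
    have h4 := mul_le_mul_of_nonneg_left (sum_inv_le_log (R := R))
      (by positivity : 0 ≤ Real.pi / 2)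
    linarith
  have h2 : ∑ x ∈ Finset.Icc (-(R : ℤ)) R, ∑ y ∈ Finset.Icc (-(R : ℤ)) R,
      (logDist x (y + 1) - logDist x y) ^ 2 ≤ Real.pi * Real.log R + 34 := by
    rw [Finset.sum_comm]
    refine le_of_eq_of_le ?_ h1
    exact Finset.sum_congr rfl fun x _ => Finset.sum_congr rfl fun y _ => by
      rw [logDist_comm y (x + 1), logDist_comm y x]
  simp only [latticeEnergy, Finset.sum_add_distrib]
  linarith

lemma abs_clamp_sub_le (a b s t : ℝ) : |max a (min b s) - max a (min b t)| ≤ |s - t| :=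
  (abs_max_sub_max_le_max _ _ _ _).trans (max_le (by simp) ((abs_min_sub_min_le_max _ _ _ _).trans
    (max_le (by simp) le_rfl)))

/-- Test functions of almost minimal energy for the resistance between a disc of radius `ρ` and the
complement of the square of radius `R`. -/
theorem exists_cutoff {ρ : ℝ} {R : ℕ} (hρ : 1 ≤ ρ) (hR : ρ < R) :
    ∃ φ : ℤ → ℤ → ℝ, (∀ x y, φ x y ∈ Set.Icc (0 : ℝ) 1) ∧
      (∀ x y : ℤ, (x : ℝ) ^ 2 + (y : ℝ) ^ 2 ≤ ρ ^ 2 → φ x y = 0) ∧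
      (∀ x y : ℤ, (R : ℤ) ≤ |x| ∨ (R : ℤ) ≤ |y| → φ x y = 1) ∧
      latticeEnergy R φ ≤ (2 * Real.pi * Real.log R + 68) / (Real.log R - Real.log ρ) ^ 2 := by
  have hρ0 : 0 < ρ := by linarith
  have hR0 : (0 : ℝ) < R := by linarith
  set D := Real.log R - Real.log ρ with hD
  have hDpos : 0 < D := sub_pos.2 (Real.log_lt_log hρ0 hR)
  refine ⟨fun x y => max 0 (min 1 ((logDist x y - Real.log ρ) / D)), fun x y =>
    ⟨le_max_left _ _, max_le zero_le_one (min_le_left _ _)⟩, fun x y hxy => ?_, fun x y hxy => ?_, ?_⟩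
  · have h1 : logDist x y ≤ Real.log ρ := by
      rcases (by positivity : (0 : ℝ) ≤ (x : ℝ) ^ 2 + (y : ℝ) ^ 2).eq_or_lt with h | h
      · rw [logDist, ← h, Real.log_zero, zero_div]
        exact Real.log_nonneg hρ
      · have := Real.log_le_log h hxy
        rw [Real.log_pow] at this
        rw [logDist]
        push_cast at this
        linarith
    exact max_eq_left ((min_le_right _ _).trans
      (div_nonpos_of_nonpos_of_nonneg (sub_nonpos.2 h1) hDpos.le))
  · have h1 : (R : ℝ) ^ 2 ≤ (x : ℝ) ^ 2 + (y : ℝ) ^ 2 := by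
      have key : ∀ z : ℤ, (R : ℤ) ≤ |z| → (R : ℝ) ^ 2 ≤ (z : ℝ) ^ 2 := fun z hz => by
        rw [← sq_abs (z : ℝ)]
        have : (R : ℝ) ≤ |(z : ℝ)| := by exact_mod_cast hz
        gcongr
      rcases hxy with h | h
      · linarith [key x h, sq_nonneg (y : ℝ)]
      · linarith [key y h, sq_nonneg (x : ℝ)]
    have h2 : Real.log R ≤ logDist x y := by
      have := Real.log_le_log (by positivity) h1
      rw [Real.log_pow] at this
      rw [logDist]
      push_cast at this
      linarith
    have h3 : 1 ≤ (logDist x y - Real.log ρ) / D := by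
      rw [one_le_div hDpos, hD]
      linarith
    simp only [min_eq_left h3]
    exact max_eq_right zero_le_one
  · have hstep : ∀ s t : ℝ, (max 0 (min 1 ((s - Real.log ρ) / D)) -
        max 0 (min 1 ((t - Real.log ρ) / D))) ^ 2 ≤ (s - t) ^ 2 / D ^ 2 := by
      intro s t
      rw [← div_pow]
      refine sq_le_sq.2 ((abs_clamp_sub_le 0 1 _ _).trans_eq ?_)
      rw [← sub_div, sub_sub_sub_cancel_right]
    calc _ ≤ latticeEnergy R logDist / D ^ 2 := by
          simp only [latticeEnergy, Finset.sum_div]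
          refine Finset.sum_le_sum fun x _ => Finset.sum_le_sum fun y _ => ?_
          rw [add_div]
          exact add_le_add (hstep _ _) (hstep _ _)
      _ ≤ _ := by
          gcongr
          exact latticeEnergy_logDist_le R

end Potential

/-! ### Comparison of the free particle with the random walk on the lattice -/

section Compare

variable {Λ : Finset Site}

/-- The site `x` is in the square of radius `R` around `a`. -/
def InBox (a : Site) (R : ℤ) (x : Site) : Prop :=
  a.1 - R ≤ x.1 ∧ x.1 ≤ a.1 + R ∧ a.2 - R ≤ x.2 ∧ x.2 ≤ a.2 + R

lemma nbr_iff {x y : Site} : nbr x y ↔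
    (y.1 = x.1 + 1 ∧ y.2 = x.2) ∨ (y.1 = x.1 - 1 ∧ y.2 = x.2) ∨
    (y.1 = x.1 ∧ y.2 = x.2 + 1) ∨ (y.1 = x.1 ∧ y.2 = x.2 - 1) := by
  unfold nbr
  rcases abs_cases (x.1 - y.1) with ⟨h1, h2⟩ | ⟨h1, h2⟩ <;>
  rcases abs_cases (x.2 - y.2) with ⟨h3, h4⟩ | ⟨h3, h4⟩ <;> rw [h1, h3] <;> omega

lemma exists_nbr_of_mem_innerBoundary {x : Site} (hx : x ∈ innerBoundary Λ) :
    x ∈ Λ ∧ ∃ y, nbr x y ∧ y ∉ Λ := by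
  classical
  simpa [innerBoundary] using hx

/-- The starting point of the lattice edge `(x, y, b)`, in coordinates centered at `a`. -/
def edgeSrc (a : Site) (e : ℤ × ℤ × Bool) : Site := (a.1 + e.1, a.2 + e.2.1)

/-- The end point of the lattice edge `(x, y, b)`; the edge is horizontal if `b = true`. -/
def edgeTgt (a : Site) (e : ℤ × ℤ × Bool) : Site :=
  if e.2.2 then (a.1 + e.1 + 1, a.2 + e.2.1) else (a.1 + e.1, a.2 + e.2.1 + 1)

lemma edge_eq {a : Site} {e e' : ℤ × ℤ × Bool} (h1 : edgeSrc a e = edgeSrc a e')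
    (h2 : edgeTgt a e = edgeTgt a e') : e = e' := by
  obtain ⟨x, y, b⟩ := e
  obtain ⟨x', y', b'⟩ := e'
  simp only [edgeSrc, edgeTgt, Prod.mk.injEq] at h1 h2
  rcases b with _ | _ <;> rcases b' with _ | _ <;> simp_all

lemma edge_ne {a : Site} {e e' : ℤ × ℤ × Bool} (h1 : edgeSrc a e = edgeTgt a e')
    (h2 : edgeTgt a e = edgeSrc a e') : False := by
  obtain ⟨x, y, b⟩ := e
  obtain ⟨x', y', b'⟩ := e'
  rcases b with _ | _ <;> rcases b' with _ | _ <;> simp [edgeSrc, edgeTgt, Prod.ext_iff] at h1 h2 <;>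
    omega

lemma nbr_edge (a : Site) (e : ℤ × ℤ × Bool) : nbr (edgeSrc a e) (edgeTgt a e) := by
  obtain ⟨x, y, b⟩ := e
  rcases b with _ | _ <;> simp [nbr_iff, edgeSrc, edgeTgt]

lemma exists_edge {a x y : Site} (h : nbr x y) : ∃ e : ℤ × ℤ × Bool,
    (edgeSrc a e = x ∧ edgeTgt a e = y) ∨ (edgeSrc a e = y ∧ edgeTgt a e = x) := by
  rw [nbr_iff] at h
  rcases h with h | h | h | h
  · exact ⟨(x.1 - a.1, x.2 - a.2, true), Or.inl (by simp [edgeSrc, edgeTgt, Prod.ext_iff]; omega)⟩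
  · exact ⟨(y.1 - a.1, y.2 - a.2, true), Or.inr (by simp [edgeSrc, edgeTgt, Prod.ext_iff]; omega)⟩
  · exact ⟨(x.1 - a.1, x.2 - a.2, false), Or.inl (by simp [edgeSrc, edgeTgt, Prod.ext_iff]; omega)⟩
  · exact ⟨(y.1 - a.1, y.2 - a.2, false), Or.inr (by simp [edgeSrc, edgeTgt, Prod.ext_iff]; omega)⟩

/-- The lattice edges in the square of radius `R`. -/
def boxEdges (R : ℕ) : Finset (ℤ × ℤ × Bool) :=
  Finset.Icc (-(R : ℤ)) R ×ˢ Finset.Icc (-(R : ℤ)) R ×ˢ Finset.univ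

lemma latticeEnergy_eq (a : Site) (R : ℕ) (φ : ℤ → ℤ → ℝ) :
    latticeEnergy R φ = ∑ e ∈ boxEdges R,
      (φ ((edgeTgt a e).1 - a.1) ((edgeTgt a e).2 - a.2) -
        φ ((edgeSrc a e).1 - a.1) ((edgeSrc a e).2 - a.2)) ^ 2 := by
  simp only [latticeEnergy, boxEdges, Finset.sum_product, Fintype.sum_bool]
  refine Finset.sum_congr rfl fun x _ => Finset.sum_congr rfl fun y _ => ?_
  simp [edgeSrc, edgeTgt, add_assoc]

open scoped Classical in
/-- A site as a vertex of the network of the free particle. -/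
def toVertex (Λ : Finset Site) (x : Site) : Option Λ := if h : x ∈ Λ then some ⟨x, h⟩ else none

lemma toVertex_of_mem {x : Site} (h : x ∈ Λ) : toVertex Λ x = some ⟨x, h⟩ := dif_pos h

lemma toVertex_of_notMem {x : Site} (h : x ∉ Λ) : toVertex Λ x = none := dif_neg h

lemma toVertex_inj {x y : Site} (h : x ∈ Λ) (he : toVertex Λ x = toVertex Λ y) : x = y := by
  rw [toVertex_of_mem h] at he
  by_cases hy : y ∈ Λ
  · rw [toVertex_of_mem hy] at he
    exact congrArg Subtype.val (Option.some.inj he)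
  · rw [toVertex_of_notMem hy] at he
    exact absurd he (by simp)

lemma two_mul_dirichlet {V : Type*} [Fintype V] (c : V → V → ℝ) (f : V → ℝ) :
    2 * dirichlet c f f = ∑ q : V × V, c q.1 q.2 * (f q.1 - f q.2) ^ 2 := by
  rw [dirichlet, mul_div_cancel₀ _ two_ne_zero, Fintype.sum_prod_type]
  exact Finset.sum_congr rfl fun x _ => Finset.sum_congr rfl fun y _ => by ring

/-- Each lattice edge with a non-vanishing gradient contributes to the energy in the network. -/
lemma latticeEnergy_le_dirichlet {c : Option Λ → Option Λ → ℝ} (h0 : ∀ o o', 0 ≤ c o o')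
    (hs : ∀ o o', c o o' = c o' o) (f : Option Λ → ℝ) (a : Site) (R : ℕ) (φ : ℤ → ℤ → ℝ)
    (hφ : ∀ x y : Site, nbr x y →
      φ (x.1 - a.1) (x.2 - a.2) ≠ φ (y.1 - a.1) (y.2 - a.2) → ∃ (hx : x ∈ Λ) (hy : y ∈ Λ),
        1 ≤ c (some ⟨x, hx⟩) (some ⟨y, hy⟩) ∧
        (φ (y.1 - a.1) (y.2 - a.2) - φ (x.1 - a.1) (x.2 - a.2)) ^ 2 ≤
          (f (some ⟨x, hx⟩) - f (some ⟨y, hy⟩)) ^ 2) :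
    latticeEnergy R φ ≤ dirichlet c f f := by
  classical
  rw [latticeEnergy_eq a]
  set w : ℤ × ℤ × Bool → ℝ := fun e => (φ ((edgeTgt a e).1 - a.1) ((edgeTgt a e).2 - a.2) -
        φ ((edgeSrc a e).1 - a.1) ((edgeSrc a e).2 - a.2)) ^ 2 with hw
  set T := (boxEdges R).filter fun e => w e ≠ 0 with hT
  set Z : Option Λ × Option Λ → ℝ := fun q => c q.1 q.2 * (f q.1 - f q.2) ^ 2 with hZ
  have hZ0 : ∀ q, 0 ≤ Z q := fun q => mul_nonneg (h0 _ _) (sq_nonneg _)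
  have hsum : ∑ e ∈ boxEdges R, w e = ∑ e ∈ T, w e := (Finset.sum_filter_ne_zero _).symm
  set m1 : ℤ × ℤ × Bool → Option Λ × Option Λ :=
    fun e => (toVertex Λ (edgeSrc a e), toVertex Λ (edgeTgt a e)) with hm1
  set m2 : ℤ × ℤ × Bool → Option Λ × Option Λ :=
    fun e => (toVertex Λ (edgeTgt a e), toVertex Λ (edgeSrc a e)) with hm2
  have hmem : ∀ e ∈ T, edgeSrc a e ∈ Λ ∧ edgeTgt a e ∈ Λ ∧ w e ≤ Z (m1 e) ∧ w e ≤ Z (m2 e) := by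
    intro e he
    have hne : w e ≠ 0 := (Finset.mem_filter.1 he).2
    obtain ⟨hx, hy, hc, hle⟩ := hφ _ _ (nbr_edge a e) fun h => hne (by simp only [hw, h]; ring)
    refine ⟨hx, hy, ?_, ?_⟩
    · simp only [hZ, hm1, toVertex_of_mem hx, toVertex_of_mem hy]
      exact hle.trans (le_mul_of_one_le_left (sq_nonneg _) hc)
    · simp only [hZ, hm2, toVertex_of_mem hx, toVertex_of_mem hy]
      rw [hs, ← neg_sub, neg_sq]
      exact hle.trans (le_mul_of_one_le_left (sq_nonneg _) hc)
  have hinj1 : Set.InjOn m1 T := fun e he e' _ h => by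
    simp only [hm1, Prod.mk.injEq] at h
    exact edge_eq (toVertex_inj (hmem e he).1 h.1) (toVertex_inj (hmem e he).2.1 h.2)
  have hinj2 : Set.InjOn m2 T := fun e he e' _ h => by
    simp only [hm2, Prod.mk.injEq] at h
    exact edge_eq (toVertex_inj (hmem e he).1 h.2) (toVertex_inj (hmem e he).2.1 h.1)
  have hdisj : Disjoint (T.image m1) (T.image m2) := by
    rw [Finset.disjoint_left]
    intro q h1 h2
    obtain ⟨e, he, rfl⟩ := Finset.mem_image.1 h1
    obtain ⟨e', he', h⟩ := Finset.mem_image.1 h2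
    simp only [hm1, hm2, Prod.mk.injEq] at h
    exact edge_ne (toVertex_inj (hmem e he).1 h.1.symm) (toVertex_inj (hmem e he).2.1 h.2.symm)
  have h2 : 2 * ∑ e ∈ T, w e ≤ 2 * dirichlet c f f := by
    rw [two_mul_dirichlet]
    calc 2 * ∑ e ∈ T, w e = ∑ e ∈ T, w e + ∑ e ∈ T, w e := two_mul _
      _ ≤ ∑ e ∈ T, Z (m1 e) + ∑ e ∈ T, Z (m2 e) :=
        add_le_add (Finset.sum_le_sum fun e he => (hmem e he).2.2.1)
          (Finset.sum_le_sum fun e he => (hmem e he).2.2.2)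
      _ = ∑ q ∈ T.image m1 ∪ T.image m2, Z q := by
        rw [Finset.sum_union hdisj, Finset.sum_image hinj1, Finset.sum_image hinj2]
      _ ≤ ∑ q, Z q :=
        Finset.sum_le_sum_of_subset_of_nonneg (Finset.subset_univ _) fun q _ _ => hZ0 q
  rw [hsum]
  linarith

/-- A function that is one outside of a square inside the box has at most its lattice energy. -/
lemma dirichlet_walkCond_le {φ : ℤ → ℤ → ℝ} {R : ℕ} {a : Site} {g : Option Λ → ℝ}
    (hg1 : g none = 1) (hg : ∀ x : Λ, g (some x) = φ ((x : Site).1 - a.1) ((x : Site).2 - a.2))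
    (hφ : ∀ x y : ℤ, (R : ℤ) ≤ |x| ∨ (R : ℤ) ≤ |y| → φ x y = 1)
    (hbox : ∀ x, InBox a R x → x ∈ Λ) :
    dirichlet (walkCond Λ) g g ≤ latticeEnergy R φ := by
  classical
  rw [latticeEnergy_eq a]
  set w : ℤ × ℤ × Bool → ℝ := fun e => (φ ((edgeTgt a e).1 - a.1) ((edgeTgt a e).2 - a.2) -
        φ ((edgeSrc a e).1 - a.1) ((edgeSrc a e).2 - a.2)) ^ 2 with hw
  set Z : Option Λ × Option Λ → ℝ := fun q => walkCond Λ q.1 q.2 * (g q.1 - g q.2) ^ 2 with hZ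
  have hZ0 : ∀ q, 0 ≤ Z q := fun q => mul_nonneg (walkCond_nonneg _ _) (sq_nonneg _)
  set T := (boxEdges R).filter fun e => edgeSrc a e ∈ Λ ∧ edgeTgt a e ∈ Λ with hT
  set m1 : ℤ × ℤ × Bool → Option Λ × Option Λ :=
    fun e => (toVertex Λ (edgeSrc a e), toVertex Λ (edgeTgt a e)) with hm1
  set m2 : ℤ × ℤ × Bool → Option Λ × Option Λ :=
    fun e => (toVertex Λ (edgeTgt a e), toVertex Λ (edgeSrc a e)) with hm2
  have hout : ∀ x : Site, ¬ InBox a (R - 1) x → φ (x.1 - a.1) (x.2 - a.2) = 1 := by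
    intro x hx
    refine hφ _ _ ?_
    unfold InBox at hx
    rcases abs_cases (x.1 - a.1) with ⟨h1, h2⟩ | ⟨h1, h2⟩ <;>
    rcases abs_cases (x.2 - a.2) with ⟨h3, h4⟩ | ⟨h3, h4⟩ <;> rw [h1, h3] <;> omega
  have hbd : ∀ x : Λ, (x : Site) ∈ innerBoundary Λ → g (some x) = 1 := by
    intro x hx
    obtain ⟨-, y, hxy, hy⟩ := exists_nbr_of_mem_innerBoundary hx
    rw [hg]
    refine hout x fun hin => hy (hbox y ?_)
    rw [nbr_iff] at hxy
    unfold InBox at hin ⊢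
    omega
  have hcover : ∀ q, Z q ≠ 0 → q ∈ T.image m1 ∪ T.image m2 := by
    rintro ⟨o, o'⟩ hq
    have hw : walkCond Λ o o' ≠ 0 := fun h => hq (by simp only [hZ, h, zero_mul])
    have hgne : g o ≠ g o' := fun h => hq (by simp only [hZ, h, sub_self]; ring)
    rcases o with _ | x <;> rcases o' with _ | y
    · exact absurd rfl hgne
    · have hy : (y : Site) ∈ innerBoundary Λ := by
        by_contra hy
        exact hw (if_neg hy)
      exact absurd (hg1.trans (hbd y hy).symm) hgne
    · have hx : (x : Site) ∈ innerBoundary Λ := by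
        by_contra hx
        exact hw (if_neg hx)
      exact absurd ((hbd x hx).trans hg1.symm) hgne
    · have hxy : nbr (x : Site) y := by
        by_contra hxy
        exact hw (if_neg hxy)
      obtain ⟨e, he⟩ := exists_edge (a := a) hxy
      have hbox' : InBox a (R - 1) x ∨ InBox a (R - 1) y := by
        by_contra! hc
        exact hgne (by rw [hg, hg, hout _ hc.1, hout _ hc.2])
      have heT : e ∈ T := by
        refine Finset.mem_filter.2 ⟨?_, ?_⟩
        · have hsrc : InBox a R (edgeSrc a e) := by
            rw [nbr_iff] at hxy
            unfold InBox at hbox' ⊢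
            rcases he with ⟨h1, -⟩ | ⟨h1, -⟩ <;> rw [h1] <;> omega
          simp only [InBox, edgeSrc] at hsrc
          simp only [boxEdges, Finset.mem_product, Finset.mem_Icc, Finset.mem_univ, and_true]
          omega
        · rcases he with ⟨h1, h2⟩ | ⟨h1, h2⟩ <;> rw [h1, h2]
          · exact ⟨x.2, y.2⟩
          · exact ⟨y.2, x.2⟩
      rw [Finset.mem_union, Finset.mem_image, Finset.mem_image]
      rcases he with ⟨h1, h2⟩ | ⟨h1, h2⟩
      · exact Or.inl ⟨e, heT, by simp only [hm1, h1, h2, toVertex_of_mem x.2, toVertex_of_mem y.2]⟩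
      · exact Or.inr ⟨e, heT, by simp only [hm2, h1, h2, toVertex_of_mem x.2, toVertex_of_mem y.2]⟩
  have hmem : ∀ e ∈ T, edgeSrc a e ∈ Λ ∧ edgeTgt a e ∈ Λ ∧ Z (m1 e) ≤ w e ∧ Z (m2 e) ≤ w e := by
    intro e he
    obtain ⟨hx, hy⟩ := (Finset.mem_filter.1 he).2
    have hle : ∀ o o', walkCond Λ o o' ≤ 1 := fun o o' => by
      rcases walkCond_eq o o' with h | h <;> rw [h]
      exact zero_le_one
    refine ⟨hx, hy, ?_, ?_⟩
    · simp only [hZ, hm1, toVertex_of_mem hx, toVertex_of_mem hy, hg, hw]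
      refine (mul_le_of_le_one_left (sq_nonneg _) (hle _ _)).trans_eq (by ring)
    · simp only [hZ, hm2, toVertex_of_mem hx, toVertex_of_mem hy, hg, hw]
      exact mul_le_of_le_one_left (sq_nonneg _) (hle _ _)
  have hinj1 : Set.InjOn m1 T := fun e he e' _ h => by
    simp only [hm1, Prod.mk.injEq] at h
    exact edge_eq (toVertex_inj (hmem e he).1 h.1) (toVertex_inj (hmem e he).2.1 h.2)
  have hinj2 : Set.InjOn m2 T := fun e he e' _ h => by
    simp only [hm2, Prod.mk.injEq] at h
    exact edge_eq (toVertex_inj (hmem e he).1 h.2) (toVertex_inj (hmem e he).2.1 h.1)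
  have h2 : 2 * dirichlet (walkCond Λ) g g ≤ 2 * ∑ e ∈ boxEdges R, w e := by
    rw [two_mul_dirichlet]
    calc ∑ q, Z q = ∑ q ∈ T.image m1 ∪ T.image m2, Z q := by
          refine (Finset.sum_subset (Finset.subset_univ _) fun q _ hq => ?_).symm
          by_contra h
          exact hq (hcover q h)
      _ ≤ ∑ q ∈ T.image m1, Z q + ∑ q ∈ T.image m2, Z q := by
          rw [← Finset.sum_union_inter]
          exact le_add_of_nonneg_right (Finset.sum_nonneg fun q _ => hZ0 q)
      _ = ∑ e ∈ T, Z (m1 e) + ∑ e ∈ T, Z (m2 e) := by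
          rw [Finset.sum_image hinj1, Finset.sum_image hinj2]
      _ ≤ ∑ e ∈ T, w e + ∑ e ∈ T, w e :=
          add_le_add (Finset.sum_le_sum fun e he => (hmem e he).2.2.1)
            (Finset.sum_le_sum fun e he => (hmem e he).2.2.2)
      _ ≤ 2 * ∑ e ∈ boxEdges R, w e := by
          rw [← two_mul]
          refine mul_le_mul_of_nonneg_left (Finset.sum_le_sum_of_subset_of_nonneg
            (Finset.filter_subset _ _) fun e _ _ => sq_nonneg _) zero_le_two
  linarith

end Compare

/-! ### The capacity between a droplet and the boundary of the box, from below -/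

section Below

/-- Along a chain inside a finite set, a function with increments at most `t` varies by at most `t`
times the size of the set. -/
lemma abs_sub_le_card_mul {V : Type*} {r : V → V → Prop} (S : Finset V) {f : V → ℝ} {t : ℝ}
    (ht : 0 ≤ t) (hr : ∀ a b, r a b → a ∈ S → b ∈ S → |f a - f b| ≤ t) {x y : V}
    (h : Relation.ReflTransGen (fun a b => r a b ∧ a ∈ S ∧ b ∈ S) x y) :
    |f x - f y| ≤ S.card * t := by
  classical
  set G : SimpleGraph V := SimpleGraph.fromRel fun a b => r a b ∧ a ∈ S ∧ b ∈ S with hG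
  rcases eq_or_ne x y with rfl | hxy
  · simpa using mul_nonneg (Nat.cast_nonneg _) ht
  have hadj : ∀ a b, G.Adj a b → a ∈ S ∧ b ∈ S ∧ |f a - f b| ≤ t := by
    intro a b hab
    rw [hG, SimpleGraph.fromRel_adj] at hab
    rcases hab.2 with h1 | h1
    · exact ⟨h1.2.1, h1.2.2, hr a b h1.1 h1.2.1 h1.2.2⟩
    · exact ⟨h1.2.2, h1.2.1, by rw [abs_sub_comm]; exact hr b a h1.1 h1.2.1 h1.2.2⟩
  have hreach : G.Reachable x y := by
    clear hxy
    induction h with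
    | refl => exact SimpleGraph.Reachable.refl _
    | @tail b c _ hbc ih =>
      rcases eq_or_ne b c with rfl | hne
      · exact ih
      · refine ih.trans (SimpleGraph.Adj.reachable ?_)
        rw [hG, SimpleGraph.fromRel_adj]
        exact ⟨hne, Or.inl hbc⟩
  obtain ⟨w, hw⟩ := hreach.exists_isPath
  have hlen : ∀ {u v : V} (w : G.Walk u v), |f u - f v| ≤ w.length * t := by
    intro u v w
    induction w with
    | nil => simp
    | @cons u v z huv w ih =>
      have := abs_sub_le (f u) (f v) (f z)
      have h2 := (hadj u v huv).2.2
      rw [SimpleGraph.Walk.length_cons]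
      push_cast
      linarith
  have hsupp : ∀ {u v : V} (w : G.Walk u v), u ∈ S → ∀ z ∈ w.support, z ∈ S := by
    intro u v w
    induction w with
    | nil =>
      intro hu q hq
      rw [SimpleGraph.Walk.support_nil, List.mem_singleton] at hq
      rwa [hq]
    | @cons u v z huv w ih =>
      intro hu q hq
      rw [SimpleGraph.Walk.support_cons, List.mem_cons] at hq
      rcases hq with rfl | hq
      · exact hu
      · exact ih (hadj _ _ huv).2.1 q hq
  have hxS : x ∈ S := by
    rcases h.cases_head with h1 | ⟨c, h1, -⟩
    · exact absurd h1 hxy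
    · exact h1.2.1
  have hcard : w.length ≤ S.card := by
    have h1 : w.support.toFinset ⊆ S := fun z hz => hsupp w hxS z (List.mem_toFinset.1 hz)
    have h2 := Finset.card_le_card h1
    rw [List.toFinset_card_of_nodup hw.support_nodup, SimpleGraph.Walk.length_support] at h2
    omega
  calc |f x - f y| ≤ w.length * t := hlen w
    _ ≤ S.card * t := by gcongr

lemma chain_symm {S : Finset Site} {x y : Site}
    (h : Relation.ReflTransGen (fun a b => nbr a b ∧ a ∈ S ∧ b ∈ S) x y) :
    Relation.ReflTransGen (fun a b => nbr a b ∧ a ∈ S ∧ b ∈ S) y x := by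
  induction h with
  | refl => exact Relation.ReflTransGen.refl
  | tail _ hbc ih => exact Relation.ReflTransGen.head ⟨nbr_symm hbc.1, hbc.2.2, hbc.2.1⟩ ih

/-- A line segment of lattice sites is connected. -/
lemma segment_connected {S : Finset Site} {d : Site} (hd : ∀ x : Site, nbr x (x + d)) (k : ℕ) (x : Site)
    (h : ∀ i : ℕ, i ≤ k → x + (i : ℤ) • d ∈ S) :
    Relation.ReflTransGen (fun a b => nbr a b ∧ a ∈ S ∧ b ∈ S) x (x + (k : ℤ) • d) := by
  induction k with
  | zero => simpa using Relation.ReflTransGen.refl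
  | succ k ih =>
    refine (ih fun i hi => h i (by omega)).tail ⟨?_, h k (by omega), h (k + 1) le_rfl⟩
    have := hd (x + (k : ℤ) • d)
    rwa [add_assoc, show (k : ℤ) • d + d = ((k + 1 : ℕ) : ℤ) • d by
      push_cast; rw [add_smul, one_smul]] at this

lemma segment_right {S : Finset Site} (x z y : ℤ) (hxz : x ≤ z)
    (h : ∀ i, x ≤ i → i ≤ z → ((i, y) : Site) ∈ S) :
    Relation.ReflTransGen (fun a b => nbr a b ∧ a ∈ S ∧ b ∈ S) (x, y) (z, y) := by
  have := segment_connected (S := S) (d := (1, 0)) (fun x => by simp [nbr_iff]) (z - x).toNat (x, y)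
    fun i hi => by
      have := h (x + i) (by omega) (by omega)
      simpa using this
  simpa [Int.toNat_of_nonneg (sub_nonneg.2 hxz)] using this

lemma segment_up {S : Finset Site} (x z y : ℤ) (hxz : x ≤ z)
    (h : ∀ i, x ≤ i → i ≤ z → ((y, i) : Site) ∈ S) :
    Relation.ReflTransGen (fun a b => nbr a b ∧ a ∈ S ∧ b ∈ S) (y, x) (y, z) := by
  have := segment_connected (S := S) (d := (0, 1)) (fun x => by simp [nbr_iff]) (z - x).toNat (y, x)
    fun i hi => by
      have := h (x + i) (by omega) (by omega)
      simpa using this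
  simpa [Int.toNat_of_nonneg (sub_nonneg.2 hxz)] using this

/-- The boundary of a square is connected. -/
lemma ring_connected {S : Finset Site} {a : Site} {M : ℤ} 
    (hS : ∀ x, InBox a M x → ¬ InBox a (M - 1) x → x ∈ S) {x : Site} (hx : InBox a M x)
    (hx' : ¬ InBox a (M - 1) x) :
    Relation.ReflTransGen (fun a b => nbr a b ∧ a ∈ S ∧ b ∈ S) x (a.1 + M, a.2 + M) := by
  have htop : ∀ z, a.1 - M ≤ z → z ≤ a.1 + M →
      Relation.ReflTransGen (fun a b => nbr a b ∧ a ∈ S ∧ b ∈ S) (z, a.2 + M)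
        (a.1 + M, a.2 + M) := fun z h1 h2 =>
    segment_right _ _ _ h2 fun i h3 h4 => hS _ (by simp only [InBox]; omega)
      (by simp only [InBox]; omega)
  have hright : ∀ z, a.2 - M ≤ z → z ≤ a.2 + M →
      Relation.ReflTransGen (fun a b => nbr a b ∧ a ∈ S ∧ b ∈ S) (a.1 + M, z)
        (a.1 + M, a.2 + M) := fun z h1 h2 =>
    segment_up _ _ _ h2 fun i h3 h4 => hS _ (by simp only [InBox]; omega)
      (by simp only [InBox]; omega)
  obtain ⟨u, v⟩ := x
  simp only [InBox] at hx hx'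
  have hcases : v = a.2 + M ∨ u = a.1 + M ∨ u = a.1 - M ∨ v = a.2 - M := by omega
  rcases hcases with rfl | rfl | rfl | rfl
  · exact htop u (by omega) (by omega)
  · exact hright v (by omega) (by omega)
  · exact (segment_up _ _ _ (by omega : v ≤ a.2 + M) fun i h3 h4 =>
      hS _ (by simp only [InBox]; omega) (by simp only [InBox]; omega)).trans
        (htop _ (by omega) (by omega))
  · exact (segment_right _ _ _ (by omega : u ≤ a.1 + M) fun i h3 h4 =>
      hS _ (by simp only [InBox]; omega) (by simp only [InBox]; omega)).trans
        (hright _ (by omega) (by omega))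

variable {Λ : Finset Site} {p : Params} {F : Set (Config Λ)} {L : ℕ}

lemma freeAt_of_not_inBox {ξ : Config Λ} {a : Site} (hξ : ∀ x : Λ, ξ x ≠ 0 → InBox a L x) {x : Λ}
    (hx : ¬ InBox a (L + 1) x) : FreeAt ξ x := by
  have h0 : ∀ y : Λ, InBox a L y → ¬ InBox a L x := fun y _ h => hx (by unfold InBox at h ⊢; omega)
  refine ⟨?_, fun y hy => ?_⟩
  · by_contra hne
    exact h0 x (hξ x hne) (hξ x hne)
  · obtain ⟨h1, h2⟩ := eq_one_of_activeBond hy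
    have h3 := hξ y (by rw [h1]; decide)
    rw [nbr_iff] at h2
    unfold InBox at hx h3
    omega

/-- The values of the equilibrium potential close to a droplet and at the boundary of the box: the
potential is small on a square around the droplet, since the free particle can reach the droplet from
there, and almost one at the boundary. -/
lemma H3.potential_bounds (hp : p.Metastable) (h : H1 p F) (h3 : H3 p F L) {ξ : Config Λ}
    (hξ : ξ ∈ proto p F) {f : Config Λ → ℝ} (hf : f ∈ admissible p F) {a : Site}
    (hdrop : ∀ x : Λ, ξ x ≠ 0 → InBox a L x) (hbox : ∀ x, InBox a (L + 3) x → x ∈ Λ) {t : ℝ}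
    (ht : 0 ≤ t) (hedge : ∀ o o', freeCond p (gammaStar p F) ξ o o' = 1 →
      |f (insertTwo ξ o) - f (insertTwo ξ o')| ≤ t) :
    (∀ x : Λ, (x : Site) ∈ innerBoundary Λ → 1 - t ≤ f (insertTwo ξ (some x))) ∧
    ∀ x : Λ, InBox a (L + 3) x → ¬ InBox a (L + 2) x →
      f (insertTwo ξ (some x)) ≤ ((2 * (L + 3) + 1) ^ 2 + 1) * t := by
  classical
  set Γ := gammaStar p F with hΓ
  have hopen : ∀ x : Λ, FreeAt ξ x → IsOpenSite p Γ ξ (some x) := fun x hx =>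
    ⟨hx.1, (h3.energy_critical hξ hx).le⟩
  have hflat : ∀ {b c : Config Λ}, LinkedIn (fun ζ => energy p ζ < Γ) b c → f b = f c := by
    intro b c hbc
    induction hbc with
    | refl => rfl
    | tail _ hcd ih => exact ih.trans (hf.2 _ _ hcd.1 (max_lt hcd.2.1 hcd.2.2))
  constructor
  · intro x hx
    have hx0 : ξ x = 0 := by
      by_contra hne
      exact h3.notMem_innerBoundary hξ hne hx
    have hfree := freeAt_of_innerBoundary hx hx0
    have h1 := hedge none (some x) (by
      rw [freeCond, if_pos (Or.inr ⟨trivial, hfree⟩)]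
      exact if_pos hx)
    have h2 : f (insertTwo ξ none) = 1 := by
      rw [← hf.1.2.1]
      exact (hflat (h3.linkedIn_proto hp h hξ)).symm
    rw [h2] at h1
    linarith [(abs_le.1 h1).2]
  intro v hv hv'
  obtain ⟨ζ, ⟨x, z, ⟨y, hy, hyfree, hpath⟩, hxz, hz0, ⟨u, hu⟩, rfl⟩, hgood⟩ := h3.good ξ hξ
  obtain ⟨hzE, b, hb, hlink⟩ := exists_linkedIn_of_commHeightSet_lt h.nonempty hgood
  have hfz : f (insertTwo ξ (some z)) = 0 := by
    rw [← hf.1.2.2 b hb]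
    exact hflat hlink
  obtain ⟨hu1, hzu⟩ := eq_one_of_activeBond hu
  have huin := hdrop u (by rw [hu1]; decide)
  have hxin : InBox a (L + 2) x := by
    rw [nbr_iff] at hxz hzu
    unfold InBox at huin ⊢
    omega
  have hxfree : FreeAt ξ x := by
    rcases hpath.cases_tail with h1 | ⟨c, -, h1⟩
    · rw [h1]; exact hyfree
    · exact h1.2
  have hxz' : |f (insertTwo ξ (some x)) - f (insertTwo ξ (some z))| ≤ t := hedge _ _ (by
    rw [freeCond, if_pos (Or.inl ⟨hxfree, ⟨hz0, hzE.le⟩⟩)]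
    exact if_pos hxz)
  -- the free sites of the square, on which the free particle moves
  set B : Finset Site := Finset.Icc (a.1 - (L + 3)) (a.1 + (L + 3)) ×ˢ
    Finset.Icc (a.2 - (L + 3)) (a.2 + (L + 3)) with hB
  have hmemB : ∀ x, x ∈ B ↔ InBox a (L + 3) x := fun x => by
    simp only [hB, Finset.mem_product, Finset.mem_Icc, InBox]
    tauto
  set S : Finset Site := B.filter fun x => ∃ hx : x ∈ Λ, FreeAt ξ ⟨x, hx⟩ with hS
  have hmemS : ∀ x : Λ, InBox a (L + 3) x → FreeAt ξ x → (x : Site) ∈ S := fun x h1 h2 =>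
    Finset.mem_filter.2 ⟨(hmemB _).2 h1, x.2, h2⟩
  set φ : Site → ℝ := fun x => f (insertTwo ξ (toVertex Λ x)) with hφ
  have hcardS : (S.card : ℝ) ≤ (2 * (L + 3) + 1) ^ 2 := by
    have h1 : S.card ≤ (2 * (L + 3) + 1) ^ 2 := by
      refine (Finset.card_le_card (Finset.filter_subset _ _)).trans_eq ?_
      rw [hB, Finset.card_product, Int.card_Icc, Int.card_Icc, sq]
      congr 1 <;> omega
    exact_mod_cast h1
  have hring : ∀ x, InBox a (L + 3) x → ¬ InBox a (L + 3 - 1) x → x ∈ S := by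
    intro x h1 h2
    refine hmemS ⟨x, hbox x h1⟩ h1 (freeAt_of_not_inBox hdrop fun h4 => h2 ?_)
    simp only [InBox] at h4 ⊢
    omega
  have hchain : InBox a (L + 2) x → ∃ w, InBox a (L + 3) w ∧ ¬ InBox a (L + 3 - 1) w ∧
      Relation.ReflTransGen (fun a b => nbr a b ∧ a ∈ S ∧ b ∈ S) w (x : Site) := by
    clear hxz' hxfree hxin hxz
    induction hpath with
    | refl =>
      intro hin
      obtain ⟨-, q, hq, hqΛ⟩ := exists_nbr_of_mem_innerBoundary hy
      refine absurd (hbox q ?_) hqΛ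
      rw [nbr_iff] at hq
      unfold InBox at hin ⊢
      omega
    | @tail b c hyb hbc ih =>
      intro hin
      have hbfree : FreeAt ξ b := by
        rcases hyb.cases_tail with h1 | ⟨d, -, h1⟩
        · rw [h1]; exact hyfree
        · exact h1.2
      have hbin : InBox a (L + 3) b := by
        have := hbc.1
        rw [nbr_iff] at this
        unfold InBox at hin ⊢
        omega
      have hcin : InBox a (L + 3) c := by
        unfold InBox at hin ⊢
        omega
      have hstep : nbr (b : Site) c ∧ (b : Site) ∈ S ∧ (c : Site) ∈ S :=
        ⟨hbc.1, hmemS b hbin hbfree, hmemS c hcin hbc.2⟩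
      by_cases hb2 : InBox a (L + 2) b
      · obtain ⟨w, h1, h2, h4⟩ := ih hb2
        exact ⟨w, h1, h2, h4.tail hstep⟩
      · refine ⟨b, hbin, fun h4 => hb2 ?_, Relation.ReflTransGen.single hstep⟩
        unfold InBox at h4 ⊢
        omega
  obtain ⟨w, hw1, hw2, hwx⟩ := hchain hxin
  have hvc := ring_connected (S := S) hring hv (x := v) (fun h4 => hv' (by
    unfold InBox at h4 ⊢
    omega))
  have hwc := ring_connected (S := S) hring hw1 hw2
  have hvx := (hvc.trans (chain_symm hwc)).trans hwx
  have hvar := abs_sub_le_card_mul (r := nbr) S (f := φ) ht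
    (fun b c hn hb hc => by
      obtain ⟨-, hbΛ, hbf⟩ := Finset.mem_filter.1 hb
      obtain ⟨-, hcΛ, hcf⟩ := Finset.mem_filter.1 hc
      simp only [hφ, toVertex_of_mem hbΛ, toVertex_of_mem hcΛ]
      refine hedge _ _ ?_
      rw [freeCond, if_pos (Or.inl ⟨hbf, hopen _ hcf⟩)]
      exact if_pos hn)
    hvx
  simp only [hφ, toVertex_of_mem v.2, toVertex_of_mem x.2] at hvar
  have h1 := (abs_le.1 hvar).2
  have h2 := (abs_le.1 hxz').2
  rw [hfz, sub_zero] at h2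
  have h4 : (S.card : ℝ) * t ≤ (2 * (L + 3) + 1) ^ 2 * t := by gcongr
  linarith

/-- The flow from the droplet to infinity, tested on the equilibrium potential. -/
theorem H3.flow_bound (hp : p.Metastable) (h : H1 p F) (h3 : H3 p F L) {ξ : Config Λ}
    (hξ : ξ ∈ proto p F) {f : Config Λ → ℝ} (hf : f ∈ admissible p F) {a : Site}
    (hdrop : ∀ x : Λ, ξ x ≠ 0 → InBox a L x) (hbox : ∀ x, InBox a (L + 4) x → x ∈ Λ) {R : ℕ}
    (hR : ∀ x ∈ Λ, InBox a (R - 1) x) {E : ℝ}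
    (hE : E = dirichlet (freeCond p (gammaStar p F) ξ)
      (fun o => f (insertTwo ξ o)) (fun o => f (insertTwo ξ o)))
    (hs : ((2 * (L + 3) + 1) ^ 2 + 1) * √E ≤ 1 - √E) :
    (2 * Real.pi * (1 - √E - ((2 * (L + 3) + 1) ^ 2 + 1) * √E)) ^ 2 ≤
      (2 * Real.pi * Real.log R + 120) * E := by
  classical
  set Γ := gammaStar p F with hΓ
  set t := √E with ht
  set s : ℝ := ((2 * (L + 3) + 1) ^ 2 + 1) * t with hs'
  have hE0 : 0 ≤ E := hE ▸ dirichlet_self_nonneg (freeCond_nonneg Γ ξ) _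
  have hedge : ∀ o o', freeCond p Γ ξ o o' = 1 →
      |f (insertTwo ξ o) - f (insertTwo ξ o')| ≤ t := by
    intro o o' ho
    have h1 := edge_le_dirichlet (freeCond_nonneg (p := p) Γ ξ) (freeCond_comm Γ ξ)
      (fun o => f (insertTwo ξ o)) o o'
    rw [ho, one_mul, ← hE] at h1
    exact Real.abs_le_sqrt h1
  obtain ⟨hbd, hring⟩ := h3.potential_bounds hp h hξ hf hdrop
    (fun x hx => hbox x (by unfold InBox at hx ⊢; omega)) (Real.sqrt_nonneg E) hedge
  set Φ : Site → ℝ := fun x => if InBox a (L + 2) x then s else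
    if x ∈ Λ then max s (min (1 - t) (f (insertTwo ξ (toVertex Λ x)))) else 1 - t with hΦ
  have hΦring : ∀ x, InBox a (L + 3) x → Φ x = s := by
    intro x hx
    by_cases hx2 : InBox a (L + 2) x
    · exact if_pos hx2
    · have hxΛ : x ∈ Λ := hbox x (by unfold InBox at hx ⊢; omega)
      simp only [hΦ, if_neg hx2, if_pos hxΛ, toVertex_of_mem hxΛ]
      exact max_eq_left ((min_le_right _ _).trans (hring ⟨x, hxΛ⟩ hx hx2))
  have hΦout : ∀ x ∉ Λ, Φ x = 1 - t := by
    intro x hx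
    have hx2 : ¬ InBox a (L + 2) x := fun h4 => hx (hbox x (by unfold InBox at h4 ⊢; omega))
    simp only [hΦ, if_neg hx2, if_neg hx]
  have hΦbd : ∀ x ∈ innerBoundary Λ, Φ x = 1 - t := by
    intro x hx
    obtain ⟨hxΛ, y, hxy, hy⟩ := hx
    have hx2 : ¬ InBox a (L + 2) x := fun h4 => hy (hbox y (by
      rw [nbr_iff] at hxy
      unfold InBox at h4 ⊢
      omega))
    simp only [hΦ, if_neg hx2, if_pos hxΛ, toVertex_of_mem hxΛ]
    rw [min_eq_left (hbd ⟨x, hxΛ⟩ ⟨hxΛ, y, hxy, hy⟩), max_eq_right hs]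
  have hout : ∀ x y, nbr x y → x ∉ Λ → Φ x = Φ y := by
    intro x y hxy hx
    rw [hΦout x hx]
    by_cases hy : y ∈ Λ
    · exact (hΦbd y ⟨hy, x, nbr_symm hxy, hx⟩).symm
    · exact (hΦout y hy).symm
  have hin : ∀ x y, nbr x y → InBox a (L + 2) x → Φ x = Φ y := by
    intro x y hxy hx
    rw [hΦring x (by unfold InBox at hx ⊢; omega), hΦring y]
    rw [nbr_iff] at hxy
    unfold InBox at hx ⊢
    omega
  have hfar : ∀ x (hx : x ∈ Λ), ¬ InBox a (L + 2) x → FreeAt ξ ⟨x, hx⟩ := fun x hx hx2 =>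
    freeAt_of_not_inBox hdrop fun h4 => hx2 (by simp only [InBox] at h4 ⊢; omega)
  set φ : ℤ → ℤ → ℝ := fun i j => Φ (a.1 + i, a.2 + j) - (1 - t) with hφ
  have hφΦ : ∀ x : Site, φ (x.1 - a.1) (x.2 - a.2) = Φ x - (1 - t) := fun x => by
    simp [hφ]
  have henergy : latticeEnergy R φ ≤ E := by
    rw [hE]
    refine latticeEnergy_le_dirichlet (freeCond_nonneg Γ ξ) (freeCond_comm Γ ξ) _ a R φ
      fun x y hxy hne => ?_
    rw [hφΦ, hφΦ] at hne ⊢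
    have hne' : Φ x ≠ Φ y := fun h4 => hne (by rw [h4])
    have hx : x ∈ Λ := by
      by_contra hx
      exact hne' (hout x y hxy hx)
    have hy : y ∈ Λ := by
      by_contra hy
      exact hne' (hout y x (nbr_symm hxy) hy).symm
    have hx2 : ¬ InBox a (L + 2) x := fun h4 => hne' (hin x y hxy h4)
    have hy2 : ¬ InBox a (L + 2) y := fun h4 => hne' (hin y x (nbr_symm hxy) h4).symm
    refine ⟨hx, hy, le_of_eq ?_, ?_⟩
    · have hyfree := hfar y hy hy2
      rw [freeCond, if_pos (Or.inl ⟨hfar x hx hx2, hyfree.1, (h3.energy_critical hξ hyfree).le⟩)]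
      exact (if_pos hxy).symm
    · simp only [hΦ, if_neg hx2, if_neg hy2, if_pos hx, if_pos hy, toVertex_of_mem hx,
        toVertex_of_mem hy, sub_sub_sub_cancel_right]
      refine sq_le_sq.2 ((abs_clamp_sub_le s (1 - t) _ _).trans_eq (abs_sub_comm _ _))
  have hφ0 : φ 0 0 = s - (1 - t) := by
    simp only [hφ, add_zero]
    rw [hΦring]
    unfold InBox
    omega
  have hflow := sq_le_mul_latticeEnergy (R := R) (φ := φ) fun x y hxy => by
    simp only [hφ]
    rw [hΦout, sub_self]
    intro hmem
    have h4 := hR _ hmem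
    unfold InBox at h4
    rcases hxy with h5 | h5
    · rcases abs_cases x with ⟨h6, h7⟩ | ⟨h6, h7⟩ <;> rw [h6] at h5 <;> simp only at h4 <;> omega
    · rcases abs_cases y with ⟨h6, h7⟩ | ⟨h6, h7⟩ <;> rw [h6] at h5 <;> simp only at h4 <;> omega
  rw [hφ0] at hflow
  have hlog : 0 ≤ 2 * Real.pi * Real.log R + 120 := by
    have := Real.log_natCast_nonneg R
    have := Real.pi_pos
    positivity
  calc (2 * Real.pi * (1 - t - s)) ^ 2 = (2 * Real.pi * (s - (1 - t))) ^ 2 := by ring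
    _ ≤ (2 * Real.pi * Real.log R + 120) * latticeEnergy R φ := hflow
    _ ≤ _ := mul_le_mul_of_nonneg_left henergy hlog

lemma tendsto_log_natCast : Tendsto (fun R : ℕ => Real.log R) atTop atTop :=
  Real.tendsto_log_atTop.comp tendsto_natCast_atTop_atTop

/-- The energy forced by the flow bound. -/
lemma eventually_le_of_flow_bound {C δ : ℝ} (hC : 0 ≤ C) (hδ : 0 < δ) :
    ∀ᶠ R : ℕ in atTop, ∀ E : ℝ, 0 ≤ E → (C * √E ≤ 1 - √E →
      (2 * Real.pi * (1 - √E - C * √E)) ^ 2 ≤ (2 * Real.pi * Real.log R + 120) * E) →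
      (1 - δ) * (2 * Real.pi / Real.log R) ≤ E := by
  have hpi := Real.pi_pos
  have h1 : Tendsto (fun l : ℝ => (C + 1) * √(2 * Real.pi / l)) atTop (𝓝 0) := by
    have h2 : Tendsto (fun l : ℝ => 2 * Real.pi / l) atTop (𝓝 0) :=
      tendsto_const_nhds.div_atTop tendsto_id
    simpa using (h2.sqrt).const_mul (C + 1)
  have h2 : Tendsto (fun l : ℝ => 1 + 120 / (2 * Real.pi * l)) atTop (𝓝 1) := by
    have h3 : Tendsto (fun l : ℝ => 120 / (2 * Real.pi * l)) atTop (𝓝 0) :=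
      tendsto_const_nhds.div_atTop (tendsto_id.const_mul_atTop (by positivity))
    simpa using h3.const_add 1
  have h3 : Tendsto (fun l : ℝ => (1 - (C + 1) * √(2 * Real.pi / l)) ^ 2 -
      (1 - δ) * (1 + 120 / (2 * Real.pi * l))) atTop (𝓝 δ) := by
    have := ((h1.const_sub 1).pow 2).sub (h2.const_mul (1 - δ))
    simpa using this
  have h4 := ((h1.eventually (gt_mem_nhds zero_lt_one)).and
    ((h3.eventually (lt_mem_nhds hδ)).and (eventually_gt_atTop 0)))
  filter_upwards [tendsto_log_natCast.eventually h4] with R ⟨hR1, hR2, hl⟩ E hE hflow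
  set l := Real.log R with hl'
  set e := √(2 * Real.pi / l) with he
  by_cases hcase : 2 * Real.pi / l ≤ E
  · have : 0 < 2 * Real.pi / l := by positivity
    nlinarith
  have hEe : √E ≤ e := Real.sqrt_le_sqrt (not_le.1 hcase).le
  have hE0 := Real.sqrt_nonneg E
  have h5 := hflow (by nlinarith)
  have h6 : (1 - (C + 1) * e) ^ 2 ≤ (1 - √E - C * √E) ^ 2 := by
    refine pow_le_pow_left₀ (by linarith) ?_ 2
    nlinarith
  have h7 : (1 - δ) * (1 + 120 / (2 * Real.pi * l)) ≤ (1 - √E - C * √E) ^ 2 := by linarith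
  have h8 : (2 * Real.pi) ^ 2 * ((1 - δ) * (1 + 120 / (2 * Real.pi * l))) ≤
      (2 * Real.pi * l + 120) * E := by
    refine le_trans (mul_le_mul_of_nonneg_left h7 (by positivity)) ?_
    rw [← mul_pow]
    exact h5
  have h9 : (2 * Real.pi) ^ 2 * ((1 - δ) * (1 + 120 / (2 * Real.pi * l))) =
      (2 * Real.pi * l + 120) * ((1 - δ) * (2 * Real.pi / l)) := by
    field_simp
  rw [h9] at h8
  exact le_of_mul_le_mul_left h8 (by positivity)

end Below

/-! ### The capacity between a droplet and the boundary of the box, from above -/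

section Above

variable {Λ : Finset Site} {L : ℕ}

lemma inBox_of_near {ξ : Config Λ} {a : Site} (hdrop : ∀ x : Λ, ξ x ≠ 0 → InBox a L x) {x : Λ}
    (hx : Near ξ x) : InBox a (L + 2) x := by
  obtain ⟨y, hy, h1, h2⟩ := hx
  have h3 := hdrop y hy
  rw [abs_le] at h1 h2
  unfold InBox at h3 ⊢
  omega

/-- Test functions for the droplets that are far from the boundary of the box. -/
theorem eventually_exists_deep (L : ℕ) {δ : ℝ} (hδ : 0 < δ) :
    ∀ᶠ R : ℕ in atTop, ∀ (Λ : Finset Site) (ξ : Config Λ) (a : Site),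
      (∀ x : Λ, ξ x ≠ 0 → InBox a L x) → (∀ x, InBox a R x → x ∈ Λ) →
      ∃ g : Option Λ → ℝ, g none = 1 ∧ (∀ x, g (some x) ∈ Set.Icc (0 : ℝ) 1) ∧
        (∀ x, Near ξ x → g (some x) = 0) ∧
        dirichlet (walkCond Λ) g g ≤ (1 + δ) * (2 * Real.pi / Real.log R) := by
  have hpi := Real.pi_pos
  set ρ : ℝ := 2 * (L + 2) with hρ
  have hρ1 : 1 ≤ ρ := by
    have : (0 : ℝ) ≤ L := Nat.cast_nonneg L
    linarith
  have h2 : Tendsto (fun l : ℝ => 1 + 68 / (2 * Real.pi * l)) atTop (𝓝 1) := by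
    have h3 : Tendsto (fun l : ℝ => 68 / (2 * Real.pi * l)) atTop (𝓝 0) :=
      tendsto_const_nhds.div_atTop (tendsto_id.const_mul_atTop (by positivity))
    simpa using h3.const_add 1
  have h3 : Tendsto (fun l : ℝ => 1 - Real.log ρ / l) atTop (𝓝 1) := by
    have h4 : Tendsto (fun l : ℝ => Real.log ρ / l) atTop (𝓝 0) :=
      tendsto_const_nhds.div_atTop tendsto_id
    simpa using h4.const_sub 1
  have h4 : Tendsto (fun l : ℝ => (1 + 68 / (2 * Real.pi * l)) / (1 - Real.log ρ / l) ^ 2) atTop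
      (𝓝 1) := by
    have := h2.div (h3.pow 2) (by norm_num)
    simp only [one_pow, div_one] at this
    exact this
  have h5 := (h4.eventually (ge_mem_nhds (by linarith : (1 : ℝ) < 1 + δ))).and
    (eventually_gt_atTop (max 0 (Real.log ρ)))
  filter_upwards [tendsto_log_natCast.eventually h5,
    tendsto_natCast_atTop_atTop.eventually_gt_atTop ρ] with R ⟨hR1, hR2⟩ hR Λ ξ a hdrop hbox
  obtain ⟨hl, hlρ⟩ := max_lt_iff.1 hR2
  obtain ⟨φ, hφ1, hφ2, hφ3, hφ4⟩ := exists_cutoff hρ1 hR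
  refine ⟨fun o => o.elim 1 fun x => φ ((x : Site).1 - a.1) ((x : Site).2 - a.2), rfl,
    fun x => hφ1 _ _, fun x hx => hφ2 _ _ ?_, ?_⟩
  · have hin := inBox_of_near hdrop hx
    have key : ∀ z : ℤ, -(L + 2) ≤ z → z ≤ L + 2 → (z : ℝ) ^ 2 ≤ (L + 2) ^ 2 := by
      intro z h1 h2
      have h1' : (-(L + 2) : ℝ) ≤ z := by exact_mod_cast h1
      have h2' : (z : ℝ) ≤ L + 2 := by exact_mod_cast h2
      exact sq_le_sq' h1' h2'
    unfold InBox at hin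
    have k1 := key ((x : Site).1 - a.1) (by omega) (by omega)
    have k2 := key ((x : Site).2 - a.2) (by omega) (by omega)
    rw [hρ]
    nlinarith [sq_nonneg ((L : ℝ) + 2)]
  · refine (dirichlet_walkCond_le (φ := φ) (R := R) (a := a) rfl (fun x => rfl) hφ3 hbox).trans
      (hφ4.trans ?_)
    set l := Real.log R with hl'
    have h6 : (2 * Real.pi * l + 68) / (l - Real.log ρ) ^ 2 =
        (1 + 68 / (2 * Real.pi * l)) / (1 - Real.log ρ / l) ^ 2 * (2 * Real.pi / l) := by
      have : l - Real.log ρ ≠ 0 := (sub_pos.2 hlρ).ne'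
      have h8 : 1 - Real.log ρ / l = (l - Real.log ρ) / l := by field_simp
      rw [h8]
      field_simp
    rw [h6]
    exact mul_le_mul_of_nonneg_right hR1 (by positivity)

lemma sum_walkCond_le (x : Λ) : ∑ o', walkCond Λ (some x) o' ≤ 5 := by
  classical
  rw [Fintype.sum_option]
  have h1 : walkCond Λ (some x) none ≤ 1 := by
    rcases walkCond_eq (some x) none with h | h <;> rw [h]
    exact zero_le_one
  have h2 : ∑ y : Λ, walkCond Λ (some x) (some y) ≤ 4 := by
    set N : Finset Site := {((x : Site).1 + 1, (x : Site).2), ((x : Site).1 - 1, (x : Site).2),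
      ((x : Site).1, (x : Site).2 + 1), ((x : Site).1, (x : Site).2 - 1)} with hN
    have h3 : ∑ y : Λ, walkCond Λ (some x) (some y) =
        ((Finset.univ.filter fun y : Λ => nbr (x : Site) y).card : ℝ) := by
      rw [Finset.card_filter]
      push_cast
      exact Finset.sum_congr rfl fun y _ => by
        simp only [walkCond]
    have h4 : (Finset.univ.filter fun y : Λ => nbr (x : Site) y).card ≤ N.card := by
      refine Finset.card_le_card_of_injOn (fun y => (y : Site)) (fun y hy => ?_)
        (fun y _ z _ h => Subtype.ext h)
      have := (Finset.mem_filter.1 hy).2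
      rw [nbr_iff] at this
      simp only [hN, Finset.coe_insert, Finset.coe_singleton, Set.mem_insert_iff,
        Set.mem_singleton_iff, Prod.ext_iff]
      omega
    have h5 : N.card ≤ 4 := Finset.card_le_four
    rw [h3]
    exact_mod_cast h4.trans h5
  linarith

/-- A crude test function, for the droplets that are close to the boundary of the box. -/
theorem exists_shallow {ξ : Config Λ} {a : Site} (hdrop : ∀ x : Λ, ξ x ≠ 0 → InBox a L x) :
    ∃ g : Option Λ → ℝ, g none = 1 ∧ (∀ x, g (some x) ∈ Set.Icc (0 : ℝ) 1) ∧
      (∀ x, Near ξ x → g (some x) = 0) ∧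
      dirichlet (walkCond Λ) g g ≤ 5 * (2 * (L + 2) + 1) ^ 2 := by
  classical
  set A : Finset Λ := Finset.univ.filter fun x => InBox a (L + 2) (x : Site) with hA
  set g : Option Λ → ℝ := fun o => o.elim 1 fun x => if x ∈ A then 0 else 1 with hg
  have hA1 : ∀ x ∈ A, g (some x) = 0 := fun x hx => if_pos hx
  have hA2 : ∀ o, (∀ x ∈ A, o ≠ some x) → g o = 1 := by
    rintro (_ | x) ho
    · rfl
    · exact if_neg fun hx => ho x hx rfl
  have hcard : (A.card : ℝ) ≤ (2 * (L + 2) + 1) ^ 2 := by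
    have h1 : A.card ≤ (2 * (L + 2) + 1) ^ 2 := by
      set B : Finset Site := Finset.Icc (a.1 - (L + 2)) (a.1 + (L + 2)) ×ˢ
        Finset.Icc (a.2 - (L + 2)) (a.2 + (L + 2)) with hB
      have h2 : A.card ≤ B.card := by
        refine Finset.card_le_card_of_injOn (fun y => (y : Site)) (fun y hy => ?_)
          (fun y _ z _ h => Subtype.ext h)
        have := (Finset.mem_filter.1 hy).2
        unfold InBox at this
        simp only [hB, Finset.coe_product, Set.mem_prod, Finset.coe_Icc, Set.mem_Icc]
        omega
      refine h2.trans_eq ?_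
      rw [hB, Finset.card_product, Int.card_Icc, Int.card_Icc, sq]
      congr 1 <;> omega
    exact_mod_cast h1
  refine ⟨g, rfl, fun x => ?_, fun x hx => hA1 x ?_, ?_⟩
  · by_cases hx : x ∈ A
    · rw [hA1 x hx]; simp
    · rw [hA2 (some x) fun y hy h => hx (Option.some.inj h ▸ hy)]; simp
  · exact Finset.mem_filter.2 ⟨Finset.mem_univ _, inBox_of_near hdrop hx⟩
  · set S : Option Λ → ℝ := fun o => if ∃ x ∈ A, o = some x then 1 else 0 with hS
    have hterm : ∀ o o', walkCond Λ o o' * (g o - g o') ^ 2 ≤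
        S o * walkCond Λ o o' + S o' * walkCond Λ o' o := by
      intro o o'
      rw [walkCond_comm o' o, ← add_mul, mul_comm (walkCond Λ o o')]
      refine mul_le_mul_of_nonneg_right ?_ (walkCond_nonneg o o')
      have hg01 : ∀ o, g o ∈ Set.Icc (0 : ℝ) 1 := by
        rintro (_ | x)
        · simp [hg]
        · simp only [hg, Option.elim]; split_ifs <;> simp
      have hSg : ∀ o, S o = 1 - g o := by
        intro o
        by_cases ho : ∃ x ∈ A, o = some x
        · obtain ⟨x, hx, rfl⟩ := ho
          rw [hA1 x hx]
          simp only [hS]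
          rw [if_pos ⟨x, hx, rfl⟩, sub_zero]
        · rw [hA2 o fun x hx h => ho ⟨x, hx, h⟩]
          simp only [hS]
          rw [if_neg ho, sub_self]
      rw [hSg, hSg]
      have h1 := hg01 o
      have h2 := hg01 o'
      rw [Set.mem_Icc] at h1 h2
      nlinarith [mul_nonneg h1.1 (sub_nonneg.2 h1.2), mul_nonneg h2.1 (sub_nonneg.2 h2.2),
        mul_nonneg h1.1 h2.1, mul_nonneg (sub_nonneg.2 h1.2) (sub_nonneg.2 h2.2)]
    have hsum : ∑ o, ∑ o', S o * walkCond Λ o o' ≤ 5 * A.card := by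
      have h1 : ∀ o, ∑ o', S o * walkCond Λ o o' ≤ 5 * S o := by
        rintro (_ | x)
        · simp [hS]
        · rw [← Finset.mul_sum, mul_comm]
          refine mul_le_mul_of_nonneg_right (sum_walkCond_le x) ?_
          simp only [hS]; split_ifs <;> norm_num
      refine (Finset.sum_le_sum fun o _ => h1 o).trans_eq ?_
      have hSx : ∀ x : Λ, S (some x) = if x ∈ A then 1 else 0 := fun x => if_congr
        ⟨fun ⟨y, hy, he⟩ => Option.some.inj he ▸ hy, fun hx => ⟨x, hx, rfl⟩⟩ rfl rfl
      have hS0 : S none = 0 := if_neg fun ⟨y, _, he⟩ => absurd he (by simp)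
      rw [← Finset.mul_sum, Fintype.sum_option, hS0, zero_add]
      simp only [hSx, Finset.sum_boole, Finset.filter_univ_mem]
    have h2 : 2 * dirichlet (walkCond Λ) g g ≤ 5 * A.card + 5 * A.card := by
      rw [two_mul_dirichlet, Fintype.sum_prod_type]
      refine (Finset.sum_le_sum fun o _ => Finset.sum_le_sum fun o' _ => hterm o o').trans ?_
      simp only [Finset.sum_add_distrib]
      refine add_le_add hsum ?_
      rw [Finset.sum_comm]
      exact hsum
    nlinarith

end Above

/-! ### Counting protocritical droplets -/

section Counting

/-- The lexicographically smallest occupied site of a configuration on the lattice, used as its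
position. -/
def IsBase (c : Site → Fin 3) (b : Site) : Prop :=
  c b ≠ 0 ∧ ∀ x, c x ≠ 0 → b.1 < x.1 ∨ (b.1 = x.1 ∧ b.2 ≤ x.2)

lemma IsBase.unique {c : Site → Fin 3} {b b' : Site} (h : IsBase c b) (h' : IsBase c b') : b = b' := by
  have h1 := h.2 b' h'.1
  have h2 := h'.2 b h.1
  exact Prod.ext (by omega) (by omega)

lemma IsBase.shift {c : Site → Fin 3} {b : Site} (h : IsBase c b) (v : Site) :
    IsBase (fun x => c (x - v)) (b + v) := by
  refine ⟨by simpa using h.1, fun x hx => ?_⟩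
  have := h.2 _ hx
  simp only [Prod.fst_add, Prod.snd_add, Prod.fst_sub, Prod.snd_sub] at this ⊢
  omega

variable {Λ : Finset Site} {p : Params} {F : Set (Config Λ)} {L : ℕ}

lemma extend_of_mem {ξ : Config Λ} (x : Λ) : extend ξ x = ξ x := dif_pos x.2

lemma mem_of_extend_ne {ξ : Config Λ} {x : Site} (h : extend ξ x ≠ 0) :
    ∃ hx : x ∈ Λ, ξ ⟨x, hx⟩ ≠ 0 := by
  by_cases hx : x ∈ Λ
  · exact ⟨hx, by rwa [extend, dif_pos hx] at h⟩
  · exact absurd (dif_neg hx) h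

lemma extend_injective {ξ ξ' : Config Λ} (h : extend ξ = extend ξ') : ξ = ξ' := by
  funext x
  rw [← extend_of_mem (ξ := ξ), h, extend_of_mem]

lemma exists_isBase {ξ : Config Λ} {x : Λ} (hx : ξ x ≠ 0) : ∃ b, IsBase (extend ξ) b := by
  classical
  obtain ⟨b, hb, hmin⟩ := Finset.exists_min_image (Λ.filter fun y => extend ξ y ≠ 0)
    (fun y => (toLex y : ℤ ×ₗ ℤ)) ⟨x, Finset.mem_filter.2 ⟨x.2, by rwa [extend_of_mem]⟩⟩
  refine ⟨b, (Finset.mem_filter.1 hb).2, fun y hy => ?_⟩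
  obtain ⟨hyΛ, -⟩ := mem_of_extend_ne hy
  have := hmin y (Finset.mem_filter.2 ⟨hyΛ, hy⟩)
  rw [Prod.Lex.toLex_le_toLex] at this
  exact this

lemma mem_shiftClass_self (ξ : Config Λ) : extend ξ ∈ shiftClass ξ := ⟨0, by simp⟩

lemma shiftClass_eq_of_shift {ξ ξ' : Config Λ} {v : Site} (h : ∀ x, extend ξ' (x + v) = extend ξ x) :
    shiftClass ξ' = shiftClass ξ := by
  have h' : ∀ x, extend ξ' x = extend ξ (x - v) := fun x => by rw [← h, sub_add_cancel]
  ext c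
  constructor
  · rintro ⟨w, rfl⟩
    exact ⟨w + v, by funext x; simp only [h', sub_sub]⟩
  · rintro ⟨w, rfl⟩
    refine ⟨w - v, ?_⟩
    funext x
    simp only [h']
    congr 1
    abel

/-- A droplet is determined by its shape and its position. -/
lemma eq_of_shiftClass_of_base {ξ ξ' : Config Λ} {b : Site} (h : shiftClass ξ = shiftClass ξ')
    (hb : IsBase (extend ξ) b) (hb' : IsBase (extend ξ') b) : ξ = ξ' := by
  have h1 : extend ξ ∈ shiftClass ξ' := h ▸ mem_shiftClass_self ξ
  obtain ⟨v, hv⟩ := h1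
  have h2 := hb'.shift v
  simp only at hv
  rw [hv] at h2
  have h3 : v = 0 := by
    have := hb.unique h2
    simpa using this.symm
  subst h3
  refine extend_injective ?_
  rw [← hv]
  simp

lemma H3.exists_isBase (h3 : H3 p F L) {ξ : Config Λ} (hξ : ξ ∈ proto p F) :
    ∃ b, IsBase (extend ξ) b := by
  have h1 := (h3.single ξ hξ).1
  have h2 : Nonempty (bondGraph ξ).ConnectedComponent := by
    by_contra hne
    rw [not_nonempty_iff] at hne
    rw [numDroplets, Nat.card_of_isEmpty] at h1
    exact zero_ne_one h1
  obtain ⟨x⟩ := h2.map Quot.out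
  exact Kawasaki.exists_isBase x.2

lemma H3.inBox_of_isBase (h3 : H3 p F L) {ξ : Config Λ} (hξ : ξ ∈ proto p F) {b : Site}
    (hb : IsBase (extend ξ) b) (x : Λ) (hx : ξ x ≠ 0) : InBox b L x := by
  obtain ⟨-, -, a, ha⟩ := h3.single ξ hξ
  obtain ⟨hbΛ, hb0⟩ := mem_of_extend_ne hb.1
  have h1 := ha _ hb0
  have h2 := ha x hx
  simp only at h1
  unfold InBox
  omega

variable (p F) in
/-- The finite set of the shapes of protocritical droplets. -/
def shapes : Finset (Set (Site → Fin 3)) :=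
  ((Set.toFinite (proto p F)).image shiftClass).toFinset

lemma card_shapes : (shapes p F).card = numShapes p F :=
  (Set.ncard_eq_toFinset_card _ _).symm

lemma mem_shapes {σ : Set (Site → Fin 3)} : σ ∈ shapes p F ↔ ∃ ξ ∈ proto p F, shiftClass ξ = σ := by
  simp [shapes]

/-- There are at most as many droplets as there are pairs of a shape and a position. -/
lemma card_le_numShapes_mul {P : Finset (Config Λ)} {A : Finset Site}
    (hP : ∀ ξ ∈ P, ξ ∈ proto p F ∧ ∃ b ∈ A, IsBase (extend ξ) b) :
    P.card ≤ numShapes p F * A.card := by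
  classical
  choose! b hbA hb using fun ξ hξ => (hP ξ hξ).2
  rw [← card_shapes, ← Finset.card_product]
  refine Finset.card_le_card_of_injOn (fun ξ => (shiftClass ξ, b ξ)) (fun ξ hξ => ?_)
    fun ξ hξ ξ' hξ' h => ?_
  · rw [Finset.mem_coe, Finset.mem_product]
    exact ⟨mem_shapes.2 ⟨ξ, (hP ξ hξ).1, rfl⟩, hbA ξ hξ⟩
  · simp only [Prod.mk.injEq] at h
    refine eq_of_shiftClass_of_base h.1 (hb ξ hξ) ?_
    rw [h.2]
    exact hb ξ' hξ'

/-- If each shape occurs at each position in `A`, there are at least as many droplets as there are pairs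
of a shape and a position in `A`. -/
lemma numShapes_mul_le_card {P : Finset (Config Λ)} {A : Finset Site}
    (hP : ∀ ξ ∈ proto p F, ∀ b ∈ A, ∃ ξ' ∈ P, shiftClass ξ' = shiftClass ξ ∧ IsBase (extend ξ') b) :
    numShapes p F * A.card ≤ P.card := by
  classical
  have hex : ∀ q ∈ shapes p F ×ˢ A, ∃ ξ' ∈ P, shiftClass ξ' = q.1 ∧ IsBase (extend ξ') q.2 := by
    rintro ⟨σ, b⟩ hq
    rw [Finset.mem_product] at hq
    obtain ⟨ξ, hξ, hσ⟩ := mem_shapes.1 hq.1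
    simp only at hσ ⊢
    rw [← hσ]
    exact hP ξ hξ b hq.2
  choose! m hm1 hm2 hm3 using hex
  rw [← card_shapes, ← Finset.card_product]
  refine Finset.card_le_card_of_injOn m (fun q hq => hm1 q hq) fun q hq q' hq' h => ?_
  refine Prod.ext ?_ ?_
  · rw [← hm2 q hq, ← hm2 q' hq', h]
  · have h1 := hm3 q hq
    rw [h] at h1
    exact h1.unique (hm3 q' hq')

open scoped Classical in
/-- The sites of `Λ` that are within distance `d` of the complement. -/
def shallow (Λ : Finset Site) (d : ℕ) : Finset Site := Λ.filter fun x => ∃ y, InBox x d y ∧ y ∉ Λ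

lemma mem_shallow {d : ℕ} {x : Site} : x ∈ shallow Λ d ↔ x ∈ Λ ∧ ∃ y, InBox x d y ∧ y ∉ Λ := by
  simp only [shallow, Finset.mem_filter]

lemma inBox_subset_of_notMem_shallow {d : ℕ} {x : Site} (hx : x ∈ Λ) (h : x ∉ shallow Λ d) (y : Site)
    (hy : InBox x d y) : y ∈ Λ := by
  by_contra hyΛ
  exact h (mem_shallow.2 ⟨hx, y, hy, hyΛ⟩)

/-- The limiting capacity from above, in terms of the capacities of the individual droplets. -/
theorem H3.exists_critForm_le_mul (hp : p.Metastable) (h : H1 p F) (h3 : H3 p F L) {R : ℕ} {U : ℝ}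
    (hU : 0 ≤ U) (hdeep : ∀ (ξ : Config Λ) (a : Site),
      (∀ x : Λ, ξ x ≠ 0 → InBox a L x) → (∀ x, InBox a R x → x ∈ Λ) →
      ∃ g : Option Λ → ℝ, g none = 1 ∧ (∀ x, g (some x) ∈ Set.Icc (0 : ℝ) 1) ∧
        (∀ x, Near ξ x → g (some x) = 0) ∧ dirichlet (walkCond Λ) g g ≤ U) :
    ∃ f ∈ admissible p F, critForm p F f ≤ numShapes p F *
      (Λ.card * U + (shallow Λ R).card * (5 * (2 * (L + 2) + 1) ^ 2)) := by
  classical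
  set W : ℝ := 5 * (2 * (L + 2) + 1) ^ 2 with hW
  have hW0 : 0 ≤ W := by positivity
  have hex : ∀ ξ ∈ proto p F, ∃ g : Option Λ → ℝ, g none = 1 ∧
      (∀ x, g (some x) ∈ Set.Icc (0 : ℝ) 1) ∧ (∀ x, Near ξ x → g (some x) = 0) ∧
      dirichlet (walkCond Λ) g g ≤
        U + if ∃ b ∈ shallow Λ R, IsBase (extend ξ) b then W else 0 := by
    intro ξ hξ
    obtain ⟨b, hb⟩ := h3.exists_isBase hξ
    have hdrop := h3.inBox_of_isBase hξ hb
    split_ifs with hc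
    · obtain ⟨g, h1, h2, h4, h5⟩ := exists_shallow hdrop
      exact ⟨g, h1, h2, h4, h5.trans (by linarith)⟩
    · have hbs : b ∉ shallow Λ R := fun h => hc ⟨b, h, hb⟩
      obtain ⟨hbΛ, -⟩ := mem_of_extend_ne hb.1
      obtain ⟨g, h1, h2, h4, h5⟩ := hdeep ξ b hdrop (inBox_subset_of_notMem_shallow hbΛ hbs)
      exact ⟨g, h1, h2, h4, by linarith⟩
  choose! g hg1 hg2 hg3 hg4 using hex
  obtain ⟨f, hf, hle⟩ := h3.exists_critForm_le hp h g hg1 hg2 hg3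
  refine ⟨f, hf, hle.trans ?_⟩
  have hcard1 : (protoFinset p F).card ≤ numShapes p F * Λ.card := by
    refine card_le_numShapes_mul fun ξ hξ => ⟨mem_protoFinset.1 hξ, ?_⟩
    obtain ⟨b, hb⟩ := h3.exists_isBase (mem_protoFinset.1 hξ)
    exact ⟨b, (mem_of_extend_ne hb.1).1, hb⟩
  have hcard2 : ((protoFinset p F).filter fun ξ => ∃ b ∈ shallow Λ R, IsBase (extend ξ) b).card ≤
      numShapes p F * (shallow Λ R).card := by
    refine card_le_numShapes_mul fun ξ hξ => ?_
    rw [Finset.mem_filter, mem_protoFinset] at hξ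
    exact hξ
  have hcard1' : ((protoFinset p F).card : ℝ) ≤ numShapes p F * Λ.card := by exact_mod_cast hcard1
  have hcard2' : (((protoFinset p F).filter
      fun ξ => ∃ b ∈ shallow Λ R, IsBase (extend ξ) b).card : ℝ) ≤
      numShapes p F * (shallow Λ R).card := by exact_mod_cast hcard2
  calc ∑ ξ ∈ protoFinset p F, dirichlet (walkCond Λ) (g ξ) (g ξ)
      ≤ ∑ ξ ∈ protoFinset p F, (U + if ∃ b ∈ shallow Λ R, IsBase (extend ξ) b then W else 0) :=
        Finset.sum_le_sum fun ξ hξ => hg4 ξ (mem_protoFinset.1 hξ)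
    _ = (protoFinset p F).card * U + ((protoFinset p F).filter
          fun ξ => ∃ b ∈ shallow Λ R, IsBase (extend ξ) b).card * W := by
        rw [Finset.sum_add_distrib, Finset.sum_const, nsmul_eq_mul, ← Finset.sum_filter,
          Finset.sum_const, nsmul_eq_mul]
    _ ≤ numShapes p F * Λ.card * U + numShapes p F * (shallow Λ R).card * W :=
        add_le_add (mul_le_mul_of_nonneg_right hcard1' hU) (mul_le_mul_of_nonneg_right hcard2' hW0)
    _ = _ := by ring

/-- The limiting capacity from below, in terms of the capacities of the individual droplets. -/
theorem H3.mul_le_critForm (hp : p.Metastable) (h3 : H3 p F L) {d : ℝ} {D : ℕ}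
    (hshift : ShiftInvariantAt p F d) (hD : d + L ≤ D) {l : ℝ} (hl0 : 0 ≤ l) {f : Config Λ → ℝ}
    (hl : ∀ ξ ∈ proto p F, ∀ a ∈ Λ, (∀ x : Λ, ξ x ≠ 0 → InBox a L x) →
      (∀ x, InBox a D x → x ∈ Λ) → l ≤ dirichlet (freeCond p (gammaStar p F) ξ)
        (fun o => f (insertTwo ξ o)) (fun o => f (insertTwo ξ o))) :
    numShapes p F * (Λ.card - (shallow Λ D).card) * l ≤ critForm p F f := by
  classical
  set A : Finset Site := Λ \ shallow Λ D with hA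
  set P := (protoFinset p F).filter fun ξ => ∃ b ∈ A, IsBase (extend ξ) b with hP
  have hAcard : (A.card : ℝ) = Λ.card - (shallow Λ D).card := by
    rw [hA, Finset.cast_card_sdiff fun x hx => (mem_shallow.1 hx).1]
  have hcard : numShapes p F * A.card ≤ P.card := by
    refine numShapes_mul_le_card fun ξ hξ b hb => ?_
    obtain ⟨b₀, hb₀⟩ := h3.exists_isBase hξ
    obtain ⟨hbΛ, hbs⟩ := Finset.mem_sdiff.1 hb
    obtain ⟨ξ', hξ', hsh⟩ := hshift ξ hξ (b - b₀) fun x hx y hy => by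
      obtain ⟨hxΛ, hx0⟩ := mem_of_extend_ne hx
      have h1 := h3.inBox_of_isBase hξ hb₀ _ hx0
      have h2 : ¬ InBox b D y := fun h2 => hy (inBox_subset_of_notMem_shallow hbΛ hbs y h2)
      have key : ∀ u v : ℤ, ((D : ℤ) - L ≤ u - v ∨ (D : ℤ) - L ≤ v - u) → d ≤ dist u v := by
        intro u v huv
        rw [Int.dist_eq]
        have hDL : d ≤ (D : ℝ) - L := by linarith
        rcases huv with huv | huv
        · have : ((D : ℝ) - L) ≤ (u : ℝ) - v := by exact_mod_cast huv
          exact hDL.trans (this.trans (le_abs_self _))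
        · have : ((D : ℝ) - L) ≤ (v : ℝ) - u := by exact_mod_cast huv
          rw [abs_sub_comm]
          exact hDL.trans (this.trans (le_abs_self _))
      rw [Prod.dist_eq, le_max_iff]
      unfold InBox at h1 h2
      simp only at h1
      have hcases : ((D : ℤ) - L ≤ (x + (b - b₀)).1 - y.1 ∨ (D : ℤ) - L ≤ y.1 - (x + (b - b₀)).1) ∨
          ((D : ℤ) - L ≤ (x + (b - b₀)).2 - y.2 ∨ (D : ℤ) - L ≤ y.2 - (x + (b - b₀)).2) := by
        simp only [Prod.fst_add, Prod.snd_add, Prod.fst_sub, Prod.snd_sub]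
        omega
      exact hcases.imp (key _ _) (key _ _)
    have hbase : IsBase (extend ξ') b := by
      have h1 := hb₀.shift (b - b₀)
      rw [add_sub_cancel] at h1
      have h2 : (fun x => extend ξ (x - (b - b₀))) = extend ξ' := by
        funext x
        rw [← hsh, sub_add_cancel]
      rwa [h2] at h1
    exact ⟨ξ', Finset.mem_filter.2 ⟨mem_protoFinset.2 hξ', b, hb, hbase⟩,
      shiftClass_eq_of_shift hsh, hbase⟩
  have hcard' : (numShapes p F : ℝ) * A.card ≤ P.card := by exact_mod_cast hcard
  rw [← hAcard]
  calc numShapes p F * A.card * l ≤ P.card * l := mul_le_mul_of_nonneg_right hcard' hl0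
    _ = ∑ ξ ∈ P, l := by rw [Finset.sum_const, nsmul_eq_mul]
    _ ≤ ∑ ξ ∈ P, dirichlet (freeCond p (gammaStar p F) ξ)
        (fun o => f (insertTwo ξ o)) (fun o => f (insertTwo ξ o)) := by
        refine Finset.sum_le_sum fun ξ hξ => ?_
        rw [hP, Finset.mem_filter, mem_protoFinset] at hξ
        obtain ⟨hξ, b, hb, hbase⟩ := hξ
        obtain ⟨hbΛ, hbs⟩ := Finset.mem_sdiff.1 hb
        exact hl ξ hξ b hbΛ (h3.inBox_of_isBase hξ hbase) (inBox_subset_of_notMem_shallow hbΛ hbs)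
    _ ≤ ∑ ξ ∈ protoFinset p F, dirichlet (freeCond p (gammaStar p F) ξ)
        (fun o => f (insertTwo ξ o)) (fun o => f (insertTwo ξ o)) :=
        Finset.sum_le_sum_of_subset_of_nonneg (Finset.filter_subset _ _) fun ξ _ _ =>
          dirichlet_self_nonneg (freeCond_nonneg _ ξ) _
    _ ≤ critForm p F f := h3.sum_dirichlet_le hp f

/-- There is a protocritical droplet: otherwise the upper bound of `H3.exists_critForm_le` would be an
empty sum, and the variational problem has positive values. -/
lemma H3.numShapes_pos (hp : p.Metastable) (h : H1 p F) (h3 : H3 p F L) : 0 < numShapes p F := by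
  by_contra h0
  have h1 : numShapes p F = 0 := by omega
  obtain ⟨f, hf, hle⟩ := h3.exists_critForm_le hp h (fun _ _ => 1) (fun _ _ => rfl)
    (fun _ _ _ => by simp) (by
      intro ξ hξ
      have h2 : shiftClass ξ ∈ shapes p F := mem_shapes.2 ⟨ξ, hξ, rfl⟩
      rw [Finset.card_eq_zero.1 (card_shapes.trans h1)] at h2
      exact absurd h2 (Finset.notMem_empty _))
  have h2 : ∀ g : Option Λ → ℝ, g = (fun _ => 1) → dirichlet (walkCond Λ) g g = 0 := by
    rintro g rfl
    simp [dirichlet]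
  simp only [h2 _ rfl, Finset.sum_const_zero] at hle
  exact absurd (critForm_pos h hf) (not_lt.2 hle)

end Counting

/-! ### Boxes of bounded distortion -/

section Boxes

/-- All lattice points on a segment between two sites of `Λ` are in `Λ`. -/
def LatticeConvex (Λ : Finset Site) : Prop :=
  ∀ x ∈ Λ, ∀ z ∈ Λ, ∀ (y : Site) (a b : ℤ), 0 ≤ a → 0 ≤ b → 0 < a + b →
    a * x.1 + b * z.1 = (a + b) * y.1 → a * x.2 + b * z.2 = (a + b) * y.2 → y ∈ Λ

variable {Λ : Finset Site}

lemma latticeConvex_of_convex {C : Set (ℝ × ℝ)} (hC : Convex ℝ C)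
    (hΛ : ∀ x : Site, x ∈ Λ ↔ ((x.1 : ℝ), (x.2 : ℝ)) ∈ C) : LatticeConvex Λ := by
  intro x hx z hz y a b ha hb hab h1 h2
  rw [hΛ] at hx hz ⊢
  have hab' : (0 : ℝ) < a + b := by exact_mod_cast hab
  have ha' : (0 : ℝ) ≤ a := by exact_mod_cast ha
  have hb' : (0 : ℝ) ≤ b := by exact_mod_cast hb
  have h1' : (a * x.1 + b * z.1 : ℝ) = (a + b) * y.1 := by exact_mod_cast h1
  have h2' : (a * x.2 + b * z.2 : ℝ) = (a + b) * y.2 := by exact_mod_cast h2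
  have := hC hx hz (a := a / (a + b)) (b := b / (a + b)) (by positivity) (by positivity)
    (by field_simp)
  convert this using 1
  refine Prod.ext ?_ ?_
  · simp only [Prod.smul_mk, smul_eq_mul, Prod.mk_add_mk]
    field_simp
    linarith
  · simp only [Prod.smul_mk, smul_eq_mul, Prod.mk_add_mk]
    field_simp
    linarith

lemma LatticeConvex.row (h : LatticeConvex Λ) {u v w y : ℤ} (hu : (u, y) ∈ Λ) (hw : (w, y) ∈ Λ)
    (huv : u ≤ v) (hvw : v ≤ w) : (v, y) ∈ Λ := by
  rcases huv.eq_or_lt with rfl | huv'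
  · exact hu
  · exact h _ hu _ hw (v, y) (w - v) (v - u) (by omega) (by omega) (by omega) (by simp only; ring)
      (by simp only; ring)

lemma LatticeConvex.swap (h : LatticeConvex Λ) :
    LatticeConvex (Λ.map (Equiv.prodComm ℤ ℤ).toEmbedding) := by
  intro x hx z hz y a b ha hb hab h1 h2
  rw [Finset.mem_map_equiv] at hx hz ⊢
  exact h _ hx _ hz _ a b ha hb hab h2 h1

/-- In each row there are at most `|m|` sites that leave `Λ` when translated by `m`. -/
lemma LatticeConvex.card_exit_le (h : LatticeConvex Λ) {N : ℕ} (hN : ∀ x ∈ Λ, -(N : ℤ) ≤ x.2 ∧ x.2 ≤ N)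
    {m : ℤ} (hm : m ≠ 0) :
    (Λ.filter fun x => ((x.1 + m, x.2) : Site) ∉ Λ).card ≤ (2 * N + 1) * m.natAbs := by
  have hm' : 0 < |m| := abs_pos.2 hm
  have hcard : (Finset.Icc (-(N : ℤ)) N ×ˢ Finset.Ico (0 : ℤ) |m|).card = (2 * N + 1) * m.natAbs := by
    rw [Finset.card_product, Int.card_Icc, Int.card_Ico, sub_zero, Int.abs_eq_natAbs,
      Int.toNat_natCast]
    congr 1
    omega
  rw [← hcard]
  refine Finset.card_le_card_of_injOn (fun x => (x.2, x.1 % |m|)) (fun x hx => ?_)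
    fun x hx z hz hxz => ?_
  · rw [Finset.mem_coe, Finset.mem_filter] at hx
    rw [Finset.mem_coe, Finset.mem_product, Finset.mem_Icc, Finset.mem_Ico]
    exact ⟨hN x hx.1, Int.emod_nonneg _ hm'.ne', Int.emod_lt_of_pos _ hm'⟩
  · -- two such sites at a distance that is a multiple of `|m|` would contradict convexity
    have key : ∀ u v y : ℤ, (u, y) ∈ Λ → (v, y) ∈ Λ → ((u + m, y) : Site) ∉ Λ →
        ((v + m, y) : Site) ∉ Λ → u % |m| = v % |m| → v ≤ u := by
      intro u v y hu hv hu' hv' huv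
      by_contra! hlt
      obtain ⟨k, hk⟩ := Int.ModEq.dvd (show Int.ModEq |m| u v from huv)
      have hk1 : 1 ≤ k := by
        by_contra! hk0
        have : k ≤ 0 := by omega
        nlinarith
      have hge : |m| ≤ v - u := by rw [hk]; nlinarith
      rcases abs_cases m with ⟨h1, h2⟩ | ⟨h1, h2⟩
      · exact hu' (h.row hu hv (by omega) (by omega))
      · exact hv' (h.row hu hv (by omega) (by omega))
    rw [Finset.mem_coe, Finset.mem_filter] at hx hz
    obtain ⟨x1, x2⟩ := x
    obtain ⟨z1, z2⟩ := z
    simp only [Prod.mk.injEq] at hxz hx hz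
    obtain ⟨rfl, h2⟩ := hxz
    rw [le_antisymm (key z1 x1 x2 hz.1 hx.1 hz.2 hx.2 h2.symm) (key x1 z1 x2 hx.1 hz.1 hx.2 hz.2 h2)]

/-- A lattice-convex set has few sites close to its complement: if the translates of `x` by
`2 * (d + 1)` in the four directions of the axes are in the set, so is the square of radius `d`
around `x`. -/
lemma LatticeConvex.card_shallow_le (h : LatticeConvex Λ) {N : ℕ}
    (hN : ∀ x ∈ Λ, (-(N : ℤ) ≤ x.1 ∧ x.1 ≤ N) ∧ -(N : ℤ) ≤ x.2 ∧ x.2 ≤ N) (d : ℕ) :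
    (shallow Λ d).card ≤ 8 * (d + 1) * (2 * N + 1) := by
  set m : ℤ := 2 * (d + 1) with hm
  have hm0 : m ≠ 0 := by omega
  have hrow : ∀ m' : ℤ, m' = m ∨ m' = -m →
      (Λ.filter fun x => ((x.1 + m', x.2) : Site) ∉ Λ).card ≤ (2 * N + 1) * (2 * (d + 1)) := by
    intro m' hm'
    refine (h.card_exit_le (fun x hx => (hN x hx).2) (by omega)).trans_eq ?_
    congr 1
    omega
  have hcol : ∀ m' : ℤ, m' = m ∨ m' = -m →
      (Λ.filter fun x => ((x.1, x.2 + m') : Site) ∉ Λ).card ≤ (2 * N + 1) * (2 * (d + 1)) := by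
    intro m' hm'
    have h1 := h.swap.card_exit_le (N := N) (m := m') (fun x hx => by
      rw [Finset.mem_map_equiv] at hx
      exact (hN _ hx).1) (by omega)
    have h2 : (2 * N + 1) * m'.natAbs = (2 * N + 1) * (2 * (d + 1)) := by
      congr 1
      omega
    rw [h2] at h1
    refine le_trans (Finset.card_le_card_of_injOn Prod.swap (fun x hx => ?_)
      (Prod.swap_injective.injOn)) h1
    rw [Finset.mem_coe, Finset.mem_filter] at hx ⊢
    rw [Finset.mem_map_equiv, Finset.mem_map_equiv]
    exact hx
  have hsub : shallow Λ d ⊆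
      ((Λ.filter fun x => ((x.1 + m, x.2) : Site) ∉ Λ) ∪
        (Λ.filter fun x => ((x.1 + -m, x.2) : Site) ∉ Λ)) ∪
      ((Λ.filter fun x => ((x.1, x.2 + m) : Site) ∉ Λ) ∪
        (Λ.filter fun x => ((x.1, x.2 + -m) : Site) ∉ Λ)) := by
    rintro ⟨x1, x2⟩ hx
    obtain ⟨hxΛ, ⟨y1, y2⟩, hy, hyΛ⟩ := mem_shallow.1 hx
    simp only [Finset.mem_union, Finset.mem_filter, hxΛ, true_and]
    by_contra! hc
    obtain ⟨⟨h1, h2⟩, h3, h4⟩ := hc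
    simp only [InBox] at hy
    have hP : ((2 * y1 - x1, x2) : Site) ∈ Λ := h.row h2 h1 (by omega) (by omega)
    have hQ : ((x1, 2 * y2 - x2) : Site) ∈ Λ := by
      have h5 := h.swap.row (u := x2 + -m) (v := 2 * y2 - x2) (w := x2 + m) (y := x1)
        (by rw [Finset.mem_map_equiv]; exact h4) (by rw [Finset.mem_map_equiv]; exact h3)
        (by omega) (by omega)
      rw [Finset.mem_map_equiv] at h5
      exact h5
    exact hyΛ (h _ hP _ hQ _ 1 1 zero_le_one zero_le_one (by norm_num) (by simp only; ring)
      (by simp only; ring))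
  refine (Finset.card_le_card hsub).trans ((Finset.card_union_le _ _).trans
    ((add_le_add (Finset.card_union_le _ _) (Finset.card_union_le _ _)).trans ?_))
  have h1 := hrow m (Or.inl rfl)
  have h2 := hrow (-m) (Or.inr rfl)
  have h3 := hcol m (Or.inl rfl)
  have h4 := hcol (-m) (Or.inr rfl)
  nlinarith

/-- The consequences of bounded distortion: the size tends to infinity, the diameter is of the order of
the square root of the size, and there are few sites close to the boundary. -/
theorem TendsToLattice.bounds {Λ : ℕ → Finset Site} (h : TendsToLattice Λ) :
    Tendsto (fun n => ((Λ n).card : ℝ)) atTop atTop ∧ ∃ κ : ℝ, 1 ≤ κ ∧ ∀ᶠ n in atTop,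
      (∀ x ∈ Λ n, |(x.1 : ℝ)| ≤ κ * √(Λ n).card ∧ |(x.2 : ℝ)| ≤ κ * √(Λ n).card) ∧
      ∀ d : ℕ, ((shallow (Λ n) d).card : ℝ) ≤ 24 * κ * (d + 1) * √(Λ n).card := by
  obtain ⟨C, r, κ, hr, hC⟩ := h
  have hcard : ∀ᶠ n in atTop, r n ^ 2 ≤ (Λ n).card := by
    filter_upwards [hC, hr.eventually_ge_atTop 1] with n ⟨_, hball, _, hΛ⟩ hrn
    set k : ℕ := ⌈r n⌉₊ - 1 with hk
    have hceil : 1 ≤ ⌈r n⌉₊ := Nat.one_le_iff_ne_zero.2 (Nat.ceil_pos.2 (by linarith)).ne'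
    have hk' : (k : ℝ) = (⌈r n⌉₊ : ℝ) - 1 := by rw [hk, Nat.cast_sub hceil, Nat.cast_one]
    have hk1 : (k : ℝ) < r n := by
      have := Nat.ceil_lt_add_one (by linarith : 0 ≤ r n)
      linarith
    have hk2 : r n - 1 ≤ k := by
      have := Nat.le_ceil (r n)
      linarith
    have hsub : Finset.Icc (-(k : ℤ)) k ×ˢ Finset.Icc (-(k : ℤ)) k ⊆ Λ n := by
      rintro ⟨x, y⟩ hxy
      rw [Finset.mem_product, Finset.mem_Icc, Finset.mem_Icc] at hxy
      rw [hΛ]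
      refine hball ?_
      have key : ∀ z : ℤ, -(k : ℤ) ≤ z ∧ z ≤ k → |(z : ℝ)| < r n := fun z hz => by
        have h1 : |z| ≤ (k : ℤ) := abs_le.2 hz
        have h2 : |(z : ℝ)| ≤ k := by exact_mod_cast h1
        linarith
      rw [mem_ball_zero_iff, Prod.norm_def, max_lt_iff]
      exact ⟨key x hxy.1, key y hxy.2⟩
    have h1 := Finset.card_le_card hsub
    rw [Finset.card_product, Int.card_Icc] at h1
    have h2 : ((k : ℤ) + 1 - -(k : ℤ)).toNat = 2 * k + 1 := by omega
    rw [h2] at h1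
    have h3 : ((2 * k + 1 : ℝ)) * (2 * k + 1) ≤ (Λ n).card := by exact_mod_cast h1
    nlinarith
  refine ⟨tendsto_atTop_mono' _ hcard ((tendsto_pow_atTop two_ne_zero).comp hr), max κ 1,
    le_max_right _ _, ?_⟩
  filter_upwards [hC, hr.eventually_ge_atTop 1, hcard] with n ⟨hconv, _, hsub, hΛ⟩ hrn hcardn
  set κ' := max κ 1 with hκ'
  have hκ1 : 1 ≤ κ' := le_max_right _ _
  set q := √((Λ n).card : ℝ) with hq
  have hrq : r n ≤ q := Real.le_sqrt_of_sq_le hcardn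
  have hbound : ∀ x ∈ Λ n, |(x.1 : ℝ)| ≤ κ' * r n ∧ |(x.2 : ℝ)| ≤ κ' * r n := by
    intro x hx
    have h1 := hsub ((hΛ x).1 hx)
    rw [mem_closedBall_zero_iff, Prod.norm_def, max_le_iff] at h1
    have h2 : κ * r n ≤ κ' * r n :=
      mul_le_mul_of_nonneg_right (le_max_left _ _) (by linarith)
    exact ⟨h1.1.trans h2, h1.2.trans h2⟩
  have hle : κ' * r n ≤ κ' * q := mul_le_mul_of_nonneg_left hrq (by linarith)
  refine ⟨fun x hx => ⟨(hbound x hx).1.trans hle, (hbound x hx).2.trans hle⟩, fun d => ?_⟩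
  set N : ℕ := ⌊κ' * r n⌋₊ with hN
  have hN' : (N : ℝ) ≤ κ' * q := (Nat.floor_le (by positivity)).trans hle
  have hbox : ∀ x ∈ Λ n, (-(N : ℤ) ≤ x.1 ∧ x.1 ≤ N) ∧ -(N : ℤ) ≤ x.2 ∧ x.2 ≤ N := by
    have key : ∀ z : ℤ, |(z : ℝ)| ≤ κ' * r n → -(N : ℤ) ≤ z ∧ z ≤ N := by
      intro z hz
      rw [← abs_le, Int.abs_eq_natAbs, Nat.cast_le]
      refine Nat.le_floor ?_
      rwa [Nat.cast_natAbs, Int.cast_abs]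
    exact fun x hx => ⟨key _ (hbound x hx).1, key _ (hbound x hx).2⟩
  have h1 := (latticeConvex_of_convex hconv hΛ).card_shallow_le hbox d
  have h2 : ((shallow (Λ n) d).card : ℝ) ≤ 8 * (d + 1) * (2 * N + 1) := by exact_mod_cast h1
  have hq1 : 1 ≤ κ' * q := by nlinarith
  have hd : (0 : ℝ) ≤ d := Nat.cast_nonneg d
  calc ((shallow (Λ n) d).card : ℝ) ≤ 8 * (d + 1) * (2 * N + 1) := h2
    _ ≤ 8 * (d + 1) * (3 * (κ' * q)) := by gcongr; linarith
    _ = 24 * κ' * (d + 1) * q := by ring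

end Boxes

/-! ### The asymptotics of the capacity -/

section Asymptotics

lemma tendsto_floor_rpow {a : ℝ} (ha : 0 < a) :
    Tendsto (fun v : ℝ => ⌊v ^ a⌋₊) atTop atTop :=
  tendsto_nat_floor_atTop.comp (tendsto_rpow_atTop ha)

/-- The radius around a deep droplet: a power of the volume with exponent slightly less than `1 / 2`. -/
lemma eventually_inner_radius {δ : ℝ} (hδ : 0 < δ) (hδ1 : δ < 1 / 2) (C : ℝ) (hC : 0 ≤ C) :
    ∀ᶠ v : ℝ in atTop, (1 - 2 * δ) / 2 * Real.log v ≤ Real.log ⌊v ^ ((1 - δ) / 2)⌋₊ ∧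
      C * ((⌊v ^ ((1 - δ) / 2)⌋₊ : ℝ) + 1) * Real.log v / √v ≤ δ := by
  set a := (1 - δ) / 2 with ha
  have ha0 : 0 < a := by rw [ha]; linarith
  have h1 : Tendsto (fun v : ℝ => 2 * C * (Real.log v / v ^ (δ / 2))) atTop (𝓝 0) := by
    have := (isLittleO_log_rpow_atTop (by positivity : 0 < δ / 2)).tendsto_div_nhds_zero
    simpa using this.const_mul (2 * C)
  filter_upwards [(tendsto_rpow_atTop ha0).eventually_ge_atTop 2, eventually_gt_atTop 1,
    Real.tendsto_log_atTop.eventually_ge_atTop (2 * Real.log 2 / δ),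
    h1.eventually (ge_mem_nhds hδ)] with v hv2 hv1 hvlog hvsmall
  have hv0 : 0 < v := by linarith
  set x := v ^ a with hx
  have hx0 : 0 < x := by linarith
  have hfl : x / 2 ≤ ⌊x⌋₊ := by
    have := Nat.lt_floor_add_one x
    linarith
  have hlogv : 0 < Real.log v := Real.log_pos hv1
  constructor
  · have h2 : Real.log (x / 2) ≤ Real.log ⌊x⌋₊ := Real.log_le_log (by positivity) hfl
    rw [Real.log_div hx0.ne' two_ne_zero, hx, Real.log_rpow hv0] at h2
    rw [div_le_iff₀ hδ] at hvlog
    refine le_trans ?_ h2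
    rw [ha]
    linarith
  · have h2 : (⌊x⌋₊ : ℝ) + 1 ≤ 2 * x := by
      have := Nat.floor_le hx0.le
      linarith
    have h3 : x / √v = 1 / v ^ (δ / 2) := by
      rw [Real.sqrt_eq_rpow, hx, ← Real.rpow_sub hv0, one_div (v ^ (δ / 2)), ← Real.rpow_neg hv0.le]
      congr 1
      rw [ha]
      ring
    calc C * ((⌊x⌋₊ : ℝ) + 1) * Real.log v / √v ≤ C * (2 * x) * Real.log v / √v := by gcongr
      _ = 2 * C * Real.log v * (x / √v) := by ring
      _ = 2 * C * (Real.log v / v ^ (δ / 2)) := by rw [h3]; ring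
      _ ≤ δ := hvsmall

/-- The radius of a square that contains the box: a power of the volume with exponent slightly larger
than `1 / 2`. -/
lemma eventually_outer_radius {δ κ : ℝ} (hδ : 0 < δ) :
    ∀ᶠ v : ℝ in atTop, 0 < Real.log ⌊v ^ ((1 + δ) / 2)⌋₊ ∧
      Real.log ⌊v ^ ((1 + δ) / 2)⌋₊ ≤ (1 + δ) / 2 * Real.log v ∧
      2 * (κ * √v) ≤ (⌊v ^ ((1 + δ) / 2)⌋₊ : ℝ) - 1 := by
  filter_upwards [(tendsto_floor_rpow (by positivity : 0 < (1 + δ) / 2)).eventually_ge_atTop 2,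
    eventually_ge_atTop 1,
    (tendsto_rpow_atTop (by positivity : 0 < δ / 2)).eventually_ge_atTop (2 * κ + 2)]
    with v hv2 hv1 hvk
  have hv0 : 0 < v := by linarith
  set x := v ^ ((1 + δ) / 2) with hx
  have hx0 : 0 < x := by positivity
  have h2 : (2 : ℝ) ≤ ⌊x⌋₊ := by exact_mod_cast hv2
  refine ⟨Real.log_pos (by linarith), ?_, ?_⟩
  · rw [← Real.log_rpow hv0]
    exact Real.log_le_log (by linarith) (Nat.floor_le hx0.le)
  · have h3 : x = √v * v ^ (δ / 2) := by
      rw [Real.sqrt_eq_rpow, ← Real.rpow_add hv0, hx]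
      congr 1
      ring
    have h4 : 1 ≤ √v := Real.one_le_sqrt.2 hv1
    have h5 := Nat.lt_floor_add_one x
    have h6 : √v * (2 * κ + 2) ≤ x := by rw [h3]; gcongr
    nlinarith

variable {p : Params} {Λ : ℕ → Finset Site} {F : (n : ℕ) → Set (Config (Λ n))} {L : ℕ}

/-- The upper bound: for most droplets, the free particle has to come from infinity. -/
theorem eventually_capacity_le (hp : p.Metastable) (hT : TendsToLattice Λ)
    (hH : ∀ᶠ n in atTop, H1 p (F n) ∧ H2 p (F n) ∧ H3 p (F n) L) {δ : ℝ} (hδ : 0 < δ)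
    (hδ1 : δ ≤ 1 / 4) :
    ∀ᶠ n in atTop, ∃ f ∈ admissible p (F n),
      critForm p (F n) f * (Real.log (Λ n).card / (4 * Real.pi * (Λ n).card)) ≤
        numShapes p (F n) * (1 + 7 * δ) := by
  have hpi := Real.pi_pos
  obtain ⟨hV, κ, hκ, hbd⟩ := hT.bounds
  set W : ℝ := 5 * (2 * (L + 2) + 1) ^ 2 with hW
  have ha : 0 < (1 - δ) / 2 := by linarith
  have hrad := eventually_inner_radius hδ (by linarith) (24 * κ * W / (4 * Real.pi))
    (by positivity)
  filter_upwards [hH, hbd, hV.eventually hrad, hV.eventually_gt_atTop 1,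
    ((tendsto_floor_rpow ha).comp hV).eventually (eventually_exists_deep L hδ)]
    with n ⟨h1, _, h3⟩ ⟨_, hshallow⟩ ⟨hR1, hR2⟩ hV1 hdeep
  simp only [Function.comp_apply] at hdeep
  set v : ℝ := ((Λ n).card : ℝ) with hv
  set R := ⌊v ^ ((1 - δ) / 2)⌋₊ with hR
  have hlogv : 0 < Real.log v := Real.log_pos hV1
  have hv0 : 0 < v := by linarith
  have hlogR : 0 < Real.log R := lt_of_lt_of_le (mul_pos (by linarith) hlogv) hR1
  obtain ⟨f, hf, hle⟩ := h3.exists_critForm_le_mul hp h1 (R := R)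
    (U := (1 + δ) * (2 * Real.pi / Real.log R)) (by positivity) (hdeep (Λ n))
  refine ⟨f, hf, ?_⟩
  set N : ℝ := (numShapes p (F n) : ℝ) with hN
  have hN0 : 0 ≤ N := Nat.cast_nonneg _
  have hS := hshallow R
  have hc : 0 ≤ Real.log v / (4 * Real.pi * v) := by positivity
  have hsq : √v * √v = v := Real.mul_self_sqrt hv0.le
  have hsq0 : 0 < √v := Real.sqrt_pos.2 hv0
  have e1 : v * ((1 + δ) * (2 * Real.pi / Real.log R)) * (Real.log v / (4 * Real.pi * v)) ≤
      1 + 6 * δ := by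
    have h4 : v * ((1 + δ) * (2 * Real.pi / Real.log R)) * (Real.log v / (4 * Real.pi * v)) =
        (1 + δ) * Real.log v / (2 * Real.log R) := by field_simp; ring
    rw [h4, div_le_iff₀ (by positivity)]
    have h5 : (1 + δ) ≤ (1 + 6 * δ) * (1 - 2 * δ) := by nlinarith
    have h6 := mul_le_mul_of_nonneg_right h5 hlogv.le
    have h7 := mul_le_mul_of_nonneg_left hR1 (by positivity : 0 ≤ 2 * (1 + 6 * δ))
    linarith
  have e2 : (shallow (Λ n) R).card * W * (Real.log v / (4 * Real.pi * v)) ≤ δ := by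
    calc (shallow (Λ n) R).card * W * (Real.log v / (4 * Real.pi * v))
        ≤ 24 * κ * (R + 1) * √v * W * (Real.log v / (4 * Real.pi * v)) := by gcongr
      _ = 24 * κ * W / (4 * Real.pi) * (R + 1) * Real.log v * (√v / v) := by
        generalize √v = q
        field_simp
      _ = 24 * κ * W / (4 * Real.pi) * (R + 1) * Real.log v / √v := by
        rw [Real.sqrt_div_self', mul_one_div]
      _ ≤ δ := hR2
  calc critForm p (F n) f * (Real.log v / (4 * Real.pi * v))
      ≤ N * (v * ((1 + δ) * (2 * Real.pi / Real.log R)) + (shallow (Λ n) R).card * W) *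
        (Real.log v / (4 * Real.pi * v)) := mul_le_mul_of_nonneg_right hle hc
    _ = N * (v * ((1 + δ) * (2 * Real.pi / Real.log R)) * (Real.log v / (4 * Real.pi * v)) +
        (shallow (Λ n) R).card * W * (Real.log v / (4 * Real.pi * v))) := by ring
    _ ≤ N * (1 + 7 * δ) := mul_le_mul_of_nonneg_left (by linarith) hN0

/-- The lower bound: each shape occurs at most positions. -/
theorem eventually_le_capacity (hp : p.Metastable) (hT : TendsToLattice Λ)
    (hH : ∀ᶠ n in atTop, H1 p (F n) ∧ H2 p (F n) ∧ H3 p (F n) L)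
    (hS : ∀ ε : ℝ, 0 < ε → ∀ᶠ n in atTop, ShiftInvariantAt p (F n) (ε * √(Λ n).card)) {δ : ℝ}
    (hδ : 0 < δ) (hδ1 : δ ≤ 1 / 4) :
    ∀ᶠ n in atTop, ∀ f ∈ admissible p (F n), numShapes p (F n) * (1 - 3 * δ) ≤
      critForm p (F n) f * (Real.log (Λ n).card / (4 * Real.pi * (Λ n).card)) := by
  have hpi := Real.pi_pos
  obtain ⟨hV, κ, hκ, hbd⟩ := hT.bounds
  set ε := δ / (48 * κ) with hε
  have hε0 : 0 < ε := by positivity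
  have hC : (0 : ℝ) ≤ (2 * (L + 3) + 1) ^ 2 + 1 := by positivity
  have ha : 0 < (1 + δ) / 2 := by linarith
  filter_upwards [hH, hbd, hS ε hε0, hV.eventually (eventually_outer_radius (κ := κ) hδ),
    hV.eventually_gt_atTop 1,
    (Real.tendsto_sqrt_atTop.comp hV).eventually_ge_atTop ((L + 6) / ε),
    ((tendsto_floor_rpow ha).comp hV).eventually (eventually_le_of_flow_bound hC hδ)]
    with n ⟨h1, _, h3⟩ ⟨hdiam, hshallow⟩ hshift ⟨hR0, hR1, hR2⟩ hV1 hVL hflow f hf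
  simp only [Function.comp_apply] at hflow hVL
  set v : ℝ := ((Λ n).card : ℝ) with hv
  set R := ⌊v ^ ((1 + δ) / 2)⌋₊ with hR
  have hlogv : 0 < Real.log v := Real.log_pos hV1
  have hv0 : 0 < v := by linarith
  have hsq : √v * √v = v := Real.mul_self_sqrt hv0.le
  have hsq0 : 0 < √v := Real.sqrt_pos.2 hv0
  set D : ℕ := ⌈ε * √v⌉₊ + L + 4 with hD
  set l : ℝ := (1 - δ) * (2 * Real.pi / Real.log R) with hl
  have hl0 : 0 ≤ l := mul_nonneg (by linarith) (by positivity)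
  have hceil := Nat.le_ceil (ε * √v)
  have hceil' := Nat.ceil_lt_add_one (by positivity : 0 ≤ ε * √v)
  have hDcast : (D : ℝ) = ⌈ε * √v⌉₊ + L + 4 := by rw [hD]; push_cast; ring
  have hmain := h3.mul_le_critForm hp hshift (D := D) (by linarith) hl0 (f := f) (by
    intro ξ hξ a haΛ hdrop hbox
    refine hflow _ (dirichlet_self_nonneg (freeCond_nonneg _ ξ) _) fun hs => ?_
    refine h3.flow_bound hp h1 hξ hf hdrop (fun x hx => hbox x ?_) (fun x hx => ?_) rfl hs
    · unfold InBox at hx ⊢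
      omega
    · have key : ∀ y z : ℤ, |(y : ℝ)| ≤ κ * √v → |(z : ℝ)| ≤ κ * √v →
          z - ((R : ℤ) - 1) ≤ y ∧ y ≤ z + ((R : ℤ) - 1) := by
        intro y z hy hz
        rw [abs_le] at hy hz
        have k1 : (z : ℝ) - ((R : ℝ) - 1) ≤ y := by linarith [hy.1, hz.2]
        have k2 : (y : ℝ) ≤ z + ((R : ℝ) - 1) := by linarith [hy.2, hz.1]
        exact ⟨by exact_mod_cast k1, by exact_mod_cast k2⟩
      have k1 := key _ _ (hdiam x hx).1 (hdiam a haΛ).1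
      have k2 := key _ _ (hdiam x hx).2 (hdiam a haΛ).2
      exact ⟨k1.1, k1.2, k2.1, k2.2⟩)
  set N : ℝ := (numShapes p (F n) : ℝ) with hN
  have hN0 : 0 ≤ N := Nat.cast_nonneg _
  have hc : 0 ≤ Real.log v / (4 * Real.pi * v) := by positivity
  have hfew : ((shallow (Λ n) D).card : ℝ) ≤ δ * v := by
    rw [div_le_iff₀ hε0] at hVL
    have hD1 : (D : ℝ) + 1 ≤ 2 * (ε * √v) := by linarith
    calc ((shallow (Λ n) D).card : ℝ) ≤ 24 * κ * (D + 1) * √v := hshallow D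
      _ ≤ 24 * κ * (2 * (ε * √v)) * √v := by gcongr
      _ = 48 * κ * ε * (√v * √v) := by ring
      _ = δ * v := by rw [hsq, hε]; field_simp
  have e1 : 1 - 3 * δ ≤ (1 - δ) * v * l * (Real.log v / (4 * Real.pi * v)) := by
    have h4 : (1 - δ) * v * l * (Real.log v / (4 * Real.pi * v)) =
        (1 - δ) ^ 2 * Real.log v / (2 * Real.log R) := by rw [hl]; field_simp; ring
    rw [h4, le_div_iff₀ (by positivity)]
    have h5 : (1 - 3 * δ) * (1 + δ) ≤ (1 - δ) ^ 2 := by nlinarith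
    have h6 := mul_le_mul_of_nonneg_right h5 hlogv.le
    have h7 := mul_le_mul_of_nonneg_left hR1 (by linarith : 0 ≤ 2 * (1 - 3 * δ))
    linarith
  calc N * (1 - 3 * δ) ≤ N * ((1 - δ) * v * l * (Real.log v / (4 * Real.pi * v))) :=
        mul_le_mul_of_nonneg_left e1 hN0
    _ = N * ((1 - δ) * v) * l * (Real.log v / (4 * Real.pi * v)) := by ring
    _ ≤ N * (v - (shallow (Λ n) D).card) * l * (Real.log v / (4 * Real.pi * v)) := by
        gcongr
        linarith
    _ ≤ critForm p (F n) f * (Real.log v / (4 * Real.pi * v)) :=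
        mul_le_mul_of_nonneg_right hmain hc

/-- The limiting capacity is attained, and its inverse is the prefactor. -/
lemma exists_capacity {Λ : Finset Site} {F : Set (Config Λ)} (h : H1 p F) (h2 : H2 p F) :
    ∃ θ : ℝ, 0 < θ ∧ (∀ f ∈ admissible p F, θ ≤ critForm p F f) ∧
      (∃ f ∈ admissible p F, critForm p F f = θ) ∧
      Tendsto (fun β : ℝ => ENNReal.ofReal (Real.exp (-β * gammaStar p F)) *
        meanHitTime p β (emptyBox Λ) F) atTop (𝓝 (ENNReal.ofReal (1 / θ))) := by
  obtain ⟨h₀, hh, hmin⟩ := exists_min_critForm h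
  exact ⟨_, critForm_pos h hh, hmin, ⟨h₀, hh, rfl⟩, tendsto_meanHitTime h h2 hh hmin⟩

/-- The asymptotics of the prefactor. -/
theorem isEquivalent_prefactor (hp : p.Metastable) {K : ℕ → ℝ} (hT : TendsToLattice Λ)
    (hH : ∀ᶠ n in atTop, H1 p (F n) ∧ H2 p (F n) ∧ H3 p (F n) L)
    (hS : ∀ ε : ℝ, 0 < ε → ∀ᶠ n in atTop, ShiftInvariantAt p (F n) (ε * √(Λ n).card))
    (hK : ∀ᶠ n in atTop, 0 < K n ∧
      Tendsto (fun β : ℝ => ENNReal.ofReal (Real.exp (-β * gammaStar p (F n))) *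
        meanHitTime p β (emptyBox (Λ n)) (F n)) atTop (𝓝 (ENNReal.ofReal (K n)))) :
    K ~[atTop] fun n => 1 / (numShapes p (F n) : ℝ) *
      (Real.log (Λ n).card / (4 * Real.pi * (Λ n).card)) := by
  refine (isEquivalent_of_tendsto_one ?_).symm
  rw [Metric.tendsto_nhds]
  intro η hη
  obtain ⟨δ, hδ, hδ1, hδη⟩ : ∃ δ : ℝ, 0 < δ ∧ δ ≤ 1 / 4 ∧ 7 * δ < η :=
    ⟨min (1 / 4) (η / 8), by positivity, min_le_left _ _, by
      have := min_le_right (1 / 4) (η / 8)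
      linarith⟩
  filter_upwards [hH, hK, eventually_capacity_le hp hT hH hδ hδ1,
    eventually_le_capacity hp hT hH hS hδ hδ1] with n ⟨h1, h2, h3⟩ ⟨hKpos, hKlim⟩ hup hlow
  obtain ⟨θ, hθ, hmin, ⟨f₀, hf₀, rfl⟩, hlim⟩ := exists_capacity h1 h2
  have hKθ : K n = 1 / critForm p (F n) f₀ :=
    (ENNReal.ofReal_eq_ofReal_iff hKpos.le (one_div_pos.2 hθ).le).1
      (tendsto_nhds_unique hKlim hlim)
  obtain ⟨f, hf, hfle⟩ := hup
  have hlow' := hlow f₀ hf₀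
  set c := Real.log (Λ n).card / (4 * Real.pi * (Λ n).card) with hc
  have hc0 : 0 ≤ c := div_nonneg (Real.log_natCast_nonneg _) (by positivity)
  have hN : (0 : ℝ) < numShapes p (F n) := by exact_mod_cast h3.numShapes_pos hp h1
  have hup' : critForm p (F n) f₀ * c ≤ numShapes p (F n) * (1 + 7 * δ) :=
    (mul_le_mul_of_nonneg_right (hmin f hf) hc0).trans hfle
  have hX : 1 / (numShapes p (F n) : ℝ) * c / K n = critForm p (F n) f₀ * c / numShapes p (F n) := by
    rw [hKθ]
    field_simp
  rw [Pi.div_apply, hX, Real.dist_eq, abs_lt]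
  constructor
  · have : 1 - 3 * δ ≤ critForm p (F n) f₀ * c / numShapes p (F n) := by
      rw [le_div_iff₀ hN]
      linarith
    linarith
  · have : critForm p (F n) f₀ * c / numShapes p (F n) ≤ 1 + 7 * δ := by
      rw [div_le_iff₀ hN]
      linarith
    linarith

end Asymptotics

end Kawasaki

end

theorem mainTheorem1 (p : Kawasaki.Params) (hp : p.Metastable) :
    -- existence of the prefactor, for every fixed finite box
    (∀ (Λ : Finset Kawasaki.Site) (F : Set (Kawasaki.Config Λ)),
      Kawasaki.H1 p F → Kawasaki.H2 p F →
      ∃ K : ℝ, 0 < K ∧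
        Tendsto (fun β : ℝ => ENNReal.ofReal (Real.exp (-β * Kawasaki.gammaStar p F)) *
            Kawasaki.meanHitTime p β (Kawasaki.emptyBox Λ) F)
          atTop (𝓝 (ENNReal.ofReal K))) ∧
    -- asymptotics of the prefactor as the box grows to the whole lattice
    (∀ (Λ : ℕ → Finset Kawasaki.Site) (F : (n : ℕ) → Set (Kawasaki.Config (Λ n))) (L : ℕ)
        (K : ℕ → ℝ),
      Kawasaki.TendsToLattice Λ →
      (∀ᶠ n in atTop, Kawasaki.H1 p (F n) ∧ Kawasaki.H2 p (F n) ∧ Kawasaki.H3 p (F n) L) →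
      (∀ ε : ℝ, 0 < ε → ∀ᶠ n in atTop,
        Kawasaki.ShiftInvariantAt p (F n) (ε * Real.sqrt (Λ n).card)) →
      (∀ᶠ n in atTop, 0 < K n ∧
        Tendsto (fun β : ℝ => ENNReal.ofReal (Real.exp (-β * Kawasaki.gammaStar p (F n))) *
            Kawasaki.meanHitTime p β (Kawasaki.emptyBox (Λ n)) (F n))
          atTop (𝓝 (ENNReal.ofReal (K n)))) →
      K ~[atTop] fun n => 1 / (Kawasaki.numShapes p (F n) : ℝ) *
        (Real.log (Λ n).card / (4 * Real.pi * (Λ n).card))) := by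
  refine ⟨fun Λ F h1 h2 => ?_, fun Λ F L K hT hH hS hK => ?_⟩
  · obtain ⟨θ, hθ, -, -, hlim⟩ := Kawasaki.exists_capacity h1 h2
    exact ⟨1 / θ, one_div_pos.2 hθ, hlim⟩
  · exact Kawasaki.isEquivalent_prefactor hp hT hH hS hK
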